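/- Let $x\cdot y=x^0y^0-\vec x\cdot\vec y$ be the Minkowski product on $\mathbb R^4$, let $\mathcal Z=\{z\in\mathbb R^4: z\cdot z=1,\ z^0>0\}$ be the unit hyperboloid, and let $d\mu(z)=2\delta(z^2-1)\theta(z^0)\,d^4z$ be its invariant measure, that is, $d^3z/z^0$ in the coordinates $\vec z\mapsto(\sqrt{1+|\vec z|^2},\vec z)$. Let $\gamma^0,\dots,\gamma^3$ be Dirac matrices, i.e. complex $4\times4$ matrices with $\gamma^a\gamma^b+\gamma^b\gamma^a=2g^{ab}$, $g=\mathrm{diag}(1,-1,-1,-1)$, and $(\gamma^a)^\dagger=\gamma^0\gamma^a\gamma^0$. Write $\gamma\cdot z=g_{ab}\gamma^az^b$ and $\bar\psi=\psi^\dagger\gamma^0$. Let $\mathcal H$ be the Hilbert space of ($\mu$-a.e. equivalence classes of) measurable functions $f:\mathcal Z\to\mathbb C^4$ with $\int\bar f\,\gamma\cdot z\,f\,d\mu<\infty$, with the scalar product $$(g,f)=\int\overline{g(z)}\;\gamma\cdot z\;f(z)\,d\mu(z).$$ A function $f$ on $\mathcal Z$ is said to belong to $C_0^\infty$ (smooth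 with compact support), respectively to $\mathcal S$ (Schwartz), if $\vec z\mapsto f(\sqrt{1+|\vec z|^2},\vec z)$ has this property on $\mathbb R^3$. For $\kappa>0$, $f\in C_0^\infty$ and $u\in\mathcal Z$ put $$F_\kappa f(u)=\Big(\frac{\kappa}{2\pi}\Big)^{3/2}\int e^{-i\kappa\,u\cdot z\;\gamma\cdot z}\,\gamma\cdot z\,f(z)\,d\mu(z),\qquad F_\kappa^*f(u)=\Big(\frac{\kappa}{2\pi}\Big)^{3/2}\int e^{+i\kappa\,u\cdot z\;\gamma\cdot u}\,\gamma\cdot z\,f(z)\,d\mu(z).$$ Proposition. For every $\kappa>0$, $F_\kappa$ and $F_\kappa^*$ map $C_0^\infty$ into $\mathcal S$ and preserve the scalar product: $(F_\kappa g,F_\kappa f)=(g,f)=(F_\kappa^*g,F_\kappa^*f)$ for all $f,g\in C_0^\infty$. Each of them has a unique extension to a bounded linear operator on $\mathcal H$. These extensions are isometries of $\mathcal H$, they are adjoint to each other, and hence they are unitary. -/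

import Mathlib

open MeasureTheory Matrix
open scoped SchwartzMap ContDiff ComplexConjugate

noncomputable section

namespace DiracHyperboloid

/-- Three-vectors, with Euclidean norm and Lebesgue measure. -/
abbrev Space : Type := EuclideanSpace ℝ (Fin 3)

/-- Four-component spinors. -/
abbrev Spinor : Type := Fin 4 → ℂ

/-- The diagonal of the Minkowski metric, signature `(+,-,-,-)`. -/
def metricSign (a : Fin 4) : ℝ := if a = 0 then 1 else -1

/-- The Minkowski scalar product `x · y` on `ℝ⁴`. -/
def mdot (x y : Fin 4 → ℝ) : ℝ := ∑ a, metricSign a * x a * y a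

/-- The unit hyperboloid `z · z = 1`, `z⁰ > 0`. -/
abbrev Hyp : Type := {z : Fin 4 → ℝ // mdot z z = 1 ∧ 0 < z 0}

/-- The time component of the point of the hyperboloid above `p`. -/
def energy (p : Space) : ℝ := √(1 + ‖p‖ ^ 2)

theorem energy_pos (p : Space) : 0 < energy p := by
  unfold energy; positivity

theorem mdot_self (x : Fin 4 → ℝ) : mdot x x = x 0 ^ 2 - (x 1 ^ 2 + x 2 ^ 2 + x 3 ^ 2) := by
  simp [mdot, metricSign, Fin.sum_univ_four]; ring

/-- The parametrization `p ↦ (√(1 + |p|²), p)` of the hyperboloid. -/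
def lift (p : Space) : Hyp :=
  ⟨Fin.cons (energy p) (fun i => p i), by
    have h : energy p ^ 2 = 1 + ‖p‖ ^ 2 := Real.sq_sqrt (by positivity)
    rw [mdot_self]
    change energy p ^ 2 - (p 0 ^ 2 + p 1 ^ 2 + p 2 ^ 2) = 1
    rw [h, EuclideanSpace.real_norm_sq_eq, Fin.sum_univ_three]; ring, energy_pos p⟩

/-- The spatial part of a point of the hyperboloid. -/
def spatial (z : Hyp) : Space := WithLp.toLp 2 fun i => z.1 i.succ

theorem spatial_lift (p : Space) : spatial (lift p) = p := by
  ext i; simp [spatial, lift]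

theorem lift_spatial (z : Hyp) : lift (spatial z) = z := by
  have h := z.2.1
  rw [mdot_self] at h
  have hn : ‖spatial z‖ ^ 2 = z.1 1 ^ 2 + z.1 2 ^ 2 + z.1 3 ^ 2 := by
    rw [EuclideanSpace.real_norm_sq_eq, Fin.sum_univ_three]; rfl
  apply Subtype.ext
  funext i
  refine Fin.cases ?_ (fun j => ?_) i
  · change √(1 + ‖spatial z‖ ^ 2) = z.1 0
    rw [hn, show 1 + (z.1 1 ^ 2 + z.1 2 ^ 2 + z.1 3 ^ 2) = z.1 0 ^ 2 by linarith,
      Real.sqrt_sq z.2.2.le]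
  · simp [lift, spatial]

theorem continuous_lift : Continuous lift := by
  refine Continuous.subtype_mk (continuous_pi fun i => ?_) _
  refine Fin.cases ?_ (fun j => ?_) i
  · change Continuous fun p : Space => √(1 + ‖p‖ ^ 2)
    fun_prop
  · change Continuous fun p : Space => p j
    fun_prop

/-- The invariant measure `2 δ(z² - 1) θ(z⁰) d⁴z` on the hyperboloid, which is `d³p / z⁰` in the
coordinates `p`. -/
def μH : Measure Hyp :=
  ((volume : Measure Space).withDensity fun p => ENNReal.ofReal (1 / energy p)).map lift

/-- Dirac matrices `γ⁰, …, γ³`: four complex `4 × 4` matrices with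
`γᵃγᵇ + γᵇγᵃ = 2 gᵃᵇ` and `(γᵃ)† = γ⁰ γᵃ γ⁰`. -/
structure DiracMatrices where
  γ : Fin 4 → Matrix (Fin 4) (Fin 4) ℂ
  clifford : ∀ a b, γ a * γ b + γ b * γ a =
    (if a = b then 2 * (metricSign a : ℂ) else 0) • (1 : Matrix (Fin 4) (Fin 4) ℂ)
  adjoint : ∀ a, (γ a)ᴴ = γ 0 * γ a * γ 0

set_option maxHeartbeats 4000000 in
/-- The standard (Dirac) representation. -/
def DiracMatrices.standard : DiracMatrices where
  γ := ![!![1, 0, 0, 0; 0, 1, 0, 0; 0, 0, -1, 0; 0, 0, 0, -1],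
    !![0, 0, 0, 1; 0, 0, 1, 0; 0, -1, 0, 0; -1, 0, 0, 0],
    !![0, 0, 0, -Complex.I; 0, 0, Complex.I, 0; 0, Complex.I, 0, 0; -Complex.I, 0, 0, 0],
    !![0, 0, 1, 0; 0, 0, 0, -1; -1, 0, 0, 0; 0, 1, 0, 0]]
  clifford := by
    intro a b
    fin_cases a <;> fin_cases b <;>
      simp [← Matrix.ext_iff, Fin.forall_fin_succ, metricSign] <;> norm_num
  adjoint := by
    intro a
    fin_cases a <;>
      simp [← Matrix.ext_iff, Fin.forall_fin_succ]

variable (D : DiracMatrices)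

/-- `γ · x = g_{ab} γᵃ xᵇ`. -/
def slash (x : Fin 4 → ℝ) : Matrix (Fin 4) (Fin 4) ℂ :=
  ∑ a, ((metricSign a * x a : ℝ) : ℂ) • D.γ a

/-- The Dirac conjugate `ψ̄ = ψ† γ⁰`. -/
def diracConj (ψ : Spinor) : Spinor := star ψ ᵥ* D.γ 0

/-- The density `ḡ(z) γ·z f(z)` of the scalar product. -/
def density (g f : Hyp → Spinor) (z : Hyp) : ℂ :=
  diracConj D (g z) ⬝ᵥ (slash D z.1 *ᵥ f z)

/-- The scalar product `(g, f) = ∫ ḡ(z) γ·z f(z) dμ(z)`. -/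
def scalar (g f : Hyp → Spinor) : ℂ := ∫ z, density D g f z ∂μH

/-- The class `C₀^∞` on the hyperboloid. -/
def IsTest (f : Hyp → Spinor) : Prop :=
  ContDiff ℝ ∞ (fun p => f (lift p)) ∧ HasCompactSupport (fun p => f (lift p))

/-- The Schwartz class on the hyperboloid. -/
def IsSchwartz (f : Hyp → Spinor) : Prop :=
  ∃ φ : 𝓢(Space, Spinor), ∀ p, f (lift p) = φ p

/-- `F_κ f(u) = (κ/2π)^{3/2} ∫ exp(-iκ u·z γ·z) γ·z f(z) dμ(z)`. -/
def fourierF (κ : ℝ) (f : Hyp → Spinor) (u : Hyp) : Spinor :=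
  (((κ / (2 * Real.pi)) ^ (3 / 2 : ℝ) : ℝ) : ℂ) •
    ∫ z : Hyp, (NormedSpace.exp ((-(Complex.I * κ * mdot u.1 z.1)) • slash D z.1) *
      slash D z.1) *ᵥ f z ∂μH

/-- `F_κ^* f(u) = (κ/2π)^{3/2} ∫ exp(+iκ u·z γ·u) γ·z f(z) dμ(z)`. -/
def fourierFStar (κ : ℝ) (f : Hyp → Spinor) (u : Hyp) : Spinor :=
  (((κ / (2 * Real.pi)) ^ (3 / 2 : ℝ) : ℝ) : ℂ) •
    ∫ z : Hyp, (NormedSpace.exp ((Complex.I * κ * mdot u.1 z.1) • slash D u.1) *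
      slash D z.1) *ᵥ f z ∂μH

/-- The functions of finite norm: measurable, with `∫ f̄ γ·z f dμ < ∞`. -/
def MemH (f : Hyp → Spinor) : Prop :=
  AEStronglyMeasurable f μH ∧ Integrable (density D f f) μH

/-! The matrix of the form `ḡ γ·z f` is the square of a hermitian invertible matrix `boost`.
This serves only to verify the Hilbert space structure. -/

theorem gamma_zero_sq : D.γ 0 * D.γ 0 = 1 := by
  have h := D.clifford 0 0
  rw [if_pos rfl, ← two_smul ℂ (D.γ 0 * D.γ 0), mul_smul] at h
  have := smul_right_injective _ (two_ne_zero (α := ℂ)) h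
  simpa [metricSign] using this

theorem slash_anticomm (x : Fin 4 → ℝ) :
    D.γ 0 * slash D x + slash D x * D.γ 0 = ((2 * x 0 : ℝ) : ℂ) • 1 := by
  have h : D.γ 0 * slash D x + slash D x * D.γ 0 =
      ∑ a, ((metricSign a * x a : ℝ) : ℂ) • (D.γ 0 * D.γ a + D.γ a * D.γ 0) := by
    simp [slash, Finset.mul_sum, Finset.sum_mul, ← Finset.sum_add_distrib]
  rw [h]
  simp only [D.clifford]
  rw [Finset.sum_eq_single 0]
  · simp [metricSign, smul_smul, mul_comm]
  · intro b _ hb; simp [hb.symm]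
  · simp

theorem slash_sq (x : Fin 4 → ℝ) : slash D x * slash D x = ((mdot x x : ℝ) : ℂ) • 1 := by
  have h1 : slash D x * slash D x = ∑ a, ∑ b,
      (((metricSign a * x a) * (metricSign b * x b) : ℝ) : ℂ) • (D.γ a * D.γ b) := by
    rw [slash, Finset.sum_mul]
    refine Finset.sum_congr rfl fun a _ => ?_
    rw [Finset.mul_sum]
    refine Finset.sum_congr rfl fun b _ => ?_
    rw [smul_mul_assoc, mul_smul_comm, smul_smul]; norm_cast
  have h2 : slash D x * slash D x = ∑ a, ∑ b,
      (((metricSign a * x a) * (metricSign b * x b) : ℝ) : ℂ) • (D.γ b * D.γ a) := by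
    rw [h1, Finset.sum_comm]
    refine Finset.sum_congr rfl fun a _ => Finset.sum_congr rfl fun b _ => ?_
    rw [mul_comm (metricSign b * x b)]
  have h3 : (2 : ℂ) • (slash D x * slash D x) = (2 : ℂ) • (((mdot x x : ℝ) : ℂ) • 1) := by
    conv_lhs => rw [two_smul]
    nth_rewrite 1 [h1]
    rw [h2]
    simp only [← Finset.sum_add_distrib, ← smul_add, D.clifford, smul_smul]
    rw [mdot, Complex.ofReal_sum, Finset.mul_sum, Finset.sum_smul]
    refine Finset.sum_congr rfl fun a _ => ?_
    rw [Finset.sum_eq_single a]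
    · rw [if_pos rfl]
      congr 1
      have : metricSign a * metricSign a = 1 := by unfold metricSign; split_ifs <;> norm_num
      have : (metricSign a : ℂ) * metricSign a = 1 := by exact_mod_cast this
      push_cast
      linear_combination 2 * (x a : ℂ) ^ 2 * (metricSign a : ℂ) * this
    · intro b _ hb; simp [hb.symm]
    · simp
  exact smul_right_injective _ (two_ne_zero (α := ℂ)) h3

theorem slash_adjoint (x : Fin 4 → ℝ) : (slash D x)ᴴ = D.γ 0 * slash D x * D.γ 0 := by
  simp [slash, Matrix.conjTranspose_sum, Finset.mul_sum, Finset.sum_mul, D.adjoint]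

def boostNorm (z : Hyp) : ℝ := (√(2 * (1 + z.1 0)))⁻¹

def boost (z : Hyp) : Matrix (Fin 4) (Fin 4) ℂ :=
  (boostNorm z : ℂ) • (1 + D.γ 0 * slash D z.1)

def boostInv (z : Hyp) : Matrix (Fin 4) (Fin 4) ℂ :=
  (boostNorm z : ℂ) • (1 + slash D z.1 * D.γ 0)

theorem boostNorm_sq (z : Hyp) : (boostNorm z : ℂ) * boostNorm z * (2 * (1 + z.1 0)) = 1 := by
  have h : 0 < 2 * (1 + z.1 0) := by linarith [z.2.2]
  have : boostNorm z * boostNorm z * (2 * (1 + z.1 0)) = 1 := by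
    unfold boostNorm
    rw [← mul_inv, Real.mul_self_sqrt h.le, inv_mul_cancel₀ h.ne']
  exact_mod_cast this

theorem boost_adjoint (z : Hyp) : (boost D z)ᴴ = boost D z := by
  simp [boost, Matrix.conjTranspose_mul, slash_adjoint, D.adjoint 0, mul_assoc, gamma_zero_sq]

theorem boost_sq (z : Hyp) : boost D z * boost D z = D.γ 0 * slash D z.1 := by
  have h0 := gamma_zero_sq D
  have h1 := slash_anticomm D z.1
  have h2 : slash D z.1 * slash D z.1 = 1 := by rw [slash_sq, z.2.1]; simp
  have h3 : slash D z.1 * D.γ 0 = ((2 * z.1 0 : ℝ) : ℂ) • 1 - D.γ 0 * slash D z.1 :=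
    eq_sub_of_add_eq' h1
  have h4 : (D.γ 0 * slash D z.1) * (D.γ 0 * slash D z.1) =
      ((2 * z.1 0 : ℝ) : ℂ) • (D.γ 0 * slash D z.1) - 1 := by
    calc _ = D.γ 0 * (slash D z.1 * D.γ 0) * slash D z.1 := by noncomm_ring
      _ = ((2 * z.1 0 : ℝ) : ℂ) • (D.γ 0 * slash D z.1)
          - (D.γ 0 * D.γ 0) * (slash D z.1 * slash D z.1) := by
        rw [h3]; simp [mul_sub, sub_mul, mul_assoc]
      _ = _ := by rw [h0, h2, mul_one]
  have h5 : (1 + D.γ 0 * slash D z.1) * (1 + D.γ 0 * slash D z.1) =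
      ((2 * (1 + z.1 0) : ℝ) : ℂ) • (D.γ 0 * slash D z.1) := by
    rw [add_mul, mul_add, mul_add, h4]
    push_cast
    simp only [mul_add, add_smul, mul_one, one_mul, two_smul]
    abel
  rw [boost, smul_mul_assoc, mul_smul_comm, h5, smul_smul, smul_smul]
  have := boostNorm_sq z
  push_cast
  rw [mul_assoc] at this ⊢
  rw [this, one_smul]

theorem boost_mul_inv (z : Hyp) : boost D z * boostInv D z = 1 := by
  have h0 := gamma_zero_sq D
  have h1 := slash_anticomm D z.1
  have h2 : slash D z.1 * slash D z.1 = 1 := by rw [slash_sq, z.2.1]; simp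
  have h5 : (1 + D.γ 0 * slash D z.1) * (1 + slash D z.1 * D.γ 0) =
      ((2 * (1 + z.1 0) : ℝ) : ℂ) • 1 := by
    calc _ = 1 + (D.γ 0 * slash D z.1 + slash D z.1 * D.γ 0)
          + D.γ 0 * (slash D z.1 * slash D z.1) * D.γ 0 := by noncomm_ring
      _ = _ := by
        rw [h2, mul_one, h0, h1]; push_cast; rw [mul_add, add_smul, mul_one, two_smul]; abel
  rw [boost, boostInv, smul_mul_assoc, mul_smul_comm, h5, smul_smul, smul_smul]
  have := boostNorm_sq z
  push_cast
  rw [mul_assoc] at this ⊢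
  rw [this, one_smul]

theorem boost_inv_mul (z : Hyp) : boostInv D z * boost D z = 1 :=
  mul_eq_one_comm.1 (boost_mul_inv D z)

/-- Spinors with the hermitian norm. -/
abbrev ESpinor : Type := EuclideanSpace ℂ (Fin 4)

def boosted (f : Hyp → Spinor) (z : Hyp) : ESpinor := WithLp.toLp 2 (boost D z *ᵥ f z)

theorem density_eq_inner (g f : Hyp → Spinor) (z : Hyp) :
    density D g f z = inner ℂ (boosted D g z) (boosted D f z) := by
  rw [boosted, boosted, EuclideanSpace.inner_toLp_toLp, dotProduct_comm, density, diracConj,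
    ← Matrix.dotProduct_mulVec, Matrix.mulVec_mulVec, ← boost_sq, ← Matrix.mulVec_mulVec,
    Matrix.star_mulVec, boost_adjoint, ← Matrix.dotProduct_mulVec]

theorem density_self (f : Hyp → Spinor) (z : Hyp) :
    density D f f z = ((‖boosted D f z‖ ^ 2 : ℝ) : ℂ) := by
  rw [density_eq_inner, inner_self_eq_norm_sq_to_K]; norm_cast

theorem continuous_slash : Continuous fun z : Hyp => slash D z.1 := by
  refine continuous_finsetSum _ fun a _ => Continuous.fun_smul ?_ continuous_const
  exact Complex.continuous_ofReal.comp
    (continuous_const.mul ((continuous_apply a).comp continuous_subtype_val))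

theorem continuous_boostNorm : Continuous fun z : Hyp => (boostNorm z : ℂ) := by
  have : ∀ z : Hyp, √(2 * (1 + z.1 0)) ≠ 0 := fun z =>
    (Real.sqrt_pos.2 (by linarith [z.2.2])).ne'
  unfold boostNorm
  exact Complex.continuous_ofReal.comp (Continuous.inv₀ (Real.continuous_sqrt.comp (continuous_const.mul
    (continuous_const.add ((continuous_apply 0).comp continuous_subtype_val)))) this)

theorem continuous_boost : Continuous (boost D) :=
  (continuous_boostNorm).smul (continuous_const.add (continuous_const.mul (continuous_slash D)))

theorem continuous_boostInv : Continuous (boostInv D) :=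
  (continuous_boostNorm).smul (continuous_const.add ((continuous_slash D).mul continuous_const))

theorem aesm_mulVec {A : Hyp → Matrix (Fin 4) (Fin 4) ℂ} (hA : Continuous A) {f : Hyp → Spinor}
    (hf : AEStronglyMeasurable f μH) : AEStronglyMeasurable (fun z => A z *ᵥ f z) μH := by
  refine (aemeasurable_pi_lambda _ fun i => ?_).aestronglyMeasurable
  change AEMeasurable (fun z => ∑ j, A z i j * f z j) μH
  refine Finset.aemeasurable_fun_sum _ fun j _ => AEMeasurable.mul ?_ ?_
  · exact (hA.matrix_elem i j).measurable.aemeasurable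
  · exact (measurable_pi_apply j).comp_aemeasurable hf.aemeasurable

theorem aesm_boosted {f : Hyp → Spinor} (hf : AEStronglyMeasurable f μH) :
    AEStronglyMeasurable (boosted D f) μH :=
  (PiLp.continuous_toLp 2 _).comp_aestronglyMeasurable (aesm_mulVec (continuous_boost D) hf)

theorem memH_iff {f : Hyp → Spinor} (hf : AEStronglyMeasurable f μH) :
    MemH D f ↔ MemLp (boosted D f) 2 μH := by
  rw [memLp_two_iff_integrable_sq_norm (aesm_boosted D hf), MemH]
  have : density D f f = fun z => ((‖boosted D f z‖ ^ 2 : ℝ) : ℂ) := funext (density_self D f)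
  rw [this]
  refine ⟨fun h => ?_, fun h => ⟨hf, h.ofReal⟩⟩
  have h2 := h.2.re
  simp only [RCLike.re_to_complex, Complex.ofReal_re] at h2
  exact h2

theorem boosted_add (f g : Hyp → Spinor) : boosted D (f + g) = boosted D f + boosted D g := by
  funext z; simp [boosted, Matrix.mulVec_add]

theorem boosted_smul (c : ℂ) (f : Hyp → Spinor) : boosted D (c • f) = c • boosted D f := by
  funext z; simp [boosted, Matrix.mulVec_smul]

theorem boosted_congr {f g : Hyp → Spinor} (h : f =ᵐ[μH] g) : boosted D f =ᵐ[μH] boosted D g := by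
  filter_upwards [h] with z hz
  simp [boosted, hz]

theorem density_congr {f f' g g' : Hyp → Spinor} (h : f =ᵐ[μH] f') (h' : g =ᵐ[μH] g') :
    density D f g =ᵐ[μH] density D f' g' := by
  filter_upwards [h, h'] with z hz hz'
  simp [density, hz, hz']

theorem memH_congr {f g : Hyp → Spinor} (h : f =ᵐ[μH] g) (hf : MemH D f) : MemH D g :=
  ⟨hf.1.congr h, hf.2.congr (density_congr D h h)⟩

/-- The equivalence classes (modulo equality almost everywhere) of functions of finite norm. -/
def submoduleH : Submodule ℂ (Hyp →ₘ[μH] Spinor) where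
  carrier := {f | MemH D f}
  zero_mem' := by
    refine memH_congr D (AEEqFun.coeFn_zero (μ := μH) (β := Spinor)).symm ?_
    refine ⟨aestronglyMeasurable_const, ?_⟩
    have : density D 0 0 = 0 := by funext z; simp [density]
    rw [this]; exact integrable_zero _ _ _
  add_mem' := by
    intro f g hf hg
    refine memH_congr D (AEEqFun.coeFn_add f g).symm ?_
    rw [memH_iff D (f.aestronglyMeasurable.add g.aestronglyMeasurable), boosted_add]
    exact ((memH_iff D f.aestronglyMeasurable).1 hf).add ((memH_iff D g.aestronglyMeasurable).1 hg)
  smul_mem' := by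
    intro c f hf
    refine memH_congr D (AEEqFun.coeFn_smul c f).symm ?_
    rw [memH_iff D (f.aestronglyMeasurable.const_smul c), boosted_smul]
    exact ((memH_iff D f.aestronglyMeasurable).1 hf).const_smul c

/-- The Hilbert space `H` of equivalence classes of `ℂ⁴`-valued functions on the hyperboloid with
the scalar product `(g, f) = ∫ ḡ γ·z f dμ`. -/
def HSpace : Type := submoduleH D

instance : AddCommGroup (HSpace D) := inferInstanceAs (AddCommGroup (submoduleH D))

instance : Module ℂ (HSpace D) := inferInstanceAs (Module ℂ (submoduleH D))

/-- A representative of an element of `H`. -/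
def HSpace.rep {D : DiracMatrices} (h : HSpace D) : Hyp → Spinor :=
  ((Subtype.val h : Hyp →ₘ[μH] Spinor) : Hyp → Spinor)

theorem HSpace.memH_rep {D : DiracMatrices} (h : HSpace D) : MemH D h.rep := Subtype.property h

/-- The element of `H` given by a function of finite norm. -/
def HSpace.mk (f : Hyp → Spinor) (hf : MemH D f) : HSpace D :=
  (⟨AEEqFun.mk f hf.1, memH_congr D (AEEqFun.coeFn_mk f hf.1).symm hf⟩ : submoduleH D)

theorem HSpace.rep_mk (f : Hyp → Spinor) (hf : MemH D f) : (HSpace.mk D f hf).rep =ᵐ[μH] f :=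
  AEEqFun.coeFn_mk f hf.1

theorem HSpace.ext_rep {D : DiracMatrices} {g h : HSpace D} (e : g.rep =ᵐ[μH] h.rep) : g = h :=
  Subtype.ext (AEEqFun.ext e)

theorem HSpace.rep_add {D : DiracMatrices} (g h : HSpace D) :
    (g + h).rep =ᵐ[μH] g.rep + h.rep :=
  AEEqFun.coeFn_add (Subtype.val g : Hyp →ₘ[μH] Spinor) (Subtype.val h)

theorem HSpace.rep_smul {D : DiracMatrices} (c : ℂ) (h : HSpace D) :
    (c • h).rep =ᵐ[μH] c • h.rep :=
  AEEqFun.coeFn_smul c (Subtype.val h : Hyp →ₘ[μH] Spinor)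

/-- Comparison with the ordinary `L²` space. -/
def toL2 : HSpace D →ₗ[ℂ] Lp ESpinor 2 (μH) where
  toFun h := ((memH_iff D h.memH_rep.1).1 h.memH_rep).toLp
  map_add' g h := by
    rw [← MemLp.toLp_add]
    refine MemLp.toLp_congr _ _ ?_
    rw [← boosted_add]
    exact boosted_congr D (HSpace.rep_add g h)
  map_smul' c h := by
    rw [RingHom.id_apply, ← MemLp.toLp_const_smul]
    refine MemLp.toLp_congr _ _ ?_
    rw [← boosted_smul]
    exact boosted_congr D (HSpace.rep_smul c h)

theorem toL2_coe (h : HSpace D) : toL2 D h =ᵐ[μH] boosted D h.rep :=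
  MemLp.coeFn_toLp ((memH_iff D h.memH_rep.1).1 h.memH_rep)

theorem scalar_eq_inner (g h : HSpace D) :
    scalar D g.rep h.rep = inner ℂ (toL2 D g) (toL2 D h) := by
  rw [L2.inner_def, scalar]
  refine integral_congr_ae ?_
  filter_upwards [toL2_coe D g, toL2_coe D h] with z h1 h2
  rw [h1, h2, density_eq_inner]

theorem toL2_injective : Function.Injective (toL2 D) := by
  intro g h e
  refine HSpace.ext_rep ?_
  have h1 := toL2_coe D g
  rw [e] at h1
  filter_upwards [h1, toL2_coe D h] with z h2 h3
  have h4 := congrArg (WithLp.ofLp) (h2.symm.trans h3)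
  simp only [boosted] at h4
  have h5 := congrArg (fun v => boostInv D z *ᵥ v) h4
  simpa [Matrix.mulVec_mulVec, boost_inv_mul] using h5

theorem toL2_surjective : Function.Surjective (toL2 D) := by
  intro φ
  let f : Hyp → Spinor := fun z => boostInv D z *ᵥ WithLp.ofLp (φ z)
  have hf : AEStronglyMeasurable f μH := aesm_mulVec (continuous_boostInv D)
    ((PiLp.continuous_ofLp 2 _).comp_aestronglyMeasurable (Lp.aestronglyMeasurable φ))
  have hb : boosted D f = φ := by
    funext z
    simp [boosted, f, Matrix.mulVec_mulVec, boost_mul_inv]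
  have hm : MemH D f := (memH_iff D hf).2 (by rw [hb]; exact Lp.memLp φ)
  refine ⟨HSpace.mk D f hm, Lp.ext ?_⟩
  have := boosted_congr D (HSpace.rep_mk D f hm)
  rw [hb] at this
  exact (toL2_coe D _).trans this

@[reducible]
def coreH : InnerProductSpace.Core ℂ (HSpace D) where
  inner g f := scalar D g.rep f.rep
  conj_inner_symm x y := by
    simp only [scalar_eq_inner]; exact inner_conj_symm _ _
  re_inner_nonneg x := by
    simp only [scalar_eq_inner]; exact inner_self_nonneg
  add_left x y z := by
    simp only [scalar_eq_inner, map_add]; exact inner_add_left _ _ _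
  smul_left x y r := by
    simp only [scalar_eq_inner, map_smul]; exact inner_smul_left _ _ _
  definite x h := by
    rw [scalar_eq_inner, inner_self_eq_zero] at h
    exact toL2_injective D (by rw [h, map_zero])

instance : NormedAddCommGroup (HSpace D) :=
  @InnerProductSpace.Core.toNormedAddCommGroup ℂ (HSpace D) _ _ _ (coreH D)

instance : InnerProductSpace ℂ (HSpace D) := InnerProductSpace.ofCore (coreH D).toCore

theorem inner_def (g f : HSpace D) : inner ℂ g f = scalar D g.rep f.rep := rfl

instance : CompleteSpace (HSpace D) := by
  let e : HSpace D ≃ₗ[ℂ] Lp ESpinor 2 (μH) :=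
    LinearEquiv.ofBijective (toL2 D) ⟨toL2_injective D, toL2_surjective D⟩
  let i : HSpace D ≃ₗᵢ[ℂ] Lp ESpinor 2 (μH) :=
    e.isometryOfInner fun x y => by
      rw [inner_def, scalar_eq_inner]; rfl
  exact i.toIsometryEquiv.completeSpace

/-- The bounded operator `U` on `H` extends the map `T` from its domain `C₀^∞`. -/
def Extends (U : HSpace D →L[ℂ] HSpace D) (T : (Hyp → Spinor) → Hyp → Spinor) : Prop :=
  ∀ f, IsTest f → ∃ (hf : MemH D f) (hT : MemH D (T f)),
    U (HSpace.mk D f hf) = HSpace.mk D (T f) hT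

end DiracHyperboloid

end

/-!
# Unitarity of the Fourier transform on the hyperboloid

The matrix `γ·z` has the eigenvalues `±1`, with the projections `proj D (±1) z`, so that
`fourierF D κ f` at the point `u` is, up to the constant `(κ/2π)^{3/2}`, the value at the space-time
point `κ u` of the solution `diracField D f` of the Dirac equation of mass one whose momentum space
data are given by `f`.

*Schwartz class.* On the surfaces `t = c √(κ² + |x|²)` with `|c| ≤ 1` the plane wave
superpositions with test function amplitudes decrease faster than any power of `|x|`, uniformly
in `c` (`waveInt_decay'`). This rests on integration by parts, with factors `1 / (1 + (1 - c²) p²)`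
that keep the estimates uniform up to the light cone. Derivatives along the hyperboloid are
superpositions of the same kind, and the Schwartz property follows.

*Isometry of* `fourierF`. The norm of `fourierF D κ f` is the flux of the conserved Dirac current
through the hyperboloid `κ 𝓩`. By the uniform decay and Gauss' theorem it equals the charge at
time zero (`IsConserved.flux_eq`), which Plancherel's theorem turns into the norm of `f`
(`scalar_fourierF`). Hence `fourierF` extends to an isometry `U`, and by Fubini's theorem its
adjoint `V` extends `fourierFStar` (`scalar_fourierF_left`).

*Unitarity.* It remains to show that `V` is injective. The point is that `U V` does not enlarge
supports: if `f` and `g` are test functions with disjoint supports, then `fourierFStar D κ f` and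
`fourierFStar D κ g` are orthogonal (`scalar_fourierFStar_eq_zero`). Indeed, after a band limited
regularization, `fourierF` of `fourierFStar D κ f` is a superposition of solutions of the Dirac
equation whose initial data are concentrated near the points of `κ supp f`. Different points of a
hyperboloid have space-like distance, and solutions vanish at space-like distance from their initial
data (`IsDiracSolution.eq_zero_of_lt_norm`). Now let `V h = 0` and split `h = a + b` into its
restrictions to a closed set and to the complement. Then `V a = -V b`, while `V a` and `V b` are
orthogonal, so `V a = 0`. Thus all restrictions of `h` are orthogonal to the range of `U`, which
means that `h` is pointwise orthogonal to all transforms `fourierF D κ f`. At each point these span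
the spinors, since `f` may be concentrated near a point of the hyperboloid, and so `h = 0`
(`adjoint_fourierOp_injective`).
-/

open scoped FourierTransform

noncomputable section

namespace DiracHyperboloid

/-! ### The energy function and integration over the hyperboloid -/

theorem energy_sq (p : Space) : energy p ^ 2 = 1 + ‖p‖ ^ 2 := Real.sq_sqrt (by positivity)

theorem one_le_energy (p : Space) : 1 ≤ energy p := by
  have := energy_sq p
  nlinarith [energy_pos p, sq_nonneg ‖p‖]

theorem norm_le_energy (p : Space) : ‖p‖ ≤ energy p :=
  Real.le_sqrt_of_sq_le (by linarith)

theorem abs_coord_le_energy (p : Space) (j : Fin 3) : |p j| ≤ energy p :=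
  (PiLp.norm_apply_le p j).trans (norm_le_energy p)

theorem energy_neg (p : Space) : energy (-p) = energy p := by simp [energy]

theorem one_add_norm_le_two_mul_energy (p : Space) : 1 + ‖p‖ ≤ 2 * energy p := by
  linarith [one_le_energy p, norm_le_energy p]

theorem contDiff_energy : ContDiff ℝ ∞ energy := by
  unfold energy
  exact ContDiff.sqrt (contDiff_const.add (contDiff_id.norm_sq ℝ)) fun p => by positivity

theorem continuous_energy : Continuous energy := contDiff_energy.continuous

theorem hasTemperateGrowth_energy : Function.HasTemperateGrowth energy := by
  have := Function.hasTemperateGrowth_one_add_norm_sq_rpow Space (1 / 2)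
  have e : energy = fun p => (1 + ‖p‖ ^ 2) ^ (1 / 2 : ℝ) := by
    funext p
    unfold energy
    rw [Real.sqrt_eq_rpow]
  rw [e]
  exact this

theorem hasTemperateGrowth_energy_inv : Function.HasTemperateGrowth fun p => (energy p)⁻¹ := by
  have := Function.hasTemperateGrowth_one_add_norm_sq_rpow Space (-(1 / 2))
  have e : (fun p => (energy p)⁻¹) = fun p => (1 + ‖p‖ ^ 2) ^ (-(1 / 2) : ℝ) := by
    funext p
    unfold energy
    rw [Real.sqrt_eq_rpow, Real.rpow_neg (by positivity)]
  rw [e]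
  exact this

theorem hasTemperateGrowth_coord (j : Fin 3) : Function.HasTemperateGrowth fun p : Space => p j :=
  (EuclideanSpace.proj j : Space →L[ℝ] ℝ).hasTemperateGrowth

theorem hasFDerivAt_energy (p : Space) :
    HasFDerivAt energy ((energy p)⁻¹ • innerSL ℝ p) p := by
  have h1 : HasFDerivAt (fun p : Space => 1 + ‖p‖ ^ 2) (2 • innerSL ℝ p) p :=
    ((hasStrictFDerivAt_norm_sq p).hasFDerivAt).const_add 1
  have h2 := h1.sqrt (by positivity)
  refine h2.congr_fderiv ?_
  change (1 / (2 * energy p)) • (2 • innerSL ℝ p) = _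
  rw [← Nat.cast_smul_eq_nsmul ℝ, smul_smul]
  congr 1
  have := (energy_pos p).ne'
  field_simp
  norm_num

theorem continuous_spatial : Continuous spatial :=
  (PiLp.continuous_toLp 2 _).comp
    (continuous_pi fun i => (continuous_apply i.succ).comp continuous_subtype_val)

theorem measurableEmbedding_lift : MeasurableEmbedding lift :=
  (Homeomorph.mk ⟨lift, spatial, spatial_lift, lift_spatial⟩ continuous_lift
    continuous_spatial).isClosedEmbedding.measurableEmbedding

theorem measurable_energy_density :
    Measurable fun p : Space => ENNReal.ofReal (1 / energy p) :=
  (measurable_const.div continuous_energy.measurable).ennreal_ofReal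

theorem integral_μH {V : Type*} [NormedAddCommGroup V] [NormedSpace ℝ V] (G : Hyp → V) :
    ∫ z, G z ∂μH = ∫ p, (energy p)⁻¹ • G (lift p) := by
  rw [μH, measurableEmbedding_lift.integral_map,
    integral_withDensity_eq_integral_toReal_smul measurable_energy_density (by simp)]
  refine integral_congr_ae (Filter.Eventually.of_forall fun p => ?_)
  simp only
  rw [ENNReal.toReal_ofReal (by have := energy_pos p; positivity), one_div]

theorem integrable_μH_iff {V : Type*} [NormedAddCommGroup V] [NormedSpace ℝ V] (G : Hyp → V) :
    Integrable G μH ↔ Integrable fun p => (energy p)⁻¹ • G (lift p) := by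
  rw [μH, measurableEmbedding_lift.integrable_map_iff,
    integrable_withDensity_iff_integrable_smul' measurable_energy_density (by simp)]
  refine integrable_congr (Filter.Eventually.of_forall fun p => ?_)
  simp only [Function.comp]
  rw [ENNReal.toReal_ofReal (by have := energy_pos p; positivity), one_div]

theorem ae_μH_iff {P : Hyp → Prop} : (∀ᵐ z ∂μH, P z) ↔ ∀ᵐ p : Space, P (lift p) := by
  rw [μH, measurableEmbedding_lift.ae_map_iff, ae_withDensity_iff measurable_energy_density]
  refine Filter.eventually_congr (Filter.Eventually.of_forall fun p => ?_)
  simp [energy_pos p]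

theorem aestronglyMeasurable_μH_of_continuous {V : Type*} [TopologicalSpace V]
    [TopologicalSpace.PseudoMetrizableSpace V] {f : Hyp → V}
    (hf : Continuous fun p => f (lift p)) : AEStronglyMeasurable f μH := by
  have : Continuous f := by
    have h := hf.comp continuous_spatial
    convert h using 1
    funext z
    simp [lift_spatial]
  exact this.aestronglyMeasurable

/-! ### Spectral projections of `γ · z` -/

variable (D : DiracMatrices)

/-- For `s = ±1`, the projection `(1 + s γ·z) / 2` onto the eigenspace of `γ·z` with
eigenvalue `s`. -/
def proj (s : ℝ) (z : Hyp) : Matrix (Fin 4) (Fin 4) ℂ :=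
  (1 / 2 : ℂ) • (1 + (s : ℂ) • slash D z.1)

theorem slash_mul_slash (z : Hyp) : slash D z.1 * slash D z.1 = 1 := by
  rw [slash_sq, z.2.1]; simp

theorem slash_mul_proj {s : ℝ} (hs : s * s = 1) (z : Hyp) :
    slash D z.1 * proj D s z = (s : ℂ) • proj D s z := by
  have hs' : (s : ℂ) * s = 1 := by exact_mod_cast hs
  simp only [proj, mul_smul_comm, mul_add, mul_one, slash_mul_slash, smul_add, smul_smul]
  rw [add_comm]
  congr 2
  · ring
  · linear_combination (-1 / 2 : ℂ) * hs'

theorem proj_add_proj (z : Hyp) : proj D 1 z + proj D (-1) z = 1 := by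
  simp only [proj, ← smul_add]
  rw [show (1 + ((1 : ℝ) : ℂ) • slash D z.1 + (1 + ((-1 : ℝ) : ℂ) • slash D z.1)) =
    (2 : ℂ) • (1 : Matrix (Fin 4) (Fin 4) ℂ) by rw [two_smul]; push_cast; module]
  rw [smul_smul]; norm_num

theorem proj_sub_proj (z : Hyp) : proj D 1 z - proj D (-1) z = slash D z.1 := by
  simp only [proj]; push_cast; module

theorem proj_mul_proj {s : ℝ} (hs : s * s = 1) (z : Hyp) :
    proj D s z * proj D s z = proj D s z := by
  have hs' : (s : ℂ) * s = 1 := by exact_mod_cast hs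
  conv_lhs => enter [1]; rw [proj]
  rw [smul_mul_assoc, add_mul, one_mul, smul_mul_assoc, slash_mul_proj D hs, smul_smul, hs',
    one_smul, ← two_smul ℂ, smul_smul]
  norm_num

theorem proj_mul_proj_neg {s : ℝ} (hs : s * s = 1) (z : Hyp) :
    proj D s z * proj D (-s) z = 0 := by
  have hs' : (s : ℂ) * s = 1 := by exact_mod_cast hs
  conv_lhs => enter [1]; rw [proj]
  rw [smul_mul_assoc, add_mul, one_mul, smul_mul_assoc, slash_mul_proj D (by simpa using hs),
    smul_smul]
  push_cast
  rw [mul_neg, hs', neg_smul, one_smul, add_neg_cancel, smul_zero]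

/-- The spectral decomposition of `exp (w γ·z)`. It comes from the continuous ring homomorphism
`(a, b) ↦ a P₊ + b P₋` from `ℂ × ℂ` to matrices. -/
theorem exp_smul_slash (w : ℂ) (z : Hyp) : NormedSpace.exp (w • slash D z.1) =
    Complex.exp w • proj D 1 z + Complex.exp (-w) • proj D (-1) z := by
  have h11 := proj_mul_proj D (s := 1) (by norm_num) z
  have h22 := proj_mul_proj D (s := -1) (by norm_num) z
  have h12 := proj_mul_proj_neg D (s := 1) (by norm_num) z
  have h21 := proj_mul_proj_neg D (s := -1) (by norm_num) z
  rw [neg_neg] at h21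
  let _ : NormedRing (Matrix (Fin 4) (Fin 4) ℂ) := Matrix.linftyOpNormedRing
  let φ : ℂ × ℂ →+* Matrix (Fin 4) (Fin 4) ℂ :=
    { toFun := fun x => x.1 • proj D 1 z + x.2 • proj D (-1) z
      map_one' := by simp [proj_add_proj]
      map_zero' := by simp
      map_mul' := fun x y => by
        simp [add_mul, mul_add, h11, h22, h12, h21, smul_smul, mul_comm]
      map_add' := fun x y => by simp only [Prod.fst_add, Prod.snd_add]; module }
  have hφ : Continuous φ :=
    (continuous_fst.smul continuous_const).add (continuous_snd.smul continuous_const)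
  have h := NormedSpace.map_exp φ hφ (w, -w)
  have e1 : φ (w, -w) = w • slash D z.1 := by
    change w • proj D 1 z + (-w) • proj D (-1) z = _
    rw [← proj_sub_proj]; module
  rw [e1] at h
  refine h.symm.trans ?_
  change (NormedSpace.exp (w, -w)).1 • proj D 1 z + (NormedSpace.exp (w, -w)).2 • proj D (-1) z = _
  rw [Prod.fst_exp, Prod.snd_exp, Complex.exp_eq_exp_ℂ]

theorem exp_smul_slash_mul_slash (w : ℂ) (z : Hyp) :
    NormedSpace.exp (w • slash D z.1) * slash D z.1 =
      Complex.exp w • proj D 1 z - Complex.exp (-w) • proj D (-1) z := by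
  have hc (s : ℝ) : proj D s z * slash D z.1 = slash D z.1 * proj D s z := by
    simp [proj, add_mul, mul_add]
  rw [exp_smul_slash, add_mul, smul_mul_assoc, smul_mul_assoc, hc, hc,
    slash_mul_proj D (by norm_num), slash_mul_proj D (by norm_num)]
  simp [sub_eq_add_neg]

/-! ### Rapidly decreasing amplitudes -/

section Amplitudes

variable {V : Type*} [NormedAddCommGroup V] [NormedSpace ℂ V]

/-- Continuous functions on momentum space that decrease faster than any power of the energy. -/
structure RapidDecay (a : Space → V) : Prop where
  continuous : Continuous a
  bound : ∀ k : ℕ, ∃ C, ∀ p, energy p ^ k * ‖a p‖ ≤ C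

/-- Smooth functions of compact support on momentum space. -/
structure TestFn (a : Space → V) : Prop where
  contDiff : ContDiff ℝ ∞ a
  compact : HasCompactSupport a

theorem exists_bound_energy_pow {F : Type*} [NormedAddCommGroup F] [NormedSpace ℝ F]
    {m : Space → F} (hm : m.HasTemperateGrowth) :
    ∃ (k : ℕ) (C : ℝ), 0 ≤ C ∧ ∀ p, ‖m p‖ ≤ C * energy p ^ k := by
  obtain ⟨k, C, hC, h⟩ := hm.norm_iteratedFDeriv_le_uniform 0
  refine ⟨k, C * 2 ^ k, by positivity, fun p => ?_⟩
  have h1 := h 0 le_rfl p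
  rw [norm_iteratedFDeriv_zero] at h1
  refine h1.trans ?_
  rw [mul_assoc, ← mul_pow]
  have := one_add_norm_le_two_mul_energy p
  gcongr

theorem TestFn.rapidDecay {a : Space → V} (ha : TestFn a) : RapidDecay a where
  continuous := ha.contDiff.continuous
  bound k := by
    have hc : Continuous fun p => energy p ^ k * ‖a p‖ :=
      (continuous_energy.pow k).mul ha.contDiff.continuous.norm
    obtain ⟨p₀, h⟩ := hc.exists_forall_ge_of_hasCompactSupport ha.compact.norm.mul_left
    exact ⟨_, h⟩

theorem rapidDecay_schwartz (φ : 𝓢(Space, V)) : RapidDecay φ where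
  continuous := φ.continuous
  bound k := by
    obtain ⟨C₀, -, h0⟩ := φ.decay 0 0
    obtain ⟨C₁, -, h1⟩ := φ.decay k 0
    refine ⟨2 ^ k * (C₀ + C₁), fun p => ?_⟩
    have e : energy p ^ k ≤ 2 ^ k * (1 + ‖p‖ ^ k) := by
      have h2 : energy p ≤ 2 * max 1 ‖p‖ := by
        rw [energy, Real.sqrt_le_left (by positivity)]
        nlinarith [le_max_left 1 ‖p‖, le_max_right 1 ‖p‖, norm_nonneg p]
      calc energy p ^ k ≤ (2 * max 1 ‖p‖) ^ k := pow_le_pow_left₀ (energy_pos p).le h2 k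
        _ = 2 ^ k * (max 1 ‖p‖) ^ k := mul_pow _ _ _
        _ ≤ _ := by
          gcongr
          rcases max_cases 1 ‖p‖ with h | h <;> rw [h.1]
          · rw [one_pow]; linarith [pow_nonneg (norm_nonneg p) k]
          · linarith
    have h0' := h0 p
    have h1' := h1 p
    rw [norm_iteratedFDeriv_zero] at h0' h1'
    rw [pow_zero, one_mul] at h0'
    calc energy p ^ k * ‖φ p‖ ≤ 2 ^ k * (1 + ‖p‖ ^ k) * ‖φ p‖ := by gcongr
      _ = 2 ^ k * (‖φ p‖ + ‖p‖ ^ k * ‖φ p‖) := by ring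
      _ ≤ _ := by gcongr

theorem RapidDecay.exists_bound {a : Space → V} (ha : RapidDecay a) (k : ℕ) :
    ∃ C, 0 ≤ C ∧ ∀ p, energy p ^ k * ‖a p‖ ≤ C := by
  obtain ⟨C, hC⟩ := ha.bound k
  have := energy_pos 0
  exact ⟨C, le_trans (by positivity) (hC 0), hC⟩

theorem integrable_energy_pow_inv : Integrable fun p : Space => ((energy p) ^ 4)⁻¹ := by
  have h := (integrable_one_add_norm (E := Space) (μ := volume) (r := 4) (by simp; norm_num)).const_mul
    (2 ^ 4)
  refine h.mono' ?_ (Filter.Eventually.of_forall fun p => ?_)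
  · exact ((continuous_energy.pow 4).inv₀ fun p => (pow_pos (energy_pos p) 4).ne').aestronglyMeasurable
  · have h1 := one_add_norm_le_two_mul_energy p
    have h2 := energy_pos p
    rw [Real.norm_of_nonneg (by positivity), Real.rpow_neg (by positivity)]
    norm_cast
    rw [← div_eq_mul_inv, le_div_iff₀ (by positivity), inv_mul_le_iff₀ (by positivity)]
    calc (1 + ‖p‖) ^ 4 ≤ (2 * energy p) ^ 4 := by gcongr
      _ = _ := by push_cast; ring

theorem RapidDecay.integrable {a : Space → V} (ha : RapidDecay a) : Integrable a := by
  obtain ⟨C, hC⟩ := ha.bound 4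
  refine (integrable_energy_pow_inv.const_mul C).mono' ha.continuous.aestronglyMeasurable
    (Filter.Eventually.of_forall fun p => ?_)
  have h2 := energy_pos p
  rw [← div_eq_mul_inv, le_div_iff₀ (by positivity), mul_comm]
  exact hC p

theorem RapidDecay.of_norm_le {W : Type*} [NormedAddCommGroup W] [NormedSpace ℂ W]
    {a : Space → V} {b : Space → W} (ha : RapidDecay a) (hb : Continuous b)
    {C : ℝ} (k : ℕ) (h : ∀ p, ‖b p‖ ≤ C * energy p ^ k * ‖a p‖) : RapidDecay b := by
  refine ⟨hb, fun n => ?_⟩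
  obtain ⟨K, hK0, hK⟩ := ha.exists_bound (n + k)
  refine ⟨|C| * K, fun p => ?_⟩
  have h2 := energy_pos p
  calc energy p ^ n * ‖b p‖ ≤ energy p ^ n * (|C| * energy p ^ k * ‖a p‖) := by
        gcongr
        refine (h p).trans ?_
        gcongr
        exact le_abs_self C
    _ = |C| * (energy p ^ (n + k) * ‖a p‖) := by ring
    _ ≤ _ := by gcongr; exact hK p

theorem RapidDecay.smul {a : Space → V} (ha : RapidDecay a) {m : Space → ℂ}
    (hm : m.HasTemperateGrowth) : RapidDecay fun p => m p • a p := by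
  obtain ⟨k, C, hC, h⟩ := exists_bound_energy_pow hm
  refine ha.of_norm_le (hm.1.continuous.smul ha.continuous) (C := C) k fun p => ?_
  rw [norm_smul]
  gcongr
  exact h p

theorem RapidDecay.real_smul {a : Space → V} (ha : RapidDecay a) {m : Space → ℝ}
    (hm : m.HasTemperateGrowth) : RapidDecay fun p => m p • a p := by
  obtain ⟨k, C, hC, h⟩ := exists_bound_energy_pow hm
  refine ha.of_norm_le (hm.1.continuous.smul ha.continuous) (C := C) k fun p => ?_
  rw [norm_smul]
  gcongr
  exact h p

theorem RapidDecay.add {a b : Space → V} (ha : RapidDecay a) (hb : RapidDecay b) :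
    RapidDecay fun p => a p + b p := by
  refine ⟨ha.continuous.add hb.continuous, fun k => ?_⟩
  obtain ⟨C, hC⟩ := ha.bound k
  obtain ⟨C', hC'⟩ := hb.bound k
  refine ⟨C + C', fun p => ?_⟩
  have h2 := energy_pos p
  calc energy p ^ k * ‖a p + b p‖ ≤ energy p ^ k * (‖a p‖ + ‖b p‖) := by
        gcongr; exact norm_add_le _ _
    _ ≤ _ := by rw [mul_add]; exact add_le_add (hC p) (hC' p)

theorem TestFn.real_smul {a : Space → V} (ha : TestFn a) {m : Space → ℝ}
    (hm : ContDiff ℝ ∞ m) : TestFn fun p => m p • a p :=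
  ⟨hm.smul ha.contDiff, ha.compact.smul_left⟩

/-- The partial derivative in the direction of the `j`-th coordinate. -/
def pd (j : Fin 3) (a : Space → V) (p : Space) : V := fderiv ℝ a p (EuclideanSpace.single j 1)

theorem TestFn.pd {a : Space → V} (ha : TestFn a) (j : Fin 3) : TestFn (pd j a) :=
  ⟨(ha.contDiff.fderiv_right (m := ∞) (by simp)).clm_apply contDiff_const,
    ha.compact.fderiv_apply (𝕜 := ℝ) _⟩

theorem TestFn.mulCoord {a : Space → V} (ha : TestFn a) (j : Fin 3) :
    TestFn fun p => p j • a p :=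
  ha.real_smul (hasTemperateGrowth_coord j).1

theorem TestFn.mulEnergy {a : Space → V} (ha : TestFn a) : TestFn fun p => energy p • a p :=
  ha.real_smul contDiff_energy

/-! ### Superpositions of plane waves of mass one -/

/-- The superposition `∫ exp (-i (t E(p) - x · p)) a(p) d³p` of plane waves. -/
def waveInt (a : Space → V) (t : ℝ) (x : Space) : V :=
  ∫ p, Complex.exp (-(Complex.I * ((t * energy p - inner ℝ x p : ℝ) : ℂ))) • a p

theorem norm_exp_phase (r : ℝ) : ‖Complex.exp (-(Complex.I * (r : ℂ)))‖ = 1 := by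
  rw [show -(Complex.I * (r : ℂ)) = ((-r : ℝ) : ℂ) * Complex.I by push_cast; ring,
    Complex.norm_exp_ofReal_mul_I]

theorem continuous_phase (t : ℝ) (x : Space) : Continuous fun p : Space =>
    Complex.exp (-(Complex.I * ((t * energy p - inner ℝ x p : ℝ) : ℂ))) := by
  have := continuous_energy
  fun_prop

theorem integrable_wave {a : Space → V} (ha : Integrable a) (t : ℝ) (x : Space) :
    Integrable fun p =>
      Complex.exp (-(Complex.I * ((t * energy p - inner ℝ x p : ℝ) : ℂ))) • a p := by
  refine ha.norm.mono' ((continuous_phase t x).aestronglyMeasurable.smul ha.1)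
    (Filter.Eventually.of_forall fun p => ?_)
  rw [norm_smul, norm_exp_phase, one_mul]

theorem norm_waveInt_le (a : Space → V) (t : ℝ) (x : Space) :
    ‖waveInt a t x‖ ≤ ∫ p, ‖a p‖ := by
  refine (norm_integral_le_integral_norm _).trans (le_of_eq ?_)
  refine integral_congr_ae (Filter.Eventually.of_forall fun p => ?_)
  simp only [norm_smul, norm_exp_phase, one_mul]

theorem waveInt_add {a b : Space → V} (ha : Integrable a) (hb : Integrable b) (t : ℝ) (x : Space) :
    waveInt (fun p => a p + b p) t x = waveInt a t x + waveInt b t x := by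
  simp only [waveInt, smul_add]
  exact integral_add (integrable_wave ha t x) (integrable_wave hb t x)

theorem waveInt_sub {a b : Space → V} (ha : Integrable a) (hb : Integrable b) (t : ℝ) (x : Space) :
    waveInt (fun p => a p - b p) t x = waveInt a t x - waveInt b t x := by
  simp only [waveInt, smul_sub]
  exact integral_sub (integrable_wave ha t x) (integrable_wave hb t x)

theorem waveInt_smul (c : ℂ) (a : Space → V) (t : ℝ) (x : Space) :
    waveInt (fun p => c • a p) t x = c • waveInt a t x := by
  simp only [waveInt]
  rw [← integral_smul]
  refine integral_congr_ae (Filter.Eventually.of_forall fun p => ?_)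
  simp only [smul_comm c]

theorem waveInt_real_smul (c : ℝ) (a : Space → V) (t : ℝ) (x : Space) :
    waveInt (fun p => c • a p) t x = c • waveInt a t x := by
  have := waveInt_smul (c : ℂ) a t x
  simpa only [Complex.coe_smul] using this

/-- The differential of `waveInt a` with respect to `(t, x)`: `i ∂ₜ` multiplies the amplitude by the
energy, and `-i ∂ₖ` multiplies it by `pₖ`. -/
def waveDeriv (a : Space → V) (y : ℝ × Space) : ℝ × Space →L[ℝ] V :=
  (ContinuousLinearMap.fst ℝ ℝ Space).smulRight
      (-Complex.I • waveInt (fun p => energy p • a p) y.1 y.2) +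
    ∑ k : Fin 3, ((EuclideanSpace.proj k : Space →L[ℝ] ℝ).comp
      (ContinuousLinearMap.snd ℝ ℝ Space)).smulRight
        (Complex.I • waveInt (fun p => p k • a p) y.1 y.2)

theorem RapidDecay.mulEnergy {a : Space → V} (ha : RapidDecay a) :
    RapidDecay fun p => energy p • a p := ha.real_smul hasTemperateGrowth_energy

theorem RapidDecay.mulCoord {a : Space → V} (ha : RapidDecay a) (j : Fin 3) :
    RapidDecay fun p => p j • a p := ha.real_smul (hasTemperateGrowth_coord j)

theorem continuous_waveInt {a : Space → V} (ha : Integrable a) :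
    Continuous fun y : ℝ × Space => waveInt a y.1 y.2 := by
  refine continuous_of_dominated (bound := fun p => ‖a p‖) (fun y => (integrable_wave ha y.1 y.2).1)
    (fun y => Filter.Eventually.of_forall fun p => ?_) ha.norm
    (Filter.Eventually.of_forall fun p => ?_)
  · rw [norm_smul, norm_exp_phase, one_mul]
  · fun_prop

variable [CompleteSpace V]

theorem hasFDerivAt_waveInt {a : Space → V} (ha : RapidDecay a) (y : ℝ × Space) :
    HasFDerivAt (fun y : ℝ × Space => waveInt a y.1 y.2) (waveDeriv a y) y := by
  let e (y : ℝ × Space) (p : Space) : ℂ :=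
    Complex.exp (-(Complex.I * ((y.1 * energy p - inner ℝ y.2 p : ℝ) : ℂ)))
  let P (k : Fin 3) : ℝ × Space →L[ℝ] ℝ := (EuclideanSpace.proj k : Space →L[ℝ] ℝ).comp
      (ContinuousLinearMap.snd ℝ ℝ Space)
  let T : ℝ × Space →L[ℝ] ℝ := ContinuousLinearMap.fst ℝ ℝ Space
  let F' (y : ℝ × Space) (p : Space) : ℝ × Space →L[ℝ] V :=
    T.smulRight (-Complex.I • e y p • energy p • a p) +
      ∑ k, (P k).smulRight (Complex.I • e y p • p k • a p)
  have hiE : Integrable fun p => -Complex.I • e y p • energy p • a p :=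
    (integrable_wave ha.mulEnergy.integrable y.1 y.2).smul (-Complex.I)
  have hik (k : Fin 3) : Integrable fun p => Complex.I • e y p • p k • a p :=
    (integrable_wave (ha.mulCoord k).integrable y.1 y.2).smul Complex.I
  let LT : V →L[ℝ] (ℝ × Space →L[ℝ] V) := ContinuousLinearMap.smulRightL ℝ _ V T
  let LP (k : Fin 3) : V →L[ℝ] (ℝ × Space →L[ℝ] V) := ContinuousLinearMap.smulRightL ℝ _ V (P k)
  have hF'i : Integrable (F' y) := by
    refine (LT.integrable_comp hiE).add (integrable_finsetSum _ fun k _ => ?_)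
    exact (LP k).integrable_comp (hik k)
  have hint : ∫ p, F' y p = waveDeriv a y := by
    have h1 : ∫ p, F' y p = (∫ p, LT (-Complex.I • e y p • energy p • a p)) +
        ∑ k, ∫ p, LP k (Complex.I • e y p • p k • a p) := by
      rw [← integral_finsetSum _ fun k _ => (LP k).integrable_comp (hik k),
        ← integral_add (LT.integrable_comp hiE)
          (integrable_finsetSum _ fun k _ => (LP k).integrable_comp (hik k))]
      rfl
    rw [h1, LT.integral_comp_comm hiE]
    simp_rw [fun k => (LP k).integral_comp_comm (hik k)]
    simp only [integral_smul]
    rfl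
  have hF : ∀ (y : ℝ × Space) (p : Space), HasFDerivAt (fun y => e y p • a p) (F' y p) y := by
    intro y p
    have h1 : HasFDerivAt (fun y : ℝ × Space => y.1 * energy p - inner ℝ y.2 p)
        (energy p • T - (innerSL ℝ p).comp (ContinuousLinearMap.snd ℝ ℝ Space)) y := by
      have : HasFDerivAt (fun y : ℝ × Space => energy p * y.1 - inner ℝ p y.2)
        (energy p • T - (innerSL ℝ p).comp (ContinuousLinearMap.snd ℝ ℝ Space)) y :=
        (energy p • T - (innerSL ℝ p).comp (ContinuousLinearMap.snd ℝ ℝ Space)).hasFDerivAt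
      convert! this using 2 with z
      rw [mul_comm, real_inner_comm]
    have h2 := (((Complex.ofRealCLM.hasFDerivAt.comp y h1).const_mul Complex.I).neg.cexp).smul_const (a p)
    refine h2.congr_fderiv ?_
    refine ContinuousLinearMap.ext fun v => ?_
    have hin : inner ℝ p v.2 = ∑ k, v.2 k * p k := by
      simp [PiLp.inner_apply]
    have hc : (inner ℝ p v.2 : ℝ) • a p = ∑ k, v.2 k • p k • a p := by
      rw [hin, Finset.sum_smul]; simp only [smul_smul]
    have hs : ∑ k, v.2 k • Complex.I • e y p • p k • a p =
        (Complex.I * e y p) • (inner ℝ p v.2 : ℝ) • a p := by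
      rw [hc, Finset.smul_sum]
      refine Finset.sum_congr rfl fun k _ => ?_
      simp only [← Complex.coe_smul, smul_smul]
      congr 1; ring
    have hF : F' y p v = v.1 • -Complex.I • e y p • energy p • a p +
        ∑ k, v.2 k • Complex.I • e y p • p k • a p := by
      simp only [F', _root_.add_apply, _root_.sum_apply, ContinuousLinearMap.smulRight_apply]
      rfl
    rw [hF, hs]
    change (e y p * -(Complex.I * ((energy p * v.1 - inner ℝ p v.2 : ℝ) : ℂ))) • a p = _
    simp only [← Complex.coe_smul, smul_smul, ← add_smul]
    congr 1
    push_cast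
    ring
  rw [← hint]
  refine hasFDerivAt_integral_of_dominated_of_fderiv_le (s := Set.univ) (𝕜 := ℝ)
    (F := fun y p => e y p • a p) (F' := F')
    (bound := fun p => ‖T‖ * ‖energy p • a p‖ + ∑ k, ‖P k‖ * ‖p k • a p‖) Filter.univ_mem
    (Filter.Eventually.of_forall fun y => (integrable_wave ha.integrable y.1 y.2).1)
    (integrable_wave ha.integrable y.1 y.2) hF'i.1
    (Filter.Eventually.of_forall fun p z _ => ?_) ?_
    (Filter.Eventually.of_forall fun p z _ => hF z p)
  · refine (norm_add_le _ _).trans (add_le_add (le_of_eq ?_) ((norm_sum_le _ _).trans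
      (Finset.sum_le_sum fun k _ => le_of_eq ?_)))
    · rw [ContinuousLinearMap.norm_smulRight_apply, norm_smul _ (e z p • _), norm_smul (e z p),
        norm_exp_phase]; simp
    · rw [ContinuousLinearMap.norm_smulRight_apply, norm_smul _ (e z p • _), norm_smul (e z p),
        norm_exp_phase]; simp
  · exact (ha.mulEnergy.integrable.norm.const_mul _).add
      (integrable_finsetSum _ fun k _ => (ha.mulCoord k).integrable.norm.const_mul _)

/-- Integration by parts in momentum space; the phase `t E(p) - x · p` has the gradient
`t p / E(p) - x`. -/
theorem waveInt_integration_by_parts {g : Space → V} (hg : TestFn g) (j : Fin 3)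
    (t : ℝ) (x : Space) :
    x j • waveInt g t x - t • waveInt (fun p => (p j * (energy p)⁻¹) • g p) t x =
      Complex.I • waveInt (pd j g) t x := by
  let e (p : Space) : ℂ := Complex.exp (-(Complex.I * ((t * energy p - inner ℝ x p : ℝ) : ℂ)))
  let e' (p : Space) : Space →L[ℝ] ℂ :=
    (e p * -Complex.I) • (Complex.ofRealCLM.comp
      (t • ((energy p)⁻¹ • innerSL ℝ p) - innerSL ℝ x))
  have he : ∀ p, HasFDerivAt e (e' p) p := by
    intro p
    have h1 : HasFDerivAt (fun p : Space => t * energy p - inner ℝ x p)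
        (t • ((energy p)⁻¹ • innerSL ℝ p) - innerSL ℝ x) p :=
      ((hasFDerivAt_energy p).const_mul t).sub (innerSL ℝ x).hasFDerivAt
    refine ((((Complex.ofRealCLM.hasFDerivAt.comp p h1).const_mul Complex.I).neg.cexp)).congr_fderiv ?_
    refine ContinuousLinearMap.ext fun v => ?_
    simp [e', e]
    ring
  have hv : TestFn fun p => (p j * (energy p)⁻¹) • g p :=
    hg.real_smul ((hasTemperateGrowth_coord j).mul hasTemperateGrowth_energy_inv).1
  have hval : ∀ p, e' p (EuclideanSpace.single j 1) • g p =
      (Complex.I * x j) • (e p • g p) - (Complex.I * t) • e p • (p j * (energy p)⁻¹) • g p := by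
    intro p
    have h1 : innerSL ℝ x (EuclideanSpace.single j 1) = x j := by
      rw [innerSL_apply_apply, EuclideanSpace.inner_single_right]; simp
    have h2 : innerSL ℝ p (EuclideanSpace.single j 1) = p j := by
      rw [innerSL_apply_apply, EuclideanSpace.inner_single_right]; simp
    simp only [e', _root_.smul_apply, ContinuousLinearMap.comp_apply,
      _root_.sub_apply, h1, h2, ← Complex.coe_smul (p j * (energy p)⁻¹), smul_smul,
      ← sub_smul]
    congr 1
    simp
    ring
  have hi1 : Integrable fun p => (Complex.I * x j) • (e p • g p) :=
    (integrable_wave hg.rapidDecay.integrable t x).smul (Complex.I * x j)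
  have hi2 : Integrable fun p => (Complex.I * t) • e p • (p j * (energy p)⁻¹) • g p :=
    (integrable_wave hv.rapidDecay.integrable t x).smul (Complex.I * t)
  have key := integral_bilinear_hasFDerivAt_right_eq_neg_left_of_integrable
    (B := ContinuousLinearMap.lsmul ℝ ℂ) (f := e) (f' := e') (g := g) (g' := fderiv ℝ g)
    (v := EuclideanSpace.single j 1) (μ := volume)
    (by
      simp only [ContinuousLinearMap.lsmul_apply, hval]
      exact hi1.sub hi2)
    (integrable_wave (hg.pd j).rapidDecay.integrable t x)
    (integrable_wave hg.rapidDecay.integrable t x) (fun p _ => he p)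
    (fun p _ => (hg.contDiff.differentiable (by simp)).differentiableAt.hasFDerivAt)
  simp only [ContinuousLinearMap.lsmul_apply, hval] at key
  rw [integral_sub hi1 hi2] at key
  simp only [integral_smul] at key
  change waveInt (pd j g) t x = -((Complex.I * x j) • waveInt g t x -
    (Complex.I * t) • waveInt (fun p => (p j * (energy p)⁻¹) • g p) t x) at key
  rw [key, smul_neg, smul_sub, smul_smul, smul_smul, ← mul_assoc, ← mul_assoc, Complex.I_mul_I]
  simp only [← Complex.coe_smul]
  module

end Amplitudes

/-! ### Rapid decay along spacelike hyperboloids -/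

section Decay

variable {V : Type*} [NormedAddCommGroup V] [NormedSpace ℂ V]

/-- The power `(1 + S |p|²)⁻ⁿ`. For `S = 1 - c²`, the factor `(1 + S |p|²) / E(p)²` is the coefficient
of `|x|²` in `|x|² - t² |p|² / E(p)²` on the surface `t = c √(1 + |x|²)`. Amplitudes
are divided by it in `waveInt_hyperboloid_identity`. -/
def damp (S : ℝ) (n : ℕ) (p : Space) : ℝ := ((1 + S * ‖p‖ ^ 2)⁻¹) ^ n

theorem damp_base_pos {S : ℝ} (hS : 0 ≤ S) (p : Space) : 0 < 1 + S * ‖p‖ ^ 2 := by positivity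

theorem contDiff_damp {S : ℝ} (hS : 0 ≤ S) (n : ℕ) : ContDiff ℝ ∞ (damp S n) := by
  unfold damp
  exact ((contDiff_const.add (contDiff_const.mul (contDiff_id.norm_sq ℝ))).inv
    fun p => (damp_base_pos hS p).ne').pow n

theorem damp_nonneg {S : ℝ} (hS : 0 ≤ S) (n : ℕ) (p : Space) : 0 ≤ damp S n p := by
  unfold damp; positivity

theorem damp_le_one {S : ℝ} (hS : 0 ≤ S) (n : ℕ) (p : Space) : damp S n p ≤ 1 := by
  have : (1 + S * ‖p‖ ^ 2)⁻¹ ≤ 1 := inv_le_one_of_one_le₀ (by nlinarith [sq_nonneg ‖p‖])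
  exact pow_le_one₀ (by positivity) this

theorem damp_succ_mul {S : ℝ} (hS : 0 ≤ S) (n : ℕ) (p : Space) :
    damp S (n + 1) p * (1 + S * ‖p‖ ^ 2) = damp S n p := by
  have := (damp_base_pos hS p).ne'
  simp only [damp, pow_succ]
  field_simp

theorem hasFDerivAt_damp {S : ℝ} (hS : 0 ≤ S) (n : ℕ) (p : Space) :
    HasFDerivAt (damp S n) (-(2 * n * S * damp S (n + 1) p) • innerSL ℝ p) p := by
  have h1 : HasFDerivAt (fun p : Space => 1 + S * ‖p‖ ^ 2) (S • 2 • innerSL ℝ p) p :=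
    (((hasStrictFDerivAt_norm_sq p).hasFDerivAt).const_mul S).const_add 1
  have h0 := (damp_base_pos hS p).ne'
  have h2 : HasDerivAt (fun y : ℝ => (y⁻¹) ^ n)
      (-(n * ((1 + S * ‖p‖ ^ 2)⁻¹) ^ (n + 1))) (1 + S * ‖p‖ ^ 2) := by
    have := (hasDerivAt_inv h0).pow n
    refine this.congr_deriv ?_
    rcases n with _ | n
    · simp
    · simp only [Nat.add_sub_cancel, inv_pow]
      field_simp
      ring
  refine (h2.comp_hasFDerivAt p h1).congr_fderiv ?_
  rw [← Nat.cast_smul_eq_nsmul ℝ, smul_smul, smul_smul]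
  congr 1
  simp only [damp]
  push_cast
  ring

theorem TestFn.damp {a : Space → V} (ha : TestFn a) {S : ℝ} (hS : 0 ≤ S) (n : ℕ) :
    TestFn fun p => damp S n p • a p := ha.real_smul (contDiff_damp hS n)

theorem pd_damp_smul {h : Space → V} (hh : TestFn h) {S : ℝ} (hS : 0 ≤ S) (n : ℕ) (j : Fin 3) :
    pd j (fun p => damp S n p • h p) = fun p => damp S n p • pd j h p -
      (2 * n * S) • damp S (n + 1) p • p j • h p := by
  funext p
  have h1 := (hasFDerivAt_damp hS n p).fun_smul
    (hh.contDiff.differentiable (by simp)).differentiableAt.hasFDerivAt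
  have h2 : inner ℝ p (EuclideanSpace.single j 1) = p j := by
    rw [EuclideanSpace.inner_single_right]; simp
  rw [pd, h1.fderiv]
  simp only [_root_.add_apply, _root_.smul_apply, ContinuousLinearMap.smulRight_apply,
    innerSL_apply_apply, h2, pd, smul_eq_mul]
  module

variable [CompleteSpace V]

/-- Integration by parts applied twice, with the vector fields `x + t p / E(p)` and
`x - t p / E(p)`, whose product is `|x|² - t² |p|² / E(p)²`. -/
theorem waveInt_gradient_sq {g : Space → V} (hg : TestFn g) (t : ℝ) (x : Space) :
    (‖x‖ ^ 2) • waveInt g t x - (t ^ 2) • waveInt (fun p => (‖p‖ ^ 2 * (energy p ^ 2)⁻¹) • g p) t x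
      = Complex.I • ∑ j, (x j • waveInt (pd j g) t x +
        t • waveInt (pd j fun p => (p j * (energy p)⁻¹) • g p) t x) := by
  have hv (j : Fin 3) {g : Space → V} (hg : TestFn g) :
      TestFn fun p => (p j * (energy p)⁻¹) • g p :=
    hg.real_smul ((hasTemperateGrowth_coord j).mul hasTemperateGrowth_energy_inv).1
  have hj (j : Fin 3) : (x j ^ 2) • waveInt g t x -
      (t ^ 2) • waveInt (fun p => (p j * (energy p)⁻¹) • (p j * (energy p)⁻¹) • g p) t x =
      Complex.I • (x j • waveInt (pd j g) t x +
        t • waveInt (pd j fun p => (p j * (energy p)⁻¹) • g p) t x) := by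
    have h1 := waveInt_integration_by_parts hg j t x
    have h2 := waveInt_integration_by_parts (hv j hg) j t x
    rw [smul_add, smul_comm Complex.I, smul_comm Complex.I, ← h1, ← h2]
    module
  rw [Finset.smul_sum, ← Finset.sum_congr rfl fun j _ => hj j, Finset.sum_sub_distrib,
    ← Finset.sum_smul, ← Finset.smul_sum, ← EuclideanSpace.real_norm_sq_eq]
  congr 2
  have hi (j : Fin 3) := (hv j (hv j hg)).rapidDecay.integrable
  simp only [Fin.sum_univ_three]
  rw [← waveInt_add (hi 0) (hi 1), ← waveInt_add ((hi 0).fun_add (hi 1)) (hi 2)]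
  congr 1
  funext p
  rw [EuclideanSpace.real_norm_sq_eq, Fin.sum_univ_three]
  have := (energy_pos p).ne'
  simp only [smul_smul, ← add_smul]
  congr 1
  field_simp

/-- The gain of one power of `E(q)` on the surface `t = c √(κ² + |x|²)`: after division by
`1 + (1 - c²) |p|²`, the identity `waveInt_gradient_sq` expresses `E(q)² ∫ …` by integrals with at
most one factor `E(q)` and amplitudes of the same form. -/
theorem waveInt_hyperboloid_identity {a : Space → V} (ha : TestFn a) (n : ℕ) {κ c : ℝ} (hκ : κ ≠ 0)
    (hc : c ^ 2 ≤ 1) (q : Space) :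
    (energy q ^ 2) • waveInt (fun p => damp (1 - c ^ 2) n p • a p) (κ * c * energy q) (κ • q) =
      waveInt (fun p => damp (1 - c ^ 2) (n + 1) p • energy p ^ 2 • a p)
        (κ * c * energy q) (κ • q) +
      (Complex.I * (κ⁻¹ : ℝ)) • ∑ j,
        (q j • waveInt (pd j fun p => damp (1 - c ^ 2) (n + 1) p • energy p ^ 2 • a p)
            (κ * c * energy q) (κ • q) +
          (c * energy q) • waveInt
            (pd j fun p => damp (1 - c ^ 2) (n + 1) p • (p j * energy p) • a p)
            (κ * c * energy q) (κ • q)) := by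
  have hS : 0 ≤ 1 - c ^ 2 := by linarith
  have hE : TestFn fun p => energy p ^ 2 • a p := ha.real_smul (contDiff_energy.pow 2)
  have hg := hE.damp hS (n + 1)
  have h := waveInt_gradient_sq hg (κ * c * energy q) (κ • q)
  have e1 (j : Fin 3) : (fun p => (p j * (energy p)⁻¹) • damp (1 - c ^ 2) (n + 1) p •
      energy p ^ 2 • a p) = fun p => damp (1 - c ^ 2) (n + 1) p • (p j * energy p) • a p := by
    funext p
    have := (energy_pos p).ne'
    simp only [smul_smul]
    congr 1
    field_simp
  simp only [e1] at h
  have hP : TestFn fun p : Space => ‖p‖ ^ 2 • a p := ha.real_smul (contDiff_id.norm_sq ℝ)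
  have e2 : waveInt (fun p => (‖p‖ ^ 2 * (energy p ^ 2)⁻¹) • damp (1 - c ^ 2) (n + 1) p •
      energy p ^ 2 • a p) (κ * c * energy q) (κ • q) =
      waveInt (fun p => damp (1 - c ^ 2) (n + 1) p • ‖p‖ ^ 2 • a p) (κ * c * energy q) (κ • q) := by
    congr 1
    funext p
    have := (energy_pos p).ne'
    simp only [smul_smul]
    congr 1
    field_simp
  have e3 : waveInt (fun p => damp (1 - c ^ 2) n p • a p) (κ * c * energy q) (κ • q) =
      waveInt (fun p => damp (1 - c ^ 2) (n + 1) p • energy p ^ 2 • a p)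
        (κ * c * energy q) (κ • q) -
      c ^ 2 • waveInt (fun p => damp (1 - c ^ 2) (n + 1) p • ‖p‖ ^ 2 • a p)
        (κ * c * energy q) (κ • q) := by
    rw [← waveInt_real_smul, ← waveInt_sub hg.rapidDecay.integrable
      ((hP.damp hS (n + 1)).rapidDecay.integrable.fun_smul (c ^ 2))]
    congr 1
    funext p
    rw [← damp_succ_mul hS n p, energy_sq]
    module
  rw [e2] at h
  rw [e3]
  have hn : ‖κ • q‖ ^ 2 = κ ^ 2 * (energy q ^ 2 - 1) := by
    rw [energy_sq, norm_smul, mul_pow, Real.norm_eq_abs, sq_abs]; ring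
  rw [hn] at h
  generalize waveInt (fun p => damp (1 - c ^ 2) (n + 1) p • energy p ^ 2 • a p)
    (κ * c * energy q) (κ • q) = X at *
  generalize waveInt (fun p => damp (1 - c ^ 2) (n + 1) p • ‖p‖ ^ 2 • a p)
    (κ * c * energy q) (κ • q) = Y at *
  have hsum : ∀ Z W : Fin 3 → V, ∑ j, ((κ • q) j • Z j + (κ * c * energy q) • W j) =
      κ • ∑ j, (q j • Z j + (c * energy q) • W j) := by
    intro Z W
    rw [Finset.smul_sum]
    refine Finset.sum_congr rfl fun j _ => ?_
    rw [PiLp.smul_apply, smul_eq_mul]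
    module
  rw [hsum] at h
  generalize (∑ j, (q j • waveInt (pd j fun p => damp (1 - c ^ 2) (n + 1) p • energy p ^ 2 • a p)
            (κ * c * energy q) (κ • q) +
          (c * energy q) • waveInt
            (pd j fun p => damp (1 - c ^ 2) (n + 1) p • (p j * energy p) • a p)
            (κ * c * energy q) (κ • q))) = Z at *
  have h2 := congrArg (fun v => ((κ ^ 2)⁻¹ : ℝ) • v) h
  have e4 : ((κ ^ 2)⁻¹ : ℝ) • Complex.I • κ • Z = (Complex.I * (κ⁻¹ : ℝ)) • Z := by
    rw [smul_comm, ← smul_smul, Complex.coe_smul, smul_smul]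
    congr 2
    field_simp
  have e5 : ((κ ^ 2)⁻¹ : ℝ) • ((κ ^ 2 * (energy q ^ 2 - 1)) • X - (κ * c * energy q) ^ 2 • Y) =
      (energy q ^ 2 - 1) • X - (c ^ 2 * energy q ^ 2) • Y := by
    rw [smul_sub, smul_smul, smul_smul]
    congr 2
    · field_simp
    · field_simp
  rw [e4, e5] at h2
  rw [← h2]
  module

/-- Superpositions of plane waves with test function amplitudes decrease rapidly on the
surfaces `t = c √(κ² + |x|²)`, uniformly for `|c| ≤ 1`. The factors `damp` make the statement
accessible to induction on the power `N`. -/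
theorem waveInt_decay {κ : ℝ} (hκ : κ ≠ 0) (N : ℕ) : ∀ (n : ℕ) (a : Space → V), TestFn a →
    ∃ C, ∀ (c : ℝ), c ^ 2 ≤ 1 → ∀ q : Space, energy q ^ N *
      ‖waveInt (fun p => damp (1 - c ^ 2) n p • a p) (κ * c * energy q) (κ • q)‖ ≤ C := by
  induction N with
  | zero =>
    intro n a ha
    refine ⟨∫ p, ‖a p‖, fun c hc q => ?_⟩
    have hS : 0 ≤ 1 - c ^ 2 := by linarith
    rw [pow_zero, one_mul]
    refine (norm_waveInt_le _ _ _).trans (integral_mono (ha.damp hS n).rapidDecay.integrable.norm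
      ha.rapidDecay.integrable.norm fun p => ?_)
    simp only [norm_smul, Real.norm_of_nonneg (damp_nonneg hS n p)]
    exact mul_le_of_le_one_left (norm_nonneg _) (damp_le_one hS n p)
  | succ N ih =>
    have hpd : ∀ (n : ℕ) (h : Space → V), TestFn h → ∀ j, ∃ C, ∀ (c : ℝ), c ^ 2 ≤ 1 → ∀ q : Space,
        energy q ^ N * ‖waveInt (pd j fun p => damp (1 - c ^ 2) n p • h p)
          (κ * c * energy q) (κ • q)‖ ≤ C := by
      intro n h hh j
      obtain ⟨C₁, h1⟩ := ih n (pd j h) (hh.pd j)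
      obtain ⟨C₂, h2⟩ := ih (n + 1) _ (hh.mulCoord j)
      refine ⟨C₁ + 2 * n * C₂, fun c hc q => ?_⟩
      have hS : 0 ≤ 1 - c ^ 2 := by linarith
      have hE := energy_pos q
      have h1' := h1 c hc q
      have h2' := h2 c hc q
      rw [pd_damp_smul hh hS, waveInt_sub ((hh.pd j).damp hS n).rapidDecay.integrable
        (((hh.mulCoord j).damp hS (n + 1)).rapidDecay.integrable.fun_smul (2 * n * (1 - c ^ 2))),
        waveInt_real_smul]
      refine (mul_le_mul_of_nonneg_left (norm_sub_le _ _) (by positivity)).trans ?_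
      rw [mul_add, norm_smul, Real.norm_of_nonneg (by positivity)]
      refine add_le_add h1' ?_
      have hC : 0 ≤ C₂ := le_trans (by positivity) h2'
      calc _ = (2 * n * (1 - c ^ 2)) * (energy q ^ N * ‖waveInt (fun p =>
              damp (1 - c ^ 2) (n + 1) p • p j • h p) (κ * c * energy q) (κ • q)‖) := by ring
        _ ≤ (2 * n * (1 - c ^ 2)) * C₂ := by gcongr
        _ ≤ _ := mul_le_mul_of_nonneg_right
          (mul_le_of_le_one_right (by positivity) (by linarith [sq_nonneg c])) hC
    intro n a ha
    have hE : TestFn fun p => energy p ^ 2 • a p := ha.real_smul (contDiff_energy.pow 2)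
    have hP (j : Fin 3) : TestFn fun p : Space => (p j * energy p) • a p :=
      ha.real_smul ((hasTemperateGrowth_coord j).1.mul contDiff_energy)
    obtain ⟨C₀, h0⟩ := ih (n + 1) _ hE
    choose C₁ h1 using hpd (n + 1) _ hE
    choose C₂ h2 using fun j => hpd (n + 1) _ (hP j) j
    refine ⟨C₀ + |κ⁻¹| * ∑ j, (C₁ j + C₂ j), fun c hc q => ?_⟩
    have hEq := energy_pos q
    have h1E := one_le_energy q
    have hcabs : |c| ≤ 1 := by rwa [← sq_le_one_iff_abs_le_one]
    refine le_of_mul_le_mul_left ?_ hEq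
    have hid := congrArg norm (waveInt_hyperboloid_identity ha n hκ hc q)
    rw [norm_smul, Real.norm_of_nonneg (by positivity)] at hid
    calc _ = energy q ^ N * (energy q ^ 2 * ‖waveInt (fun p => damp (1 - c ^ 2) n p • a p)
          (κ * c * energy q) (κ • q)‖) := by ring
      _ ≤ energy q ^ N * (‖waveInt (fun p => damp (1 - c ^ 2) (n + 1) p • energy p ^ 2 • a p)
            (κ * c * energy q) (κ • q)‖ + |κ⁻¹| * ∑ j,
          (energy q * ‖waveInt (pd j fun p => damp (1 - c ^ 2) (n + 1) p • energy p ^ 2 • a p)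
            (κ * c * energy q) (κ • q)‖ +
          energy q * ‖waveInt
            (pd j fun p => damp (1 - c ^ 2) (n + 1) p • (p j * energy p) • a p)
            (κ * c * energy q) (κ • q)‖)) := by
        rw [hid]
        gcongr
        refine (norm_add_le _ _).trans ?_
        gcongr
        rw [norm_smul, norm_mul, Complex.norm_I, one_mul, Complex.norm_real, Real.norm_eq_abs]
        gcongr
        refine (norm_sum_le _ _).trans (Finset.sum_le_sum fun j _ => (norm_add_le _ _).trans ?_)
        rw [norm_smul, norm_smul, norm_mul, Real.norm_eq_abs, Real.norm_eq_abs,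
          Real.norm_of_nonneg hEq.le]
        gcongr
        · exact abs_coord_le_energy q j
        · exact mul_le_of_le_one_left hEq.le hcabs
      _ = energy q ^ N * ‖waveInt (fun p => damp (1 - c ^ 2) (n + 1) p • energy p ^ 2 • a p)
            (κ * c * energy q) (κ • q)‖ + |κ⁻¹| * ∑ j,
          energy q * (energy q ^ N * ‖waveInt (pd j fun p => damp (1 - c ^ 2) (n + 1) p •
            energy p ^ 2 • a p) (κ * c * energy q) (κ • q)‖ +
          energy q ^ N * ‖waveInt
            (pd j fun p => damp (1 - c ^ 2) (n + 1) p • (p j * energy p) • a p)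
            (κ * c * energy q) (κ • q)‖) := by
        simp only [Finset.mul_sum, mul_add]
        congr 1
        refine Finset.sum_congr rfl fun j _ => ?_
        ring
      _ ≤ energy q * C₀ + |κ⁻¹| * ∑ j, energy q * (C₁ j + C₂ j) := by
        have h0' := h0 c hc q
        have hC : 0 ≤ C₀ := le_trans (by positivity) h0'
        refine add_le_add (h0'.trans (le_mul_of_one_le_left hC h1E))
          (mul_le_mul_of_nonneg_left (Finset.sum_le_sum fun j _ => ?_) (abs_nonneg _))
        exact mul_le_mul_of_nonneg_left (add_le_add (h1 j c hc q) (h2 j c hc q)) hEq.le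
      _ = _ := by rw [← Finset.mul_sum]; ring

/-- The uniform rapid decay of `waveInt a` on the surfaces `t = c √(κ² + |x|²)`, `|c| ≤ 1`. -/
theorem waveInt_decay' {κ : ℝ} (hκ : κ ≠ 0) (N : ℕ) {a : Space → V} (ha : TestFn a) :
    ∃ C, ∀ (c : ℝ), c ^ 2 ≤ 1 → ∀ q : Space,
      energy q ^ N * ‖waveInt a (κ * c * energy q) (κ • q)‖ ≤ C := by
  obtain ⟨C, h⟩ := waveInt_decay hκ N 0 a ha
  refine ⟨C, fun c hc q => ?_⟩
  simpa [damp] using h c hc q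

end Decay

/-! ### Restrictions of plane wave superpositions to the hyperboloid are Schwartz functions -/

section Schwartz

variable {V : Type*} [NormedAddCommGroup V] [NormedSpace ℂ V]

/-- Smooth functions whose derivatives of order at most `n` decrease rapidly. -/
def DecayUpTo {W : Type*} [NormedAddCommGroup W] [NormedSpace ℝ W] (n : ℕ) (f : Space → W) : Prop :=
  ContDiff ℝ ∞ f ∧ ∀ m ≤ n, ∀ k : ℕ, ∃ C, ∀ q, ‖q‖ ^ k * ‖iteratedFDeriv ℝ m f q‖ ≤ C

section General

variable {W W' : Type*} [NormedAddCommGroup W] [NormedSpace ℝ W] [NormedAddCommGroup W']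
  [NormedSpace ℝ W']

theorem DecayUpTo.add {n : ℕ} {f g : Space → W} (hf : DecayUpTo n f) (hg : DecayUpTo n g) :
    DecayUpTo n fun q => f q + g q := by
  refine ⟨hf.1.add hg.1, fun m hm k => ?_⟩
  obtain ⟨C, h⟩ := hf.2 m hm k
  obtain ⟨C', h'⟩ := hg.2 m hm k
  refine ⟨C + C', fun q => ?_⟩
  have hadd := iteratedFDeriv_add_apply (x := q) (i := m)
    (hf.1.contDiffAt.of_le (by exact_mod_cast le_top))
    (hg.1.contDiffAt.of_le (by exact_mod_cast le_top))
  have : iteratedFDeriv ℝ m (fun q => f q + g q) q =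
    iteratedFDeriv ℝ m f q + iteratedFDeriv ℝ m g q := hadd
  rw [this]
  calc _ ≤ ‖q‖ ^ k * (‖iteratedFDeriv ℝ m f q‖ + ‖iteratedFDeriv ℝ m g q‖) := by
        gcongr; exact norm_add_le _ _
    _ ≤ _ := by rw [mul_add]; exact add_le_add (h q) (h' q)

theorem DecayUpTo.clm_comp {n : ℕ} {f : Space → W} (hf : DecayUpTo n f) (L : W →L[ℝ] W') :
    DecayUpTo n fun q => L (f q) := by
  refine ⟨L.contDiff.comp hf.1, fun m hm k => ?_⟩
  obtain ⟨C, h⟩ := hf.2 m hm k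
  refine ⟨‖L‖ * C, fun q => ?_⟩
  have h1 := L.norm_iteratedFDeriv_comp_left (n := m) (N := ∞) (hf.1.contDiffAt (x := q))
    (by exact_mod_cast le_top)
  calc _ ≤ ‖q‖ ^ k * (‖L‖ * ‖iteratedFDeriv ℝ m f q‖) := by gcongr; exact h1
    _ = ‖L‖ * (‖q‖ ^ k * ‖iteratedFDeriv ℝ m f q‖) := by ring
    _ ≤ _ := by gcongr; exact h q

theorem DecayUpTo.zero (n : ℕ) : DecayUpTo n fun _ : Space => (0 : W) := by
  refine ⟨contDiff_const, fun m _ k => ⟨0, fun q => ?_⟩⟩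
  have : iteratedFDeriv ℝ m (fun _ : Space => (0 : W)) q = 0 := by
    simp [iteratedFDeriv_fun_zero]
  simp [this]

theorem DecayUpTo.sum {ι : Type*} (s : Finset ι) {n : ℕ} {f : ι → Space → W}
    (hf : ∀ i, DecayUpTo n (f i)) : DecayUpTo n fun q => ∑ i ∈ s, f i q := by
  classical
  induction s using Finset.induction_on with
  | empty => simpa using DecayUpTo.zero n
  | insert i s hi ih => simpa [Finset.sum_insert hi] using (hf i).add ih

theorem DecayUpTo.smul {n : ℕ} {f : Space → W} (hf : DecayUpTo n f) {m : Space → ℝ}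
    (hm : m.HasTemperateGrowth) : DecayUpTo n fun q => m q • f q := by
  refine ⟨hm.1.smul hf.1, fun j hj k => ?_⟩
  obtain ⟨l, K, hK, hml⟩ := hm.norm_iteratedFDeriv_le_uniform n
  choose C₀ h0 using fun i : ℕ => hf.2 (j - i) ((Nat.sub_le _ _).trans hj) k
  choose C₁ h1 using fun i : ℕ => hf.2 (j - i) ((Nat.sub_le _ _).trans hj) (k + l)
  refine ⟨∑ i ∈ Finset.range (j + 1), (j.choose i : ℝ) * (K * 2 ^ l * (C₀ i + C₁ i)), fun q => ?_⟩
  have hle := norm_iteratedFDeriv_smul_le (𝕜 := ℝ) (N := ∞) hm.1 hf.1 q (n := j)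
    (by exact_mod_cast le_top)
  calc _ ≤ ‖q‖ ^ k * ∑ i ∈ Finset.range (j + 1), (j.choose i : ℝ) * ‖iteratedFDeriv ℝ i m q‖ *
        ‖iteratedFDeriv ℝ (j - i) f q‖ := by gcongr
    _ = ∑ i ∈ Finset.range (j + 1), (j.choose i : ℝ) * (‖iteratedFDeriv ℝ i m q‖ *
        (‖q‖ ^ k * ‖iteratedFDeriv ℝ (j - i) f q‖)) := by
      rw [Finset.mul_sum]; exact Finset.sum_congr rfl fun i _ => by ring
    _ ≤ _ := by
      refine Finset.sum_le_sum fun i hi => ?_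
      have hin : i ≤ n := (Nat.lt_succ_iff.1 (Finset.mem_range.1 hi)).trans hj
      have e : (1 + ‖q‖) ^ l ≤ 2 ^ l * (1 + ‖q‖ ^ l) := by
        have h2 : 1 + ‖q‖ ≤ 2 * max 1 ‖q‖ := by
          linarith [le_max_left 1 ‖q‖, le_max_right 1 ‖q‖]
        calc (1 + ‖q‖) ^ l ≤ (2 * max 1 ‖q‖) ^ l := pow_le_pow_left₀ (by positivity) h2 l
          _ = 2 ^ l * (max 1 ‖q‖) ^ l := mul_pow _ _ _
          _ ≤ _ := by
            gcongr
            rcases max_cases 1 ‖q‖ with h | h <;> rw [h.1]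
            · rw [one_pow]; linarith [pow_nonneg (norm_nonneg q) l]
            · linarith
      refine mul_le_mul_of_nonneg_left ?_ (Nat.cast_nonneg _)
      calc _ ≤ (K * (1 + ‖q‖) ^ l) * (‖q‖ ^ k * ‖iteratedFDeriv ℝ (j - i) f q‖) := by
            exact mul_le_mul_of_nonneg_right (hml i hin q) (by positivity)
        _ ≤ (K * (2 ^ l * (1 + ‖q‖ ^ l))) * (‖q‖ ^ k * ‖iteratedFDeriv ℝ (j - i) f q‖) := by
            gcongr
        _ = K * 2 ^ l * (‖q‖ ^ k * ‖iteratedFDeriv ℝ (j - i) f q‖ +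
            ‖q‖ ^ (k + l) * ‖iteratedFDeriv ℝ (j - i) f q‖) := by ring
        _ ≤ _ := mul_le_mul_of_nonneg_left (add_le_add (h0 i q) (h1 i q)) (by positivity)

theorem DecayUpTo.succ {n : ℕ} {f : Space → W} (h0 : DecayUpTo 0 f)
    (h : DecayUpTo n (fderiv ℝ f)) : DecayUpTo (n + 1) f := by
  refine ⟨h0.1, fun m hm k => ?_⟩
  rcases m with _ | m
  · exact h0.2 0 le_rfl k
  · obtain ⟨C, hC⟩ := h.2 m (by omega) k
    refine ⟨C, fun q => ?_⟩
    rw [← norm_iteratedFDeriv_fderiv]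
    exact hC q

end General

/-- The restriction of `waveInt a` to the hyperboloid `t² - |x|² = κ²`; for `κ < 0` this is the
sheet with `t < 0`. -/
def surfInt (κ : ℝ) (a : Space → V) (q : Space) : V := waveInt a (κ * energy q) (κ • q)

variable [CompleteSpace V]

theorem hasFDerivAt_surfInt (κ : ℝ) {a : Space → V} (ha : RapidDecay a) (q : Space) :
    HasFDerivAt (surfInt κ a) (∑ k : Fin 3, (EuclideanSpace.proj k : Space →L[ℝ] ℝ).smulRight
      ((κ * (q k * (energy q)⁻¹)) • -Complex.I • surfInt κ (fun p => energy p • a p) q +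
        κ • Complex.I • surfInt κ (fun p => p k • a p) q)) q := by
  have h1 : HasFDerivAt (fun q : Space => (κ * energy q, κ • q))
      ((κ • ((energy q)⁻¹ • innerSL ℝ q)).prod (κ • ContinuousLinearMap.id ℝ Space)) q :=
    ((hasFDerivAt_energy q).const_mul κ).prodMk ((hasFDerivAt_id q).const_smul κ)
  refine ((hasFDerivAt_waveInt ha (κ * energy q, κ • q)).comp q h1).congr_fderiv ?_
  refine ContinuousLinearMap.ext fun v => ?_
  have hin : inner ℝ q v = ∑ k, v k * q k := by simp [PiLp.inner_apply]
  have hL : (waveDeriv a (κ * energy q, κ • q)).comp ((κ • ((energy q)⁻¹ • innerSL ℝ q)).prod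
      (κ • ContinuousLinearMap.id ℝ Space)) v =
      (κ * ((energy q)⁻¹ * inner ℝ q v)) • (-Complex.I • surfInt κ (fun p => energy p • a p) q) +
      ∑ k, (κ * v k) • (Complex.I • surfInt κ (fun p => p k • a p) q) := by
    simp only [waveDeriv, ContinuousLinearMap.comp_apply, _root_.add_apply, _root_.sum_apply,
      ContinuousLinearMap.smulRight_apply]
    rfl
  have hR : (∑ k : Fin 3, (EuclideanSpace.proj k : Space →L[ℝ] ℝ).smulRight
      ((κ * (q k * (energy q)⁻¹)) • -Complex.I • surfInt κ (fun p => energy p • a p) q +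
        κ • Complex.I • surfInt κ (fun p => p k • a p) q)) v =
      ∑ k : Fin 3, v k • ((κ * (q k * (energy q)⁻¹)) • -Complex.I •
        surfInt κ (fun p => energy p • a p) q +
        κ • Complex.I • surfInt κ (fun p => p k • a p) q) := by
    simp only [_root_.sum_apply, ContinuousLinearMap.smulRight_apply]
    rfl
  rw [hL, hR, hin]
  simp only [Fin.sum_univ_three]
  module

theorem contDiff_surfInt (κ : ℝ) {a : Space → V} (ha : TestFn a) :
    ContDiff ℝ ∞ (surfInt κ a) := by
  rw [contDiff_infty]
  intro n
  induction n generalizing a with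
  | zero =>
    exact contDiff_zero.2 (continuous_iff_continuousAt.2
      fun q => (hasFDerivAt_surfInt κ ha.rapidDecay q).continuousAt)
  | succ n ih =>
    have hd : fderiv ℝ (surfInt κ a) = _ :=
      funext fun q => (hasFDerivAt_surfInt κ ha.rapidDecay q).fderiv
    rw [Nat.cast_succ, contDiff_succ_iff_fderiv]
    refine ⟨fun q => (hasFDerivAt_surfInt κ ha.rapidDecay q).differentiableAt, by simp, ?_⟩
    rw [hd]
    refine ContDiff.sum fun k _ => ?_
    refine (ContinuousLinearMap.smulRightL ℝ Space V
      (EuclideanSpace.proj k : Space →L[ℝ] ℝ)).contDiff.comp ?_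
    have hm : ContDiff ℝ n fun q : Space => κ * (q k * (energy q)⁻¹) :=
      (contDiff_const.mul ((hasTemperateGrowth_coord k).mul
        hasTemperateGrowth_energy_inv).1).of_le (by exact_mod_cast le_top)
    exact (hm.smul ((ih ha.mulEnergy).const_smul (-Complex.I))).add
      (((ih (ha.mulCoord k)).const_smul Complex.I).const_smul κ)

theorem decayUpTo_surfInt {κ : ℝ} (hκ : κ ≠ 0) (n : ℕ) {a : Space → V} (ha : TestFn a) :
    DecayUpTo n (surfInt κ a) := by
  have h0 : ∀ {a : Space → V}, TestFn a → DecayUpTo 0 (surfInt κ a) := by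
    intro a ha
    refine ⟨contDiff_surfInt κ ha, fun m hm k => ?_⟩
    obtain rfl : m = 0 := Nat.le_zero.1 hm
    obtain ⟨C, hC⟩ := waveInt_decay' hκ k ha
    refine ⟨C, fun q => ?_⟩
    rw [norm_iteratedFDeriv_zero]
    have h1 := hC 1 (by norm_num) q
    rw [mul_one] at h1
    refine le_trans ?_ h1
    rw [surfInt]
    gcongr
    exact norm_le_energy q
  induction n generalizing a with
  | zero => exact h0 ha
  | succ n ih =>
    refine (h0 ha).succ ?_
    have hd : fderiv ℝ (surfInt κ a) = _ :=
      funext fun q => (hasFDerivAt_surfInt κ ha.rapidDecay q).fderiv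
    rw [hd]
    refine DecayUpTo.sum _ fun k => ?_
    refine DecayUpTo.clm_comp (L := ContinuousLinearMap.smulRightL ℝ Space V
      (EuclideanSpace.proj k : Space →L[ℝ] ℝ)) ?_
    have hm : Function.HasTemperateGrowth fun q : Space => κ * (q k * (energy q)⁻¹) :=
      (Function.HasTemperateGrowth.const κ).mul ((hasTemperateGrowth_coord k).mul
        hasTemperateGrowth_energy_inv)
    have hs (c : ℂ) {f : Space → V} (hf : DecayUpTo n f) : DecayUpTo n fun q => c • f q :=
      hf.clm_comp ((ContinuousLinearMap.lsmul ℝ ℂ) c)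
    exact ((hs _ (ih ha.mulEnergy)).smul hm).add
      ((hs _ (ih (ha.mulCoord k))).clm_comp (ContinuousLinearMap.lsmul ℝ ℝ κ))

/-- The Schwartz function given by `surfInt κ a` for a test function `a`. -/
def surfSchwartz {κ : ℝ} (hκ : κ ≠ 0) {a : Space → V} (ha : TestFn a) : 𝓢(Space, V) where
  toFun := surfInt κ a
  smooth' := contDiff_surfInt κ ha
  decay' k n := (decayUpTo_surfInt hκ n ha).2 n le_rfl k

end Schwartz

/-! ### Matrix multipliers and the transforms in coordinates -/

/-- Matrix functions whose entries have temperate growth. -/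
def TemperateMat (M : Space → Matrix (Fin 4) (Fin 4) ℂ) : Prop :=
  ∀ i j, Function.HasTemperateGrowth fun p => M p i j

/-- The elementary matrix with entry `1` at `(i, j)`, as a linear map of spinors. -/
def elemCLM (i j : Fin 4) : Spinor →L[ℂ] Spinor :=
  (ContinuousLinearMap.single ℂ (fun _ : Fin 4 => ℂ) i).comp (ContinuousLinearMap.proj j)

theorem mulVec_eq_sum (M : Matrix (Fin 4) (Fin 4) ℂ) (v : Spinor) :
    M *ᵥ v = ∑ i, ∑ j, M i j • elemCLM i j v := by
  funext k
  simp only [Matrix.mulVec, dotProduct, Finset.sum_apply, Pi.smul_apply, elemCLM,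
    ContinuousLinearMap.comp_apply, ContinuousLinearMap.single_apply, ContinuousLinearMap.proj_apply]
  rw [Finset.sum_comm]
  refine Finset.sum_congr rfl fun j _ => ?_
  rw [Finset.sum_eq_single k]
  · simp
  · intro b _ hb; simp [Pi.single_apply, hb.symm]
  · simp

theorem RapidDecay.clm {V W : Type*} [NormedAddCommGroup V] [NormedSpace ℂ V]
    [NormedAddCommGroup W] [NormedSpace ℂ W] {a : Space → V} (ha : RapidDecay a) (L : V →L[ℂ] W) :
    RapidDecay fun p => L (a p) :=
  ha.of_norm_le (L.continuous.comp ha.continuous) (C := ‖L‖) 0 fun p => by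
    simpa using L.le_opNorm (a p)

theorem RapidDecay.sum {ι V : Type*} [NormedAddCommGroup V] [NormedSpace ℂ V] (s : Finset ι)
    {a : ι → Space → V} (ha : ∀ i, RapidDecay (a i)) : RapidDecay fun p => ∑ i ∈ s, a i p := by
  classical
  induction s using Finset.induction_on with
  | empty => exact ⟨by simpa using continuous_const, fun k => ⟨0, by simp⟩⟩
  | insert i s hi ih => simpa [Finset.sum_insert hi] using (ha i).add ih

theorem RapidDecay.mulVec {M : Space → Matrix (Fin 4) (Fin 4) ℂ} (hM : TemperateMat M)
    {a : Space → Spinor} (ha : RapidDecay a) : RapidDecay fun p => M p *ᵥ a p := by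
  simp only [mulVec_eq_sum]
  exact .sum _ fun i => .sum _ fun j => (ha.clm (elemCLM i j)).smul (hM i j)

theorem TestFn.mulVec {M : Space → Matrix (Fin 4) (Fin 4) ℂ} (hM : TemperateMat M)
    {a : Space → Spinor} (ha : TestFn a) : TestFn fun p => M p *ᵥ a p := by
  refine ⟨?_, ?_⟩
  · simp only [mulVec_eq_sum]
    refine ContDiff.sum fun i _ => ContDiff.sum fun j _ => (hM i j).1.smul ?_
    exact ((elemCLM i j).restrictScalars ℝ).contDiff.comp ha.contDiff
  · refine ha.compact.mono fun p hp h0 => hp ?_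
    simp [h0]

/-- Multiplication of Schwartz functions by a matrix function of temperate growth. -/
def mulVecSchwartz (M : Space → Matrix (Fin 4) (Fin 4) ℂ) (φ : 𝓢(Space, Spinor)) :
    𝓢(Space, Spinor) :=
  ∑ i, ∑ j, SchwartzMap.smulLeftCLM Spinor (fun p => M p i j)
    (SchwartzMap.postcompCLM (𝕜 := ℂ) (elemCLM i j) φ)

theorem mulVecSchwartz_apply {M : Space → Matrix (Fin 4) (Fin 4) ℂ} (hM : TemperateMat M)
    (φ : 𝓢(Space, Spinor)) (p : Space) : mulVecSchwartz M φ p = M p *ᵥ φ p := by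
  simp only [mulVecSchwartz, _root_.sum_apply, mulVec_eq_sum]
  refine Finset.sum_congr rfl fun i _ => Finset.sum_congr rfl fun j _ => ?_
  rw [SchwartzMap.smulLeftCLM_apply_apply (hM i j)]
  rfl

theorem RapidDecay.dotProduct {a b : Space → Spinor} (ha : RapidDecay a) (hb : RapidDecay b) :
    RapidDecay fun p => star (a p) ⬝ᵥ b p := by
  obtain ⟨C, hC0, hC⟩ := ha.exists_bound 0
  simp only [pow_zero, one_mul] at hC
  refine hb.of_norm_le ?_ (C := 4 * C) 0 fun p => ?_
  · have := ha.continuous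
    have := hb.continuous
    simp only [_root_.dotProduct]
    fun_prop
  · simp only [_root_.dotProduct, pow_zero, mul_one]
    calc _ ≤ ∑ i : Fin 4, ‖star (a p) i * b p i‖ := norm_sum_le _ _
      _ ≤ ∑ i : Fin 4, C * ‖b p‖ := by
        refine Finset.sum_le_sum fun i _ => ?_
        rw [norm_mul, Pi.star_apply, norm_star]
        exact mul_le_mul ((norm_le_pi_norm _ i).trans (hC p)) (norm_le_pi_norm _ i)
          (norm_nonneg _) hC0
      _ = _ := by simp; ring

theorem temperateMat_const (M : Matrix (Fin 4) (Fin 4) ℂ) : TemperateMat fun _ => M :=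
  fun _ _ => .const _

theorem TemperateMat.mul {M N : Space → Matrix (Fin 4) (Fin 4) ℂ} (hM : TemperateMat M)
    (hN : TemperateMat N) : TemperateMat fun p => M p * N p := fun i j => by
  simp only [Matrix.mul_apply]
  exact .sum fun k _ => (hM i k).mul (hN k j)

variable (D : DiracMatrices)

theorem hasTemperateGrowth_lift (a : Fin 4) :
    Function.HasTemperateGrowth fun p => (lift p).1 a := by
  refine Fin.cases ?_ (fun j => ?_) a
  · exact hasTemperateGrowth_energy
  · exact hasTemperateGrowth_coord j

theorem temperateMat_slash : TemperateMat fun p => slash D (lift p).1 := fun i j => by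
  simp only [slash, Matrix.sum_apply, Matrix.smul_apply, smul_eq_mul]
  refine .sum fun a _ => ?_
  refine .mul ?_ (.const _)
  exact Function.HasTemperateGrowth.comp Function.Complex.hasTemperateGrowth_ofReal
    ((Function.HasTemperateGrowth.const _).mul (hasTemperateGrowth_lift a))

theorem temperateMat_proj (s : ℝ) : TemperateMat fun p => proj D s (lift p) := fun i j => by
  simp only [proj, Matrix.smul_apply, Matrix.add_apply, smul_eq_mul]
  exact (Function.HasTemperateGrowth.const _).mul ((Function.HasTemperateGrowth.const _).add
    ((Function.HasTemperateGrowth.const _).mul (temperateMat_slash D i j)))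

theorem mdot_lift (q p : Space) :
    mdot (lift q).1 (lift p).1 = energy q * energy p - inner ℝ q p := by
  have h0 : ∀ p : Space, (lift p).1 0 = energy p := fun _ => rfl
  have h1 : ∀ p : Space, (lift p).1 1 = p 0 := fun _ => rfl
  have h2 : ∀ p : Space, (lift p).1 2 = p 1 := fun _ => rfl
  have h3 : ∀ p : Space, (lift p).1 3 = p 2 := fun _ => rfl
  simp [mdot, metricSign, Fin.sum_univ_four, h0, h1, h2, h3, PiLp.inner_apply,
    Fin.sum_univ_three]
  ring

/-- The amplitude of the plane waves of frequency `s = ±1` in `fourierF`. -/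
def amp (s : ℝ) (f : Hyp → Spinor) (p : Space) : Spinor :=
  (s * (energy p)⁻¹) • (proj D s (lift p) *ᵥ f (lift p))

/-- The amplitude `γ·z f(z) / z⁰` in `fourierFStar`. -/
def ampStar (f : Hyp → Spinor) (p : Space) : Spinor :=
  (energy p)⁻¹ • (slash D (lift p).1 *ᵥ f (lift p))

/-- The constant `(κ / 2π)^{3/2}`. -/
def fourierConst (κ : ℝ) : ℝ := (κ / (2 * Real.pi)) ^ (3 / 2 : ℝ)

variable {D}

theorem isTest_iff {f : Hyp → Spinor} : IsTest f ↔ TestFn fun p => f (lift p) :=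
  ⟨fun h => ⟨h.1, h.2⟩, fun h => ⟨h.1, h.2⟩⟩

theorem rapidDecay_amp {f : Hyp → Spinor} (hf : RapidDecay fun p => f (lift p)) (s : ℝ) :
    RapidDecay (amp D s f) :=
  (hf.mulVec (temperateMat_proj D s)).real_smul
    ((Function.HasTemperateGrowth.const s).mul hasTemperateGrowth_energy_inv)

theorem testFn_amp {f : Hyp → Spinor} (hf : TestFn fun p => f (lift p)) (s : ℝ) :
    TestFn (amp D s f) :=
  (hf.mulVec (temperateMat_proj D s)).real_smul
    ((Function.HasTemperateGrowth.const s).mul hasTemperateGrowth_energy_inv).1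

theorem rapidDecay_ampStar {f : Hyp → Spinor} (hf : RapidDecay fun p => f (lift p)) :
    RapidDecay (ampStar D f) :=
  (hf.mulVec (temperateMat_slash D)).real_smul hasTemperateGrowth_energy_inv

theorem testFn_ampStar {f : Hyp → Spinor} (hf : TestFn fun p => f (lift p)) :
    TestFn (ampStar D f) :=
  (hf.mulVec (temperateMat_slash D)).real_smul hasTemperateGrowth_energy_inv.1

theorem phase_lift (κ : ℝ) (q p : Space) : κ * energy q * energy p - inner ℝ (κ • q) p =
    κ * mdot (lift q).1 (lift p).1 := by
  rw [mdot_lift, inner_smul_left]; simp; ring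

theorem fourierF_lift (κ : ℝ) {f : Hyp → Spinor} (hf : RapidDecay fun p => f (lift p)) (q : Space) :
    fourierF D κ f (lift q) = (fourierConst κ : ℂ) •
      (surfInt κ (amp D 1 f) q + surfInt (-κ) (amp D (-1) f) q) := by
  rw [fourierF, ← fourierConst, integral_μH, surfInt, surfInt, waveInt, waveInt,
    ← integral_add (integrable_wave (rapidDecay_amp hf 1).integrable _ _)
      (integrable_wave (rapidDecay_amp hf (-1)).integrable _ _)]
  congr 1
  refine integral_congr_ae (Filter.Eventually.of_forall fun p => ?_)
  simp only [phase_lift]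
  rw [exp_smul_slash_mul_slash, Matrix.sub_mulVec, Matrix.smul_mulVec, Matrix.smul_mulVec, amp, amp,
    smul_sub, sub_eq_add_neg]
  congr 1
  · rw [smul_comm, one_mul]
    congr 3
    push_cast; ring
  · rw [smul_comm, ← smul_neg, ← neg_smul]
    congr 3
    · push_cast; ring
    · ring

theorem fourierFStar_lift (κ : ℝ) {f : Hyp → Spinor} (hf : RapidDecay fun p => f (lift p))
    (q : Space) : fourierFStar D κ f (lift q) = (fourierConst κ : ℂ) •
      (proj D 1 (lift q) *ᵥ surfInt (-κ) (ampStar D f) q +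
        proj D (-1) (lift q) *ᵥ surfInt κ (ampStar D f) q) := by
  have hL (M : Matrix (Fin 4) (Fin 4) ℂ) (a : Space → Spinor) (ha : Integrable a) :
      M *ᵥ ∫ p, a p = ∫ p, M *ᵥ a p := by
    have h := ContinuousLinearMap.integral_comp_comm
      ((Matrix.mulVecLin M).restrictScalars ℝ).toContinuousLinearMap ha
    simpa using h.symm
  have hw (t : ℝ) (x : Space) := integrable_wave (rapidDecay_ampStar (D := D) hf).integrable t x
  have hLi (M : Matrix (Fin 4) (Fin 4) ℂ) (a : Space → Spinor) (ha : Integrable a) :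
      Integrable fun p => M *ᵥ a p :=
    (Matrix.mulVecLin M).toContinuousLinearMap.integrable_comp ha
  rw [fourierFStar, ← fourierConst, integral_μH, surfInt, surfInt, waveInt, waveInt,
    hL _ _ (hw _ _), hL _ _ (hw _ _), ← integral_add (hLi _ _ (hw _ _)) (hLi _ _ (hw _ _))]
  congr 1
  refine integral_congr_ae (Filter.Eventually.of_forall fun p => ?_)
  simp only [phase_lift]
  rw [exp_smul_slash, ampStar, add_mul, Matrix.add_mulVec, smul_mul_assoc, smul_mul_assoc,
    Matrix.smul_mulVec, Matrix.smul_mulVec, smul_add, Matrix.mulVec_smul, Matrix.mulVec_smul,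
    Matrix.mulVec_smul, Matrix.mulVec_smul, Matrix.mulVec_mulVec, Matrix.mulVec_mulVec]
  congr 1
  · rw [smul_comm]
    congr 2
    push_cast; ring
  · rw [smul_comm]
    congr 2
    push_cast; ring

variable (D)

theorem isSchwartz_fourierF {κ : ℝ} (hκ : κ ≠ 0) {f : Hyp → Spinor} (hf : IsTest f) :
    IsSchwartz (fourierF D κ f) := by
  have h := isTest_iff.1 hf
  refine ⟨(fourierConst κ : ℂ) • (surfSchwartz hκ (testFn_amp (D := D) h 1) +
    surfSchwartz (neg_ne_zero.2 hκ) (testFn_amp (D := D) h (-1))), fun p => ?_⟩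
  rw [fourierF_lift κ h.rapidDecay]
  rfl

theorem isSchwartz_fourierFStar {κ : ℝ} (hκ : κ ≠ 0) {f : Hyp → Spinor} (hf : IsTest f) :
    IsSchwartz (fourierFStar D κ f) := by
  have h := isTest_iff.1 hf
  have ha := testFn_ampStar (D := D) h
  refine ⟨(fourierConst κ : ℂ) •
    (mulVecSchwartz (fun p => proj D 1 (lift p)) (surfSchwartz (neg_ne_zero.2 hκ) ha) +
    mulVecSchwartz (fun p => proj D (-1) (lift p)) (surfSchwartz hκ ha)), fun p => ?_⟩
  rw [fourierFStar_lift κ h.rapidDecay, _root_.smul_apply, _root_.add_apply,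
    mulVecSchwartz_apply (temperateMat_proj D 1), mulVecSchwartz_apply (temperateMat_proj D (-1))]
  rfl

variable {D}

theorem IsSchwartz.rapidDecay {f : Hyp → Spinor} (hf : IsSchwartz f) :
    RapidDecay fun p => f (lift p) := by
  obtain ⟨φ, h⟩ := hf
  simp only [h]
  exact rapidDecay_schwartz φ

theorem density_eq (g f : Hyp → Spinor) (z : Hyp) :
    density D g f z = star (g z) ⬝ᵥ ((D.γ 0 * slash D z.1) *ᵥ f z) := by
  rw [density, diracConj, ← Matrix.dotProduct_mulVec, Matrix.mulVec_mulVec]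

theorem rapidDecay_density {g f : Hyp → Spinor} (hg : RapidDecay fun p => g (lift p))
    (hf : RapidDecay fun p => f (lift p)) : RapidDecay fun p => density D g f (lift p) := by
  simp only [density_eq]
  exact hg.dotProduct (hf.mulVec ((temperateMat_const _).mul (temperateMat_slash D)))

theorem integrable_density {g f : Hyp → Spinor} (hg : RapidDecay fun p => g (lift p))
    (hf : RapidDecay fun p => f (lift p)) : Integrable (density D g f) μH := by
  rw [integrable_μH_iff]
  exact ((rapidDecay_density hg hf).real_smul hasTemperateGrowth_energy_inv).integrable

theorem memH_of_rapidDecay {f : Hyp → Spinor} (hf : RapidDecay fun p => f (lift p)) : MemH D f :=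
  ⟨aestronglyMeasurable_μH_of_continuous hf.continuous, integrable_density hf hf⟩

/-! ### Solutions of the Dirac equation and their currents -/

section Sesquilinear

/-- The sesquilinear form `a† M b` of spinors. -/
def sesq (M : Matrix (Fin 4) (Fin 4) ℂ) (a b : Spinor) : ℂ := star a ⬝ᵥ (M *ᵥ b)

variable (M : Matrix (Fin 4) (Fin 4) ℂ)

theorem exists_bound_sesq : ∃ C, 0 ≤ C ∧ ∀ a b, ‖sesq M a b‖ ≤ C * (‖a‖ * ‖b‖) := by
  refine ⟨∑ i, ∑ j, ‖M i j‖, by positivity, fun a b => ?_⟩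
  simp only [sesq, dotProduct, Matrix.mulVec, Finset.mul_sum, Finset.sum_mul]
  refine (norm_sum_le _ _).trans (Finset.sum_le_sum fun i _ =>
    (norm_sum_le _ _).trans (Finset.sum_le_sum fun j _ => ?_))
  rw [norm_mul, norm_mul, Pi.star_apply, norm_star]
  calc _ = ‖M i j‖ * (‖a i‖ * ‖b j‖) := by ring
    _ ≤ _ := by gcongr <;> exact norm_le_pi_norm _ _

theorem sesq_add_left (a b c : Spinor) : sesq M (a + b) c = sesq M a c + sesq M b c := by
  simp [sesq, add_dotProduct]

theorem sesq_add_right (a b c : Spinor) : sesq M a (b + c) = sesq M a b + sesq M a c := by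
  simp [sesq, Matrix.mulVec_add]

theorem sesq_smul_left (r : ℂ) (a b : Spinor) : sesq M (r • a) b = conj r * sesq M a b := by
  simp [sesq, smul_dotProduct]

theorem sesq_smul_right (r : ℂ) (a b : Spinor) : sesq M a (r • b) = r * sesq M a b := by
  simp [sesq, Matrix.mulVec_smul]

theorem sesq_mulVec_right (N : Matrix (Fin 4) (Fin 4) ℂ) (a b : Spinor) :
    sesq M a (N *ᵥ b) = sesq (M * N) a b := by
  simp [sesq, Matrix.mulVec_mulVec]

theorem sesq_mulVec_left (N : Matrix (Fin 4) (Fin 4) ℂ) (a b : Spinor) :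
    sesq M (N *ᵥ a) b = sesq (Nᴴ * M) a b := by
  rw [sesq, sesq, Matrix.star_mulVec, ← Matrix.mulVec_mulVec, Matrix.dotProduct_mulVec,
    Matrix.vecMul_vecMul, Matrix.mulVec_mulVec, Matrix.dotProduct_mulVec]

/-- The form `a† M b` as a real bilinear map. -/
def sesqL : Spinor →L[ℝ] Spinor →L[ℝ] ℂ :=
  LinearMap.mkContinuous₂ (LinearMap.mk₂ ℝ (sesq M) (sesq_add_left M)
    (fun r a b => by
      have := sesq_smul_left M (r : ℂ) a b
      simpa using this)
    (sesq_add_right M) (fun r a b => by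
      have := sesq_smul_right M (r : ℂ) a b
      simpa using this)) (exists_bound_sesq M).choose (fun a b => by
        have := (exists_bound_sesq M).choose_spec.2 a b
        rw [mul_assoc]
        exact this)

theorem hasFDerivAt_sesq {E : Type*} [NormedAddCommGroup E] [NormedSpace ℝ E] {φ ψ : E → Spinor}
    {φ' ψ' : E →L[ℝ] Spinor} {y : E} (hφ : HasFDerivAt φ φ' y) (hψ : HasFDerivAt ψ ψ' y) :
    HasFDerivAt (fun y => sesq M (φ y) (ψ y))
      ((sesqL M (φ y)).comp ψ' + ((sesqL M).flip (ψ y)).comp φ') y := by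
  have h := (sesqL M).hasFDerivAt_of_bilinear hφ hψ
  exact h.congr_fderiv (by ext v; simp)

theorem contDiff_sesq {E : Type*} [NormedAddCommGroup E] [NormedSpace ℝ E] {φ ψ : E → Spinor}
    {n : ℕ∞} (hφ : ContDiff ℝ n φ) (hψ : ContDiff ℝ n ψ) :
    ContDiff ℝ n fun y => sesq M (φ y) (ψ y) :=
  (sesqL M).isBoundedBilinearMap.contDiff.comp (hφ.prodMk hψ)

end Sesquilinear

variable (D : DiracMatrices)

/-- The matrices `αᵏ = γ⁰ γᵏ`. -/
def alpha (k : Fin 3) : Matrix (Fin 4) (Fin 4) ℂ := D.γ 0 * D.γ k.succ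

theorem gamma_zero_adjoint : (D.γ 0)ᴴ = D.γ 0 := by
  rw [D.adjoint, gamma_zero_sq, one_mul]

theorem alpha_adjoint (k : Fin 3) : (alpha D k)ᴴ = alpha D k := by
  rw [alpha, Matrix.conjTranspose_mul, D.adjoint, gamma_zero_adjoint, mul_assoc, mul_assoc,
    gamma_zero_sq, mul_one]

theorem gamma_zero_mul_slash (x : Fin 4 → ℝ) : D.γ 0 * slash D x =
    (x 0 : ℂ) • 1 - ∑ k : Fin 3, (x k.succ : ℂ) • alpha D k := by
  rw [slash, Fin.sum_univ_succ, mul_add, Finset.mul_sum]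
  have h0 : metricSign 0 = 1 := by simp [metricSign]
  have h1 (k : Fin 3) : metricSign k.succ = -1 := by simp [metricSign, Fin.succ_ne_zero]
  simp only [h0, h1, one_mul, mul_smul_comm, gamma_zero_sq, alpha]
  rw [sub_eq_add_neg, ← Finset.sum_neg_distrib]
  congr 1
  refine Finset.sum_congr rfl fun k _ => ?_
  push_cast
  module

/-- Continuously differentiable solutions of the Dirac equation `(i γ·∂ - 1) ψ = 0`, written as
`∂ₜ ψ + α · ∇ ψ = -i γ⁰ ψ`. -/
structure IsDiracSolution (ψ : ℝ × Space → Spinor) : Prop where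
  contDiff : ContDiff ℝ 1 ψ
  eqn : ∀ y, fderiv ℝ ψ y (1, 0) +
    ∑ k, alpha D k *ᵥ fderiv ℝ ψ y (0, EuclideanSpace.single k 1) = -Complex.I • (D.γ 0 *ᵥ ψ y)

/-- Conserved currents `(j⁰, j)` that are continuously differentiable. -/
structure IsConserved (j₀ : ℝ × Space → ℂ) (j : Fin 3 → ℝ × Space → ℂ) : Prop where
  contDiff_zero : ContDiff ℝ 1 j₀
  contDiff : ∀ k, ContDiff ℝ 1 (j k)
  eqn : ∀ y, fderiv ℝ j₀ y (1, 0) +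
    ∑ k, fderiv ℝ (j k) y (0, EuclideanSpace.single k 1) = 0

variable {D}

theorem fderiv_sesq (M : Matrix (Fin 4) (Fin 4) ℂ) {φ ψ : ℝ × Space → Spinor}
    (hφ : ContDiff ℝ 1 φ) (hψ : ContDiff ℝ 1 ψ) (y v : ℝ × Space) :
    fderiv ℝ (fun y => sesq M (φ y) (ψ y)) y v =
      sesq M (φ y) (fderiv ℝ ψ y v) + sesq M (fderiv ℝ φ y v) (ψ y) := by
  rw [(hasFDerivAt_sesq M ((hφ.differentiable (by simp)) y).hasFDerivAt
    ((hψ.differentiable (by simp)) y).hasFDerivAt).fderiv]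
  rfl

theorem IsDiracSolution.isConserved {φ ψ : ℝ × Space → Spinor} (hφ : IsDiracSolution D φ)
    (hψ : IsDiracSolution D ψ) :
    IsConserved (fun y => sesq 1 (φ y) (ψ y)) fun k y => sesq (alpha D k) (φ y) (ψ y) where
  contDiff_zero := contDiff_sesq 1 hφ.contDiff hψ.contDiff
  contDiff k := contDiff_sesq _ hφ.contDiff hψ.contDiff
  eqn y := by
    simp only [fderiv_sesq _ hφ.contDiff hψ.contDiff]
    have h1 := congrArg (fun v => sesq 1 (φ y) v) (hψ.eqn y)
    have h2 := congrArg (fun v => sesq 1 v (ψ y)) (hφ.eqn y)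
    simp only [Fin.sum_univ_three, sesq_add_right, sesq_add_left, sesq_mulVec_right,
      sesq_mulVec_left, sesq_smul_left, sesq_smul_right, one_mul, mul_one, alpha_adjoint,
      gamma_zero_adjoint, map_neg, Complex.conj_I] at h1 h2 ⊢
    linear_combination h1 + h2

theorem mulVec_waveInt (M : Matrix (Fin 4) (Fin 4) ℂ) {a : Space → Spinor} (ha : Integrable a)
    (t : ℝ) (x : Space) : M *ᵥ waveInt a t x = waveInt (fun p => M *ᵥ a p) t x := by
  have h := ContinuousLinearMap.integral_comp_comm
    ((Matrix.mulVecLin M).restrictScalars ℝ).toContinuousLinearMap (integrable_wave ha t x)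
  simp only [waveInt]
  simpa [Matrix.mulVec_smul] using h.symm

theorem waveDeriv_fst (a : Space → Spinor) (y : ℝ × Space) :
    waveDeriv a y (1, 0) = -Complex.I • waveInt (fun p => energy p • a p) y.1 y.2 := by
  simp [waveDeriv]

theorem waveDeriv_snd (a : Space → Spinor) (y : ℝ × Space) (k : Fin 3) :
    waveDeriv a y (0, EuclideanSpace.single k 1) =
      Complex.I • waveInt (fun p => p k • a p) y.1 y.2 := by
  simp [waveDeriv]

theorem contDiff_waveInt {a : Space → Spinor} (ha : RapidDecay a) :
    ContDiff ℝ 1 fun y : ℝ × Space => waveInt a y.1 y.2 := by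
  rw [contDiff_one_iff_fderiv]
  refine ⟨fun y => (hasFDerivAt_waveInt ha y).differentiableAt, ?_⟩
  have hd : fderiv ℝ (fun y : ℝ × Space => waveInt a y.1 y.2) = waveDeriv a :=
    funext fun y => (hasFDerivAt_waveInt ha y).fderiv
  rw [hd]
  unfold waveDeriv
  refine Continuous.add ?_ (continuous_finsetSum _ fun k _ => ?_)
  · exact (ContinuousLinearMap.smulRightL ℝ _ Spinor _).continuous.comp
      ((continuous_waveInt ha.mulEnergy.integrable).fun_const_smul _)
  · exact (ContinuousLinearMap.smulRightL ℝ _ Spinor _).continuous.comp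
      ((continuous_waveInt (ha.mulCoord k).integrable).fun_const_smul _)

variable (D) in
/-- The solution of the Dirac equation with momentum space data `f`: a superposition of plane waves
of frequency `±1` with the amplitudes `amp D (±1) f`. -/
def diracField (f : Hyp → Spinor) (y : ℝ × Space) : Spinor :=
  waveInt (amp D 1 f) y.1 y.2 + waveInt (amp D (-1) f) (-y.1) (-y.2)

theorem hasFDerivAt_diracField {f : Hyp → Spinor} (hf : RapidDecay fun p => f (lift p))
    (y : ℝ × Space) : HasFDerivAt (diracField D f)
      (waveDeriv (amp D 1 f) y - waveDeriv (amp D (-1) f) (-y)) y := by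
  have h1 := hasFDerivAt_waveInt (rapidDecay_amp (D := D) hf 1) y
  have h2 := (hasFDerivAt_waveInt (rapidDecay_amp (D := D) hf (-1)) (-y)).comp y
    (hasFDerivAt_id y).neg
  refine (h1.add h2).congr_fderiv ?_
  ext v
  · simp [sub_eq_add_neg]
  · simp [sub_eq_add_neg]

theorem slash_mulVec_amp {s : ℝ} (hs : s * s = 1) (f : Hyp → Spinor) (p : Space) :
    slash D (lift p).1 *ᵥ amp D s f p = s • amp D s f p := by
  rw [amp, Matrix.mulVec_smul, Matrix.mulVec_mulVec, slash_mul_proj D hs, Matrix.smul_mulVec,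
    smul_comm, Complex.coe_smul]

/-- For amplitudes in the eigenspace of `γ·z` with eigenvalue `s`, the operator `E - α · p` acts as
`s γ⁰`. -/
theorem alpha_waveInt {a : Space → Spinor} (ha : RapidDecay a) {s : ℝ}
    (hs : ∀ p, slash D (lift p).1 *ᵥ a p = s • a p) (t : ℝ) (x : Space) :
    waveInt (fun p => energy p • a p) t x - ∑ k, alpha D k *ᵥ waveInt (fun p => p k • a p) t x =
      s • (D.γ 0 *ᵥ waveInt a t x) := by
  have hM (M : Matrix (Fin 4) (Fin 4) ℂ) {b : Space → Spinor} (hb : RapidDecay b) :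
      RapidDecay fun p => M *ᵥ b p := hb.mulVec (temperateMat_const M)
  have hi (k : Fin 3) := (hM (alpha D k) (ha.mulCoord k)).integrable
  rw [mulVec_waveInt _ ha.integrable]
  simp only [fun k => mulVec_waveInt (alpha D k) (ha.mulCoord k).integrable t x]
  rw [Fin.sum_univ_three, ← waveInt_add (hi 0) (hi 1), ← waveInt_add ((hi 0).fun_add (hi 1)) (hi 2),
    ← waveInt_sub ha.mulEnergy.integrable (((hi 0).fun_add (hi 1)).fun_add (hi 2)),
    ← waveInt_real_smul]
  congr 1
  funext p
  rw [← Matrix.mulVec_smul, ← hs, Matrix.mulVec_mulVec, gamma_zero_mul_slash, Matrix.sub_mulVec,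
    Fin.sum_univ_three, Matrix.add_mulVec, Matrix.add_mulVec]
  simp only [Matrix.smul_mulVec, Matrix.one_mulVec, Matrix.mulVec_smul, Complex.coe_smul]
  rfl

theorem isDiracSolution_diracField {f : Hyp → Spinor} (hf : RapidDecay fun p => f (lift p)) :
    IsDiracSolution D (diracField D f) where
  contDiff := (contDiff_waveInt (rapidDecay_amp hf 1)).add
    ((contDiff_waveInt (rapidDecay_amp hf (-1))).comp contDiff_neg)
  eqn y := by
    have h1 := alpha_waveInt (rapidDecay_amp (D := D) hf 1)
      (slash_mulVec_amp (by norm_num) f) y.1 y.2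
    have h2 := alpha_waveInt (rapidDecay_amp (D := D) hf (-1))
      (slash_mulVec_amp (by norm_num) f) (-y.1) (-y.2)
    rw [(hasFDerivAt_diracField hf y).fderiv]
    simp only [_root_.sub_apply, waveDeriv_fst, waveDeriv_snd, Prod.fst_neg, Prod.snd_neg,
      Matrix.mulVec_sub, Matrix.mulVec_smul, Finset.sum_sub_distrib, ← Finset.smul_sum]
    rw [sub_eq_iff_eq_add] at h1 h2
    rw [h1, h2, diracField, Matrix.mulVec_add]
    module

/-! ### Conservation of the flux between a plane and a hyperboloid -/

theorem integral_fderiv_apply_eq_zero {V : Type*} [NormedAddCommGroup V] [NormedSpace ℝ V]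
    {f : Space → V} {v : Space} (hf : Differentiable ℝ f)
    (hi : Integrable f) (hi' : Integrable fun x => fderiv ℝ f x v) :
    ∫ x, fderiv ℝ f x v = 0 := by
  have h := integral_bilinear_hasFDerivAt_right_eq_neg_left_of_integrable (μ := volume) (v := v)
    (f := fun _ : Space => (1 : ℝ)) (f' := fun _ => 0) (g := f) (g' := fderiv ℝ f)
    (B := ContinuousLinearMap.lsmul ℝ ℝ) (by simp) (by simpa using hi') (by simpa using hi)
    (fun x _ => hasFDerivAt_const _ _) (fun x _ => (hf x).hasFDerivAt)
  simpa using h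

/-- Functions on space-time which decrease faster than any power of `|x|` on the surfaces
`t = c √(κ² + |x|²)`, uniformly for `|c| ≤ 1`. -/
def SurfDecay {W : Type*} [NormedAddCommGroup W] (κ : ℝ) (F : ℝ × Space → W) : Prop :=
  ∀ N : ℕ, ∃ C, ∀ c : ℝ, c ^ 2 ≤ 1 → ∀ q : Space,
    energy q ^ N * ‖F (κ * c * energy q, κ • q)‖ ≤ C

section SurfDecay

variable {W : Type*} [NormedAddCommGroup W] {κ : ℝ}

theorem SurfDecay.of_norm_le_mul {W₁ W₂ : Type*} [NormedAddCommGroup W₁] [NormedAddCommGroup W₂]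
    {F : ℝ × Space → W} {G : ℝ × Space → W₁} {H : ℝ × Space → W₂} (hG : SurfDecay κ G)
    (hH : SurfDecay κ H) (K : ℝ) (h : ∀ y, ‖F y‖ ≤ K * (‖G y‖ * ‖H y‖)) : SurfDecay κ F := by
  intro N
  obtain ⟨C, hC⟩ := hG N
  obtain ⟨C', hC'⟩ := hH 0
  simp only [pow_zero, one_mul] at hC'
  refine ⟨|K| * (C * C'), fun c hc q => ?_⟩
  have hE := energy_pos q
  have h0 : 0 ≤ C := le_trans (by positivity) (hC c hc q)
  calc _ ≤ energy q ^ N * (|K| * (‖G (κ * c * energy q, κ • q)‖ *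
        ‖H (κ * c * energy q, κ • q)‖)) := by
        refine mul_le_mul_of_nonneg_left ((h _).trans ?_) (by positivity)
        exact mul_le_mul_of_nonneg_right (le_abs_self K) (by positivity)
    _ = |K| * ((energy q ^ N * ‖G (κ * c * energy q, κ • q)‖) *
        ‖H (κ * c * energy q, κ • q)‖) := by ring
    _ ≤ _ := mul_le_mul_of_nonneg_left (mul_le_mul (hC c hc q) (hC' c hc q) (norm_nonneg _) h0)
        (abs_nonneg _)

theorem SurfDecay.of_norm_le_add {W₁ W₂ : Type*} [NormedAddCommGroup W₁] [NormedAddCommGroup W₂]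
    {F : ℝ × Space → W} {G : ℝ × Space → W₁} {H : ℝ × Space → W₂} (hG : SurfDecay κ G)
    (hH : SurfDecay κ H) (h : ∀ y, ‖F y‖ ≤ ‖G y‖ + ‖H y‖) : SurfDecay κ F := by
  intro N
  obtain ⟨C, hC⟩ := hG N
  obtain ⟨C', hC'⟩ := hH N
  refine ⟨C + C', fun c hc q => ?_⟩
  have hE := energy_pos q
  refine (mul_le_mul_of_nonneg_left (h _) (by positivity)).trans ?_
  rw [mul_add]
  exact add_le_add (hC c hc q) (hC' c hc q)

end SurfDecay

theorem surfDecay_diracField (D : DiracMatrices) {κ : ℝ} (hκ : κ ≠ 0) {f : Hyp → Spinor}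
    (hf : TestFn fun p => f (lift p)) :
    SurfDecay κ (diracField D f) ∧ SurfDecay κ (fderiv ℝ (diracField D f)) := by
  have hw {κ : ℝ} (hκ : κ ≠ 0) {a : Space → Spinor} (ha : TestFn a) :
      SurfDecay κ (fun y : ℝ × Space => waveInt a y.1 y.2) := fun N => waveInt_decay' hκ N ha
  have hw' {a : Space → Spinor} (ha : TestFn a) :
      SurfDecay κ (fun y : ℝ × Space => waveInt a (-y.1) (-y.2)) := fun N => by
    obtain ⟨C, hC⟩ := waveInt_decay' (neg_ne_zero.2 hκ) N ha
    refine ⟨C, fun c hc q => ?_⟩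
    simpa using hC c hc q
  have h1 := testFn_amp (D := D) hf 1
  have h2 := testFn_amp (D := D) hf (-1)
  refine ⟨(hw hκ h1).of_norm_le_add (hw' h2) fun y => norm_add_le _ _, ?_⟩
  have hb (a : Space → Spinor) (y : ℝ × Space) : ‖waveDeriv a y‖ ≤
      ‖waveInt (fun p => energy p • a p) y.1 y.2‖ +
        ∑ k : Fin 3, ‖waveInt (fun p => p k • a p) y.1 y.2‖ := by
    refine (norm_add_le _ _).trans (add_le_add ?_ ((norm_sum_le _ _).trans
      (Finset.sum_le_sum fun k _ => ?_)))
    · rw [ContinuousLinearMap.norm_smulRight_apply, norm_smul, norm_neg, Complex.norm_I, one_mul]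
      exact mul_le_of_le_one_left (norm_nonneg _) (ContinuousLinearMap.norm_fst_le _ _ _)
    · rw [ContinuousLinearMap.norm_smulRight_apply, norm_smul, Complex.norm_I, one_mul]
      refine mul_le_of_le_one_left (norm_nonneg _) ?_
      refine ContinuousLinearMap.opNorm_le_bound _ zero_le_one fun v => ?_
      rw [one_mul]
      exact (PiLp.norm_apply_le v.2 k).trans (norm_snd_le v)
  have hd {κ : ℝ} (hκ : κ ≠ 0) {a : Space → Spinor} (ha : TestFn a) :
      SurfDecay κ (waveDeriv a) := by
    have h01 := (hw hκ (ha.mulCoord 0)).of_norm_le_add (hw hκ (ha.mulCoord 1))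
      (F := fun y => ‖waveInt (fun p => p 0 • a p) y.1 y.2‖ +
        ‖waveInt (fun p => p 1 • a p) y.1 y.2‖) fun y => by
        rw [Real.norm_of_nonneg (by positivity)]
    have h012 := h01.of_norm_le_add (hw hκ (ha.mulCoord 2))
      (F := fun y => ∑ k : Fin 3, ‖waveInt (fun p => p k • a p) y.1 y.2‖) fun y => by
        rw [Real.norm_of_nonneg (by positivity), Real.norm_of_nonneg (by positivity),
          Fin.sum_univ_three]
    refine (hw hκ ha.mulEnergy).of_norm_le_add h012 fun y => ?_
    rw [Real.norm_of_nonneg (by positivity)]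
    exact hb a y
  have hd' {a : Space → Spinor} (ha : TestFn a) : SurfDecay κ (fun y => waveDeriv a (-y)) := by
    intro N
    obtain ⟨C, hC⟩ := hd (neg_ne_zero.2 hκ) ha N
    refine ⟨C, fun c hc q => ?_⟩
    simpa using hC c hc q
  refine (hd hκ h1).of_norm_le_add (hd' h2) fun y => ?_
  rw [(hasFDerivAt_diracField hf.rapidDecay y).fderiv]
  exact norm_sub_le _ _

/-- The flux through the hyperboloid `t = √(κ² + |x|²)` of a conserved current with sufficient
decay equals the total charge at time `0`. The two surfaces are joined by the surfaces
`t = cos θ √(κ² + |x|²)`, on which the derivative of the flux with respect to `θ` is the integral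
of a divergence. -/
theorem IsConserved.flux_eq {j₀ : ℝ × Space → ℂ} {j : Fin 3 → ℝ × Space → ℂ}
    (h : IsConserved j₀ j) {κ : ℝ} (hd : ∀ k, SurfDecay κ (j k)) (hd₀ : SurfDecay κ j₀)
    (hd' : ∀ k, SurfDecay κ (fderiv ℝ (j k))) :
    ∫ q : Space, (j₀ (κ * energy q, κ • q) -
      ∑ k, ((q k * (energy q)⁻¹ : ℝ) : ℂ) * j k (κ * energy q, κ • q)) =
    ∫ q : Space, j₀ (0, κ • q) := by
  -- the point of the surface with parameter `θ` above `q`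
  let y (θ : ℝ) (q : Space) : ℝ × Space := (κ * Real.cos θ * energy q, κ • q)
  have hyq (θ : ℝ) (q : Space) : HasFDerivAt (y θ)
      (((κ * Real.cos θ) • ((energy q)⁻¹ • innerSL ℝ q)).prod (κ • ContinuousLinearMap.id ℝ Space))
      q := ((hasFDerivAt_energy q).const_mul _).prodMk ((hasFDerivAt_id q).const_smul κ)
  have hyθ (θ : ℝ) (q : Space) : HasDerivAt (fun θ => y θ q)
      (-(κ * Real.sin θ * energy q) • ((1 : ℝ), (0 : Space))) θ := by
    have h1 : HasDerivAt (fun θ => κ * Real.cos θ * energy q) (-(κ * Real.sin θ * energy q)) θ := by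
      refine (((Real.hasDerivAt_cos θ).const_mul κ).mul_const (energy q)).congr_deriv ?_
      ring
    refine (h1.prodMk (hasDerivAt_const θ (κ • q))).congr_deriv ?_
    simp
  have hyc (θ : ℝ) : Continuous (y θ) :=
    continuous_iff_continuousAt.2 fun q => (hyq θ q).continuousAt
  have hcos (θ : ℝ) : Real.cos θ ^ 2 ≤ 1 := Real.cos_sq_le_one θ
  let v (q : Space) (k : Fin 3) : ℝ := q k * (energy q)⁻¹
  have hv (q : Space) (k : Fin 3) : |v q k| ≤ 1 := by
    simp only [v]
    rw [abs_mul, abs_inv, abs_of_pos (energy_pos q), ← div_eq_mul_inv, div_le_one (energy_pos q)]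
    exact abs_coord_le_energy q k
  have hvc (k : Fin 3) : Continuous fun q => v q k :=
    ((hasTemperateGrowth_coord k).mul hasTemperateGrowth_energy_inv).1.continuous
  let I (θ : ℝ) (q : Space) : ℂ :=
    j₀ (y θ q) - Real.cos θ * ∑ k, (v q k : ℂ) * j k (y θ q)
  -- the field whose divergence is the derivative of the flux density
  let G (θ : ℝ) (k : Fin 3) (q : Space) : ℂ := (Real.sin θ * energy q : ℝ) * j k (y θ q)
  let G' (θ : ℝ) (k : Fin 3) (q : Space) : ℂ :=
    (Real.sin θ * v q k : ℝ) * j k (y θ q) + (κ * Real.sin θ * energy q : ℝ) *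
      ((Real.cos θ * v q k : ℝ) * fderiv ℝ (j k) (y θ q) (1, 0) +
        fderiv ℝ (j k) (y θ q) (0, EuclideanSpace.single k 1))
  have hjd (k : Fin 3) (z : ℝ × Space) : HasFDerivAt (j k) (fderiv ℝ (j k) z) z :=
    ((h.contDiff k).differentiable (by simp) z).hasFDerivAt
  have hj₀d (z : ℝ × Space) : HasFDerivAt j₀ (fderiv ℝ j₀ z) z :=
    (h.contDiff_zero.differentiable (by simp) z).hasFDerivAt
  have hG (θ : ℝ) (k : Fin 3) (q : Space) : HasFDerivAt (G θ k)
      (((Real.sin θ * energy q : ℝ) : ℂ) • (fderiv ℝ (j k) (y θ q)).comp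
        (((κ * Real.cos θ) • ((energy q)⁻¹ • innerSL ℝ q)).prod
          (κ • ContinuousLinearMap.id ℝ Space)) +
        (Complex.ofRealCLM.comp (Real.sin θ • ((energy q)⁻¹ • innerSL ℝ q))).smulRight
          (j k (y θ q))) q := by
    have h1 : HasFDerivAt (fun q => ((Real.sin θ * energy q : ℝ) : ℂ))
        (Complex.ofRealCLM.comp (Real.sin θ • ((energy q)⁻¹ • innerSL ℝ q))) q :=
      Complex.ofRealCLM.hasFDerivAt.comp q ((hasFDerivAt_energy q).const_mul (Real.sin θ))
    have h2 := (hjd k (y θ q)).comp q (hyq θ q)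
    refine (h1.mul h2).congr_fderiv ?_
    ext w
    simp [mul_comm]
  have hG' (θ : ℝ) (k : Fin 3) (q : Space) :
      fderiv ℝ (G θ k) q (EuclideanSpace.single k 1) = G' θ k q := by
    have h2 : innerSL ℝ q (EuclideanSpace.single k 1) = q k := by
      rw [innerSL_apply_apply, EuclideanSpace.inner_single_right]; simp
    rw [(hG θ k q).fderiv]
    simp only [_root_.add_apply, _root_.smul_apply, ContinuousLinearMap.comp_apply,
      ContinuousLinearMap.prod_apply, ContinuousLinearMap.smulRight_apply, h2,
      ContinuousLinearMap.id_apply, G']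
    have h3 : (((κ * Real.cos θ) • ((energy q)⁻¹ • q k), κ • EuclideanSpace.single k (1 : ℝ)) :
        ℝ × Space) = (κ * Real.cos θ * v q k) • ((1 : ℝ), (0 : Space)) +
          κ • ((0 : ℝ), EuclideanSpace.single k (1 : ℝ)) := by
      ext1
      · change (κ * Real.cos θ) * ((energy q)⁻¹ * q k) = (κ * Real.cos θ * v q k) * 1 + κ * 0
        simp only [v]
        ring
      · simp
    rw [h3, map_add, map_smul, map_smul]
    simp only [Complex.ofRealCLM_apply, smul_eq_mul, Complex.real_smul, v]
    push_cast
    ring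
  have hI (θ : ℝ) (q : Space) : HasDerivAt (fun θ => I θ q) (∑ k, G' θ k q) θ := by
    have h0 := (hj₀d (y θ q)).comp_hasDerivAt θ (hyθ θ q)
    have hk (k : Fin 3) := ((hjd k (y θ q)).comp_hasDerivAt θ (hyθ θ q)).const_mul (v q k : ℂ)
    have hs : HasDerivAt (fun θ => ∑ k, (v q k : ℂ) * j k (y θ q)) _ θ :=
      HasDerivAt.fun_sum fun k _ => hk k
    have hc : HasDerivAt (fun θ => (Real.cos θ : ℂ)) ((-Real.sin θ : ℝ) : ℂ) θ :=
      (Real.hasDerivAt_cos θ).ofReal_comp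
    refine (h0.sub (hc.mul hs)).congr_deriv ?_
    have he := h.eqn (y θ q)
    rw [add_eq_zero_iff_eq_neg] at he
    simp only [map_smul, he, G', Fin.sum_univ_three, Complex.real_smul]
    push_cast
    ring
  -- a bound uniform in `θ`
  choose C₁ hC₁ using fun k => hd k 5
  choose C₂ hC₂ using fun k => hd' k 5
  have hj4 (θ : ℝ) (k : Fin 3) (q : Space) :
      energy q * ‖j k (y θ q)‖ ≤ C₁ k * (energy q ^ 4)⁻¹ := by
    have hE := energy_pos q
    rw [← div_eq_mul_inv, le_div_iff₀ (by positivity)]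
    refine le_trans (le_of_eq ?_) (hC₁ k (Real.cos θ) (hcos θ) q)
    ring
  have hj4' (θ : ℝ) (k : Fin 3) (q : Space) :
      energy q * ‖fderiv ℝ (j k) (y θ q)‖ ≤ C₂ k * (energy q ^ 4)⁻¹ := by
    have hE := energy_pos q
    rw [← div_eq_mul_inv, le_div_iff₀ (by positivity)]
    refine le_trans (le_of_eq ?_) (hC₂ k (Real.cos θ) (hcos θ) q)
    ring
  let B (k : Fin 3) (q : Space) : ℝ := (C₁ k + |κ| * (2 * C₂ k)) * (energy q ^ 4)⁻¹
  have hBi (k : Fin 3) : Integrable (B k) := integrable_energy_pow_inv.const_mul _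
  have hsin (θ : ℝ) : |Real.sin θ| ≤ 1 := Real.abs_sin_le_one θ
  have hcos' (θ : ℝ) : |Real.cos θ| ≤ 1 := Real.abs_cos_le_one θ
  have hGn (θ : ℝ) (k : Fin 3) (q : Space) : ‖G θ k q‖ ≤ C₁ k * (energy q ^ 4)⁻¹ := by
    refine le_trans ?_ (hj4 θ k q)
    have hE := energy_pos q
    simp only [G]
    rw [norm_mul, Complex.norm_real, Real.norm_eq_abs, abs_mul, abs_of_pos hE]
    refine mul_le_mul_of_nonneg_right (mul_le_of_le_one_left hE.le (hsin θ)) (norm_nonneg _)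
  have hG'n (θ : ℝ) (k : Fin 3) (q : Space) : ‖G' θ k q‖ ≤ B k q := by
    have hE := energy_pos q
    have hE1 := one_le_energy q
    have e1 : ‖fderiv ℝ (j k) (y θ q) (1, 0)‖ ≤ ‖fderiv ℝ (j k) (y θ q)‖ := by
      simpa using (fderiv ℝ (j k) (y θ q)).le_opNorm (1, 0)
    have e2 : ‖fderiv ℝ (j k) (y θ q) (0, EuclideanSpace.single k 1)‖ ≤
        ‖fderiv ℝ (j k) (y θ q)‖ := by
      simpa using (fderiv ℝ (j k) (y θ q)).le_opNorm (0, EuclideanSpace.single k 1)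
    have hb1 : |Real.sin θ * v q k| ≤ energy q := by
      rw [abs_mul]
      exact (mul_le_one₀ (hsin θ) (abs_nonneg _) (hv q k)).trans hE1
    have hb2 : |Real.cos θ * v q k| ≤ 1 := by
      rw [abs_mul]
      exact mul_le_one₀ (hcos' θ) (abs_nonneg _) (hv q k)
    have hb3 : |κ * Real.sin θ * energy q| ≤ |κ| * energy q := by
      rw [abs_mul, abs_mul, abs_of_pos hE]
      exact mul_le_mul_of_nonneg_right (mul_le_of_le_one_right (abs_nonneg _) (hsin θ)) hE.le
    calc ‖G' θ k q‖ ≤ |Real.sin θ * v q k| * ‖j k (y θ q)‖ + |κ * Real.sin θ * energy q| *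
        (|Real.cos θ * v q k| * ‖fderiv ℝ (j k) (y θ q) (1, 0)‖ +
          ‖fderiv ℝ (j k) (y θ q) (0, EuclideanSpace.single k 1)‖) := by
          simp only [G']
          refine (norm_add_le _ _).trans ?_
          rw [norm_mul, norm_mul, Complex.norm_real, Complex.norm_real, Real.norm_eq_abs,
            Real.norm_eq_abs]
          refine add_le_add le_rfl (mul_le_mul_of_nonneg_left ((norm_add_le _ _).trans ?_)
            (abs_nonneg _))
          rw [norm_mul, Complex.norm_real, Real.norm_eq_abs]
      _ ≤ energy q * ‖j k (y θ q)‖ + (|κ| * energy q) *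
        (1 * ‖fderiv ℝ (j k) (y θ q)‖ + ‖fderiv ℝ (j k) (y θ q)‖) := by gcongr
      _ = energy q * ‖j k (y θ q)‖ + |κ| * (2 * (energy q * ‖fderiv ℝ (j k) (y θ q)‖)) := by ring
      _ ≤ C₁ k * (energy q ^ 4)⁻¹ + |κ| * (2 * (C₂ k * (energy q ^ 4)⁻¹)) :=
        add_le_add (hj4 θ k q) (mul_le_mul_of_nonneg_left
          (mul_le_mul_of_nonneg_left (hj4' θ k q) zero_le_two) (abs_nonneg _))
      _ = _ := by simp only [B]; ring
  have hjc (θ : ℝ) (k : Fin 3) : Continuous fun q => j k (y θ q) :=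
    (h.contDiff k).continuous.comp (hyc θ)
  have hG'c (θ : ℝ) (k : Fin 3) : Continuous (G' θ k) := by
    have hf (w : ℝ × Space) : Continuous fun q => fderiv ℝ (j k) (y θ q) w :=
      (((h.contDiff k).continuous_fderiv (by simp)).comp (hyc θ)).clm_apply continuous_const
    have hr {r : Space → ℝ} (hr : Continuous r) : Continuous fun q => (r q : ℂ) :=
      Complex.continuous_ofReal.comp hr
    exact ((hr (continuous_const.mul (hvc k))).mul (hjc θ k)).add
      ((hr (continuous_const.mul continuous_energy)).mul
        (((hr (continuous_const.mul (hvc k))).mul (hf _)).add (hf _)))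
  have hGi (θ : ℝ) (k : Fin 3) : Integrable (G θ k) := by
    refine (integrable_energy_pow_inv.const_mul (C₁ k)).mono' ?_
      (Filter.Eventually.of_forall (hGn θ k))
    exact (continuous_iff_continuousAt.2 fun q => (hG θ k q).continuousAt).aestronglyMeasurable
  have hG'i (θ : ℝ) (k : Fin 3) : Integrable (G' θ k) :=
    (hBi k).mono' (hG'c θ k).aestronglyMeasurable (Filter.Eventually.of_forall (hG'n θ k))
  have hdiv (θ : ℝ) (k : Fin 3) : ∫ q, G' θ k q = 0 := by
    have h1 := integral_fderiv_apply_eq_zero (f := G θ k) (v := EuclideanSpace.single k 1)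
      (fun q => (hG θ k q).differentiableAt) (hGi θ k) (by simp only [hG']; exact hG'i θ k)
    simpa only [hG'] using h1
  have hIc (θ : ℝ) : Continuous (I θ) := by
    have := h.contDiff_zero.continuous.comp (hyc θ)
    have hh (k : Fin 3) : Continuous fun q => (v q k : ℂ) * j k (y θ q) :=
      (Complex.continuous_ofReal.comp (hvc k)).mul (hjc θ k)
    exact this.sub (continuous_const.mul (continuous_finsetSum _ fun k _ => hh k))
  have hIi (θ : ℝ) : Integrable (I θ) := by
    obtain ⟨C₀, hC₀⟩ := hd₀ 4
    have hE4 : ∀ {X : ℂ} {C : ℝ} {q : Space}, energy q ^ 4 * ‖X‖ ≤ C → ‖X‖ ≤ C * (energy q ^ 4)⁻¹ := by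
      intro X C q hh
      have hE := energy_pos q
      rw [← div_eq_mul_inv, le_div_iff₀ (by positivity), mul_comm]
      exact hh
    have i0 : Integrable fun q => j₀ (y θ q) :=
      (integrable_energy_pow_inv.const_mul C₀).mono'
        (h.contDiff_zero.continuous.comp (hyc θ)).aestronglyMeasurable
        (Filter.Eventually.of_forall fun q => hE4 (hC₀ _ (hcos θ) q))
    have ik (k : Fin 3) : Integrable fun q => (v q k : ℂ) * j k (y θ q) := by
      refine (integrable_energy_pow_inv.const_mul (C₁ k)).mono'
        ((Complex.continuous_ofReal.comp (hvc k)).mul (hjc θ k)).aestronglyMeasurable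
        (Filter.Eventually.of_forall fun q => ?_)
      refine le_trans ?_ (hj4 θ k q)
      rw [norm_mul, Complex.norm_real, Real.norm_eq_abs]
      exact mul_le_mul_of_nonneg_right ((hv q k).trans (one_le_energy q)) (norm_nonneg _)
    exact i0.sub ((integrable_finsetSum _ fun k _ => ik k).const_mul _)
  have hJ (θ : ℝ) : HasDerivAt (fun θ => ∫ q, I θ q) 0 θ := by
    have h1 := hasDerivAt_integral_of_dominated_loc_of_deriv_le (μ := volume) (x₀ := θ)
      (s := Set.univ) (F := I) (F' := fun θ q => ∑ k, G' θ k q) (bound := fun q => ∑ k, B k q)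
      Filter.univ_mem (Filter.Eventually.of_forall fun θ => (hIc θ).aestronglyMeasurable) (hIi θ)
      (continuous_finsetSum _ fun k _ => hG'c θ k).aestronglyMeasurable
      (Filter.Eventually.of_forall fun q θ _ => (norm_sum_le _ _).trans
        (Finset.sum_le_sum fun k _ => hG'n θ k q))
      (integrable_finsetSum _ fun k _ => hBi k)
      (Filter.Eventually.of_forall fun q θ _ => hI θ q)
    have h2 := h1.2
    rw [integral_finsetSum _ fun k _ => hG'i θ k] at h2
    simpa only [hdiv, Finset.sum_const_zero] using h2
  have hconst := is_const_of_deriv_eq_zero (fun θ => (hJ θ).differentiableAt)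
    (fun θ => (hJ θ).deriv) 0 (Real.pi / 2)
  simpa [I, y, v] using hconst

/-! ### Plancherel's theorem at time zero and the isometry property -/

variable {D : DiracMatrices}

theorem SurfDecay.sesq {κ : ℝ} {φ ψ : ℝ × Space → Spinor} (hφ : SurfDecay κ φ)
    (hψ : SurfDecay κ ψ) (M : Matrix (Fin 4) (Fin 4) ℂ) :
    SurfDecay κ fun y => sesq M (φ y) (ψ y) := by
  obtain ⟨C, -, hC⟩ := exists_bound_sesq M
  exact hφ.of_norm_le_mul hψ C fun y => hC _ _

theorem SurfDecay.fderiv_sesq {κ : ℝ} {φ ψ : ℝ × Space → Spinor} (cφ : ContDiff ℝ 1 φ)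
    (cψ : ContDiff ℝ 1 ψ) (hφ : SurfDecay κ φ) (hψ : SurfDecay κ ψ)
    (hφ' : SurfDecay κ (fderiv ℝ φ)) (hψ' : SurfDecay κ (fderiv ℝ ψ))
    (M : Matrix (Fin 4) (Fin 4) ℂ) :
    SurfDecay κ (fderiv ℝ fun y => DiracHyperboloid.sesq M (φ y) (ψ y)) := by
  obtain ⟨C, hC0, hC⟩ := exists_bound_sesq M
  have h1 : SurfDecay κ fun y => C * (‖φ y‖ * ‖fderiv ℝ ψ y‖) :=
    hφ.of_norm_le_mul hψ' C fun y => by rw [Real.norm_of_nonneg (by positivity)]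
  have h2 : SurfDecay κ fun y => C * (‖fderiv ℝ φ y‖ * ‖ψ y‖) :=
    hφ'.of_norm_le_mul hψ C fun y => by rw [Real.norm_of_nonneg (by positivity)]
  refine h1.of_norm_le_add h2 fun y => ?_
  rw [Real.norm_of_nonneg (by positivity), Real.norm_of_nonneg (by positivity)]
  refine ContinuousLinearMap.opNorm_le_bound _ (by positivity) fun v => ?_
  rw [DiracHyperboloid.fderiv_sesq M cφ cψ]
  refine (norm_add_le _ _).trans ?_
  rw [add_mul]
  refine add_le_add ((hC _ _).trans ?_) ((hC _ _).trans ?_)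
  · rw [mul_assoc, mul_assoc]
    gcongr
    exact (fderiv ℝ ψ y).le_opNorm v
  · rw [mul_assoc, mul_right_comm]
    gcongr
    exact (fderiv ℝ φ y).le_opNorm v

/-- At time zero, `waveInt` is a Fourier transform. -/
theorem waveInt_zero_eq_fourier {V : Type*} [NormedAddCommGroup V] [NormedSpace ℂ V]
    (a : Space → V) (κ : ℝ) (q : Space) :
    waveInt a 0 (κ • q) = 𝓕 a ((-(κ / (2 * Real.pi))) • q) := by
  rw [Real.fourier_eq', waveInt]
  refine integral_congr_ae (Filter.Eventually.of_forall fun p => ?_)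
  simp only
  congr 2
  rw [inner_smul_left, inner_smul_right, real_inner_comm]
  have := Real.pi_ne_zero
  push_cast
  simp only [conj_trivial]
  field_simp
  ring

theorem plancherel_waveInt {κ : ℝ} (hκ : 0 < κ) {a b : Space → Spinor} (ha : TestFn a)
    (hb : TestFn b) : ∫ q : Space, sesq 1 (waveInt a 0 (κ • q)) (waveInt b 0 (κ • q)) =
      (((2 * Real.pi / κ) ^ 3 : ℝ) : ℂ) * ∫ p, sesq 1 (a p) (b p) := by
  let L : Spinor →L[ℂ] ESpinor := (PiLp.continuousLinearEquiv 2 ℂ fun _ : Fin 4 => ℂ).symm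
  have hL {a : Space → Spinor} (ha : TestFn a) (x : Space) :
      waveInt (fun p => L (a p)) 0 x = L (waveInt a 0 x) := by
    rw [waveInt, waveInt, ← L.integral_comp_comm (integrable_wave ha.rapidDecay.integrable 0 x)]
    simp only [map_smul]
  have hLt {a : Space → Spinor} (ha : TestFn a) : TestFn fun p => L (a p) :=
    ⟨(L.restrictScalars ℝ).contDiff.comp ha.contDiff, ha.compact.comp_left (g := L) (map_zero L)⟩
  have hs (u v : Spinor) : sesq 1 u v = inner ℂ (L u) (L v) := by
    change _ = inner ℂ (WithLp.toLp 2 u) (WithLp.toLp 2 v)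
    rw [EuclideanSpace.inner_toLp_toLp, dotProduct_comm, sesq, Matrix.one_mulVec]
  let A : 𝓢(Space, ESpinor) := (hLt ha).compact.toSchwartzMap (hLt ha).contDiff
  let B : 𝓢(Space, ESpinor) := (hLt hb).compact.toSchwartzMap (hLt hb).contDiff
  have hpl := SchwartzMap.integral_inner_fourier_fourier A B
  have e1 : ∫ q : Space, sesq 1 (waveInt a 0 (κ • q)) (waveInt b 0 (κ • q)) =
      ∫ q : Space, inner ℂ (𝓕 A ((-(κ / (2 * Real.pi))) • q)) (𝓕 B ((-(κ / (2 * Real.pi))) • q)) := by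
    refine integral_congr_ae (Filter.Eventually.of_forall fun q => ?_)
    simp only
    rw [hs, ← hL ha, ← hL hb, waveInt_zero_eq_fourier, waveInt_zero_eq_fourier]
    rfl
  rw [e1, Measure.integral_comp_smul volume
    (fun ξ : Space => inner ℂ (𝓕 A ξ) (𝓕 B ξ)) (-(κ / (2 * Real.pi))), hpl]
  have e2 : |((-(κ / (2 * Real.pi))) ^ Module.finrank ℝ Space)⁻¹| = (2 * Real.pi / κ) ^ 3 := by
    rw [finrank_euclideanSpace_fin, abs_inv, abs_pow, abs_neg, abs_of_pos (by positivity),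
      ← inv_pow, inv_div]
  rw [e2, Complex.real_smul]
  congr 1
  refine integral_congr_ae (Filter.Eventually.of_forall fun p => ?_)
  simp only [hs]
  rfl

theorem slash_lift_neg_eq_sub (p : Space) :
    slash D (lift (-p)).1 = ((2 * (lift p).1 0 : ℝ) : ℂ) • D.γ 0 - slash D (lift p).1 := by
  have h0 : (lift (-p)).1 0 = (lift p).1 0 := energy_neg p
  have h1 (k : Fin 3) : (lift (-p)).1 k.succ = -(lift p).1 k.succ := rfl
  have h2 (x : Fin 4 → ℝ) : slash D x = ((metricSign 0 * x 0 : ℝ) : ℂ) • D.γ 0 +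
      ∑ k : Fin 3, ((metricSign k.succ * x k.succ : ℝ) : ℂ) • D.γ k.succ := Fin.sum_univ_succ _
  rw [h2 (lift (-p)).1, h2 (lift p).1]
  simp only [h0, h1]
  rw [← sub_sub, sub_eq_add_neg _ (∑ _, _), ← Finset.sum_neg_distrib]
  congr 1
  · simp only [metricSign, if_true]; push_cast; module
  · refine Finset.sum_congr rfl fun k _ => ?_
    push_cast; module

theorem slash_lift_neg (p : Space) :
    slash D (lift (-p)).1 = D.γ 0 * slash D (lift p).1 * D.γ 0 := by
  have h := congrArg (fun M => D.γ 0 * M) (slash_anticomm D (lift p).1)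
  simp only [mul_add, ← mul_assoc, gamma_zero_sq, one_mul, mul_smul_comm, mul_one] at h
  rw [slash_lift_neg_eq_sub, ← h]
  abel

theorem proj_lift_neg (s : ℝ) (p : Space) :
    proj D s (lift (-p)) = D.γ 0 * proj D s (lift p) * D.γ 0 := by
  simp only [proj, slash_lift_neg, mul_smul_comm, smul_mul_assoc, mul_add, add_mul, mul_one,
    gamma_zero_sq]

theorem proj_adjoint (s : ℝ) (z : Hyp) : (proj D s z)ᴴ = D.γ 0 * proj D s z * D.γ 0 := by
  simp [proj, slash_adjoint, mul_add, add_mul, gamma_zero_sq]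

theorem proj_mul_gamma_mul_proj {s : ℝ} (hs : s * s = 1) (z : Hyp) :
    proj D s z * D.γ 0 * proj D s z = ((s * z.1 0 : ℝ) : ℂ) • proj D s z := by
  have hs' : (s : ℂ) * s = 1 := by exact_mod_cast hs
  have h1 : slash D z.1 * D.γ 0 = ((2 * z.1 0 : ℝ) : ℂ) • 1 - D.γ 0 * slash D z.1 :=
    eq_sub_of_add_eq' (slash_anticomm D z.1)
  have h2 : proj D s z * D.γ 0 = (1 / 2 : ℂ) • (D.γ 0 + (s : ℂ) • (slash D z.1 * D.γ 0)) := by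
    rw [proj, smul_mul_assoc, add_mul, one_mul, smul_mul_assoc]
  rw [h2, h1, smul_mul_assoc, add_mul, smul_mul_assoc, sub_mul, smul_mul_assoc, one_mul, mul_assoc,
    slash_mul_proj D hs, mul_smul_comm, smul_sub, smul_smul (s : ℂ) (s : ℂ), hs']
  push_cast
  module

theorem sesq_amp_amp {s : ℝ} (hs : s * s = 1) (g f : Hyp → Spinor) (p : Space) :
    sesq 1 (amp D s g p) (amp D s f p) = ((energy p)⁻¹ : ℝ) *
      ((s : ℂ) * sesq (D.γ 0 * proj D s (lift p)) (g (lift p)) (f (lift p))) := by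
  have hs' : (s : ℂ) * s = 1 := by exact_mod_cast hs
  have h : (proj D s (lift p))ᴴ * 1 * proj D s (lift p) =
      ((s * (lift p).1 0 : ℝ) : ℂ) • (D.γ 0 * proj D s (lift p)) := by
    rw [mul_one, proj_adjoint, mul_assoc, mul_assoc, ← mul_assoc (proj D s (lift p)),
      proj_mul_gamma_mul_proj hs, mul_smul_comm]
  have hE : (energy p : ℂ) ≠ 0 := by exact_mod_cast (energy_pos p).ne'
  have h0 : (lift p).1 0 = energy p := rfl
  rw [amp, amp, ← Complex.coe_smul, ← Complex.coe_smul, sesq_smul_left, sesq_smul_right,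
    sesq_mulVec_left, sesq_mulVec_right, h, sesq, Matrix.smul_mulVec, dotProduct_smul, h0, sesq]
  simp only [Complex.conj_ofReal, smul_eq_mul]
  push_cast
  field_simp
  linear_combination (s : ℂ) * (star (g (lift p)) ⬝ᵥ
    (D.γ 0 * proj D s (lift p)) *ᵥ f (lift p)) * hs'

/-- At time zero the amplitudes of positive and negative frequency are orthogonal. -/
theorem sesq_amp_amp_neg {s : ℝ} (hs : s * s = 1) (g f : Hyp → Spinor) (p : Space) :
    sesq 1 (amp D s g p) (amp D (-s) f (-p)) = 0 := by
  have h : (proj D s (lift p))ᴴ * 1 * proj D (-s) (lift (-p)) = 0 := by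
    rw [mul_one, proj_adjoint, proj_lift_neg]
    calc _ = D.γ 0 * proj D s (lift p) * (D.γ 0 * D.γ 0) * proj D (-s) (lift p) * D.γ 0 := by
          noncomm_ring
      _ = D.γ 0 * (proj D s (lift p) * proj D (-s) (lift p)) * D.γ 0 := by
          rw [gamma_zero_sq]; noncomm_ring
      _ = 0 := by rw [proj_mul_proj_neg D hs]; simp
  rw [amp, amp, ← Complex.coe_smul, ← Complex.coe_smul, sesq_smul_left, sesq_smul_right,
    sesq_mulVec_left, sesq_mulVec_right, h]
  simp [sesq]

/-- The Fourier amplitude of `diracField` at time zero. -/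
def initialAmp (D : DiracMatrices) (f : Hyp → Spinor) (p : Space) : Spinor :=
  amp D 1 f p + amp D (-1) f (-p)

theorem diracField_zero {f : Hyp → Spinor} (hf : RapidDecay fun p => f (lift p)) (x : Space) :
    diracField D f (0, x) = waveInt (initialAmp D f) 0 x := by
  have hi := (rapidDecay_amp (D := D) hf (-1)).integrable
  have e : waveInt (amp D (-1) f) 0 (-x) = waveInt (fun p => amp D (-1) f (-p)) 0 x := by
    rw [waveInt, waveInt, ← integral_neg_eq_self]
    simp
  rw [diracField, neg_zero, e, ← waveInt_add (rapidDecay_amp hf 1).integrable hi.comp_neg]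
  rfl

theorem testFn_comp_neg {V : Type*} [NormedAddCommGroup V] [NormedSpace ℂ V] {a : Space → V}
    (ha : TestFn a) : TestFn fun p => a (-p) :=
  ⟨ha.contDiff.comp contDiff_neg, ha.compact.comp_homeomorph (Homeomorph.neg Space)⟩

theorem testFn_initialAmp {f : Hyp → Spinor} (hf : TestFn fun p => f (lift p)) :
    TestFn (initialAmp D f) :=
  ⟨(testFn_amp hf 1).contDiff.add (testFn_comp_neg (testFn_amp hf (-1))).contDiff,
    (testFn_amp hf 1).compact.add (testFn_comp_neg (testFn_amp hf (-1))).compact⟩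

theorem integral_initialAmp {g f : Hyp → Spinor} (hg : TestFn fun p => g (lift p))
    (hf : TestFn fun p => f (lift p)) :
    ∫ p, sesq 1 (initialAmp D g p) (initialAmp D f p) = scalar D g f := by
  have h2 (p : Space) : sesq 1 (amp D (-1) g (-p)) (amp D 1 f p) = 0 := by
    have := sesq_amp_amp_neg (D := D) (s := -1) (by norm_num) g f (-p)
    simpa using this
  have h1 (p : Space) : sesq 1 (amp D 1 g p) (amp D (-1) f (-p)) = 0 :=
    sesq_amp_amp_neg (D := D) (s := 1) (by norm_num) g f p
  have hp (p : Space) : sesq 1 (initialAmp D g p) (initialAmp D f p) =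
      sesq 1 (amp D 1 g p) (amp D 1 f p) +
        sesq 1 (amp D (-1) g (-p)) (amp D (-1) f (-p)) := by
    simp only [initialAmp, sesq_add_left, sesq_add_right, h1, h2]
    ring
  have hi (s : ℝ) : Integrable fun p => sesq 1 (amp D s g p) (amp D s f p) := by
    have := ((rapidDecay_amp (D := D) hg.rapidDecay s).dotProduct
      (rapidDecay_amp (D := D) hf.rapidDecay s)).integrable
    simpa [sesq] using this
  simp only [hp]
  rw [integral_add (hi 1) (hi (-1)).comp_neg,
    integral_neg_eq_self (fun p => sesq 1 (amp D (-1) g p) (amp D (-1) f p)),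
    ← integral_add (hi 1) (hi (-1)), scalar, integral_μH]
  refine integral_congr_ae (Filter.Eventually.of_forall fun p => ?_)
  simp only
  rw [sesq_amp_amp (by norm_num), sesq_amp_amp (by norm_num), density_eq, Complex.real_smul,
    ← proj_sub_proj, mul_sub, Matrix.sub_mulVec, dotProduct_sub]
  simp only [sesq]
  push_cast
  ring

theorem fourierF_lift_eq_diracField (κ : ℝ) {f : Hyp → Spinor}
    (hf : RapidDecay fun p => f (lift p)) (q : Space) : fourierF D κ f (lift q) =
      (fourierConst κ : ℂ) • diracField D f (κ * energy q, κ • q) := by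
  rw [fourierF_lift κ hf, diracField, surfInt, surfInt, neg_mul, neg_smul]

theorem fourierConst_sq {κ : ℝ} (hκ : 0 < κ) :
    fourierConst κ * fourierConst κ = (κ / (2 * Real.pi)) ^ 3 := by
  have : 0 < κ / (2 * Real.pi) := by positivity
  rw [fourierConst, ← Real.rpow_add this]
  norm_num

/-- The isometry property: the scalar product of the transforms is the flux of the Dirac current
through the hyperboloid, and hence equal to its charge at time zero. -/
theorem scalar_fourierF {κ : ℝ} (hκ : 0 < κ) {g f : Hyp → Spinor} (hg : IsTest g)
    (hf : IsTest f) : scalar D (fourierF D κ g) (fourierF D κ f) = scalar D g f := by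
  have hg' := isTest_iff.1 hg
  have hf' := isTest_iff.1 hf
  have sg := isDiracSolution_diracField (D := D) hg'.rapidDecay
  have sf := isDiracSolution_diracField (D := D) hf'.rapidDecay
  obtain ⟨dg, dg'⟩ := surfDecay_diracField D hκ.ne' hg'
  obtain ⟨df, df'⟩ := surfDecay_diracField D hκ.ne' hf'
  have hflux := (sg.isConserved sf).flux_eq (κ := κ) (fun k => dg.sesq df (alpha D k))
    (dg.sesq df 1) (fun k => SurfDecay.fderiv_sesq sg.contDiff sf.contDiff dg df dg' df' (alpha D k))
  simp only [diracField_zero hg'.rapidDecay, diracField_zero hf'.rapidDecay] at hflux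
  rw [plancherel_waveInt hκ (testFn_initialAmp hg') (testFn_initialAmp hf'),
    integral_initialAmp hg' hf'] at hflux
  have hc : (fourierConst κ : ℂ) * fourierConst κ * (((2 * Real.pi / κ) ^ 3 : ℝ) : ℂ) = 1 := by
    have h := fourierConst_sq hκ
    have h2 : fourierConst κ * fourierConst κ * (2 * Real.pi / κ) ^ 3 = 1 := by
      rw [h, ← mul_pow]
      have := Real.pi_pos
      field_simp
    exact_mod_cast h2
  rw [← one_mul (scalar D g f), ← hc, mul_assoc, ← hflux, scalar, integral_μH,
    ← integral_const_mul]
  refine integral_congr_ae (Filter.Eventually.of_forall fun q => ?_)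
  have hE : (energy q : ℂ) ≠ 0 := by exact_mod_cast (energy_pos q).ne'
  have h0 : (lift q).1 0 = energy q := rfl
  have h1 (k : Fin 3) : (lift q).1 k.succ = q k := rfl
  simp only
  rw [density_eq, fourierF_lift_eq_diracField κ hg'.rapidDecay,
    fourierF_lift_eq_diracField κ hf'.rapidDecay, gamma_zero_mul_slash, Complex.real_smul]
  generalize diracField D g (κ * energy q, κ • q) = u
  generalize diracField D f (κ * energy q, κ • q) = v
  change _ * sesq _ _ _ = _
  rw [sesq_smul_left, sesq_smul_right]
  have hs : sesq (((lift q).1 0 : ℂ) • 1 - ∑ k : Fin 3, ((lift q).1 k.succ : ℂ) • alpha D k) u v =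
      energy q * sesq 1 u v - ∑ k, (q k : ℂ) * sesq (alpha D k) u v := by
    simp only [sesq, h0, h1, Fin.sum_univ_three, Matrix.sub_mulVec, Matrix.add_mulVec,
      Matrix.smul_mulVec, dotProduct_sub, dotProduct_add, dotProduct_smul, smul_eq_mul]
  rw [hs]
  simp only [Complex.conj_ofReal, Fin.sum_univ_three]
  push_cast
  field_simp

/-! ### Finite speed of propagation -/

section FinitePropagation

variable {J₀ : ℝ × Space → ℝ} {J : Fin 3 → ℝ × Space → ℝ}

/-- A conserved real current that is causal (time-like or light-like, future directed) and vanishes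
at time zero outside the ball of radius `δ` vanishes outside the domain of influence of this ball.
The charge in the shrinking balls of radius `R - s` around `x₁` is measured with the smooth weight
`m ((R - s)² - |x - x₁|²)`; it does not increase with `s`. -/
theorem charge_eq_zero_of_causal (h₀ : ContDiff ℝ 1 J₀) (hJ : ∀ k, ContDiff ℝ 1 (J k))
    (hc : ∀ y, fderiv ℝ J₀ y (1, 0) +
      ∑ k, fderiv ℝ (J k) y (0, EuclideanSpace.single k 1) = 0)
    (hp : ∀ y (n : Space), ‖n‖ ≤ 1 → 0 ≤ J₀ y + ∑ k, n k * J k y) {δ : ℝ}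
    (hz : ∀ x, δ < ‖x‖ → J₀ (0, x) = 0) {t : ℝ} {x₁ : Space} (ht : |t| + δ < ‖x₁‖) :
    J₀ (t, x₁) = 0 := by
  obtain ⟨σ, hσ1, hσ⟩ : ∃ σ : ℝ, |σ| = 1 ∧ σ * |t| = t := by
    rcases le_total 0 t with h | h
    · exact ⟨1, by simp, by rw [abs_of_nonneg h, one_mul]⟩
    · exact ⟨-1, by simp, by rw [abs_of_nonpos h]; ring⟩
  obtain ⟨R, hR1, hR2⟩ : ∃ R, |t| < R ∧ R < ‖x₁‖ - δ := exists_between (by linarith)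
  let m := expNegInvGlue
  have hm : ContDiff ℝ 1 m := expNegInvGlue.contDiff (n := 1)
  have hmd (y : ℝ) : HasDerivAt m (deriv m y) y := (hm.differentiable (by simp) y).hasDerivAt
  have hm0 (y : ℝ) : 0 ≤ deriv m y := expNegInvGlue.monotone.deriv_nonneg
  have hmz {y : ℝ} (hy : y < 0) : deriv m y = 0 := by
    have : m =ᶠ[nhds y] fun _ => 0 := by
      filter_upwards [gt_mem_nhds hy] with z hz
      exact expNegInvGlue.zero_of_nonpos hz.le
    rw [this.deriv_eq, deriv_const]
  have hmc : Continuous (deriv m) := hm.continuous_deriv (by simp)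
  let b (s : ℝ) (x : Space) : ℝ := (R - s) ^ 2 - ‖x - x₁‖ ^ 2
  have hb : Continuous fun y : ℝ × Space => b y.1 y.2 := by fun_prop
  have hbs {s : ℝ} {x : Space} {ρ : ℝ} (hρ : |R - s| ≤ ρ) (hx : x ∉ Metric.closedBall x₁ ρ) :
      b s x < 0 := by
    rw [Metric.mem_closedBall, dist_eq_norm, not_le] at hx
    have := hρ.trans_lt hx
    simp only [b]
    rw [sub_neg, sq_lt_sq, abs_of_nonneg (norm_nonneg _)]
    exact this
  let y (s : ℝ) (x : Space) : ℝ × Space := (σ * s, x)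
  have hyc : Continuous fun z : ℝ × Space => y z.1 z.2 := by fun_prop
  let g (s : ℝ) (x : Space) : ℝ := m (b s x) * J₀ (y s x)
  let g' (s : ℝ) (x : Space) : ℝ := -(2 * (R - s)) * deriv m (b s x) * J₀ (y s x) +
    m (b s x) * (σ * fderiv ℝ J₀ (y s x) (1, 0))
  have hgc : Continuous fun z : ℝ × Space => g z.1 z.2 :=
    (hm.continuous.comp hb).mul (h₀.continuous.comp hyc)
  have hg'c : Continuous fun z : ℝ × Space => g' z.1 z.2 := by
    have h1 : Continuous fun z : ℝ × Space => fderiv ℝ J₀ (y z.1 z.2) (1, 0) :=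
      (((h₀.continuous_fderiv (by simp))).comp hyc).clm_apply continuous_const
    have h2 := hmc.comp hb
    have h3 := h₀.continuous.comp hyc
    have h4 := hm.continuous.comp hb
    exact (((by fun_prop : Continuous fun z : ℝ × Space => -(2 * (R - z.1))).mul h2).mul h3).add
      (h4.mul (continuous_const.mul h1))
  have hg (s : ℝ) (x : Space) : HasDerivAt (fun s => g s x) (g' s x) s := by
    have h1 : HasDerivAt (fun s => b s x) (-(2 * (R - s))) s := by
      refine ((((hasDerivAt_id s).const_sub R).pow 2).sub_const (‖x - x₁‖ ^ 2)).congr_deriv ?_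
      simp
    have h2 : HasDerivAt (fun s => y s x) (σ • ((1 : ℝ), (0 : Space))) s := by
      refine (((hasDerivAt_id s).const_mul σ).prodMk (hasDerivAt_const s x)).congr_deriv ?_
      simp
    have h3 := (h₀.differentiable (by simp) (y s x)).hasFDerivAt.comp_hasDerivAt s h2
    refine (((hmd (b s x)).comp s h1).mul h3).congr_deriv ?_
    simp only [g', map_smul, smul_eq_mul, Function.comp]
    ring
  have hgz {s : ℝ} {x : Space} (hx : b s x < 0) : g s x = 0 := by
    simp only [g, m]
    rw [expNegInvGlue.zero_of_nonpos hx.le, zero_mul]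
  have hg'z {s : ℝ} {x : Space} (hx : b s x < 0) : g' s x = 0 := by
    simp only [g', hmz hx, m]
    rw [expNegInvGlue.zero_of_nonpos hx.le]
    ring
  have hcs {V : Type} [NormedAddCommGroup V] (s : ℝ) {f : Space → V} (hf : ∀ x, b s x < 0 → f x = 0) :
      HasCompactSupport f :=
    HasCompactSupport.intro (isCompact_closedBall x₁ |R - s|) fun x hx => hf x (hbs le_rfl hx)
  have hsec (s : ℝ) : Continuous fun x : Space => (s, x) := by fun_prop
  have hgi (s : ℝ) : Integrable (g s) :=
    (hgc.comp (hsec s)).integrable_of_hasCompactSupport (hcs s fun x => hgz)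
  -- the weighted charge
  have hE (s : ℝ) : HasDerivAt (fun s => ∫ x, g s x) (∫ x, g' s x) s := by
    obtain ⟨C, hC⟩ := ((isCompact_closedBall s 1).prod
      (isCompact_closedBall x₁ (|R - s| + 1))).exists_bound_of_continuousOn hg'c.continuousOn
    refine (hasDerivAt_integral_of_dominated_loc_of_deriv_le (μ := volume) (x₀ := s)
      (s := Metric.ball s 1) (F := g) (F' := g')
      (bound := Set.indicator (Metric.closedBall x₁ (|R - s| + 1)) fun _ => C)
      (Metric.ball_mem_nhds s one_pos)
      (Filter.Eventually.of_forall fun s => (hgc.comp (hsec s)).aestronglyMeasurable) (hgi s)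
      (hg'c.comp (hsec s)).aestronglyMeasurable
      (Filter.Eventually.of_forall fun x s' hs' => ?_) ?_
      (Filter.Eventually.of_forall fun x s' _ => hg s' x)).2
    · by_cases hx : x ∈ Metric.closedBall x₁ (|R - s| + 1)
      · rw [Set.indicator_of_mem hx]
        exact hC (s', x) ⟨Metric.ball_subset_closedBall hs', hx⟩
      · rw [Set.indicator_of_notMem hx, hg'z (hbs ?_ hx), norm_zero]
        rw [Metric.mem_ball, Real.dist_eq] at hs'
        calc |R - s'| = |(R - s) - (s' - s)| := by ring_nf
          _ ≤ |R - s| + |s' - s| := abs_sub _ _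
          _ ≤ _ := by linarith
    · exact (integrable_indicator_iff measurableSet_closedBall).2
        (integrableOn_const (isCompact_closedBall _ _).measure_ne_top)
  have hE' {s : ℝ} (hs : s < R) : ∫ x, g' s x ≤ 0 := by
    let G (k : Fin 3) (x : Space) : ℝ := σ * (m (b s x) * J k (y s x))
    have hbx (x : Space) : HasFDerivAt (b s) (-(2 • innerSL ℝ (x - x₁))) x := by
      have h1 : HasFDerivAt (fun x : Space => ‖x - x₁‖ ^ 2) (2 • innerSL ℝ (x - x₁)) x :=
        ((hasFDerivAt_id x).sub_const x₁).norm_sq.congr_fderiv (by ext; simp)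
      exact h1.const_sub ((R - s) ^ 2)
    have hG (k : Fin 3) (x : Space) : HasFDerivAt (G k)
        (σ • (m (b s x) • (fderiv ℝ (J k) (y s x)).comp (ContinuousLinearMap.inr ℝ ℝ Space) +
          J k (y s x) • (deriv m (b s x) • (-(2 • innerSL ℝ (x - x₁)))))) x := by
      have h1 := (hmd (b s x)).comp_hasFDerivAt x (hbx x)
      have h2 := ((hJ k).differentiable (by simp) (y s x)).hasFDerivAt.comp x
        (hasFDerivAt_prodMk_right (σ * s) x)
      exact (h1.mul h2).const_mul σ
    have hG' (k : Fin 3) (x : Space) : fderiv ℝ (G k) x (EuclideanSpace.single k 1) =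
        σ * (m (b s x) * fderiv ℝ (J k) (y s x) (0, EuclideanSpace.single k 1) -
          2 * deriv m (b s x) * ((x - x₁) k * J k (y s x))) := by
      have h2 : innerSL ℝ (x - x₁) (EuclideanSpace.single k 1) = (x - x₁) k := by
        rw [innerSL_apply_apply, EuclideanSpace.inner_single_right]; simp
      rw [(hG k x).fderiv]
      simp only [_root_.add_apply, _root_.smul_apply, _root_.neg_apply,
        ContinuousLinearMap.comp_apply, ContinuousLinearMap.inr_apply, h2, smul_eq_mul, nsmul_eq_mul]
      push_cast
      ring
    have hGc (k : Fin 3) : Continuous (G k) :=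
      continuous_iff_continuousAt.2 fun x => (hG k x).continuousAt
    have hG'c (k : Fin 3) : Continuous fun x => fderiv ℝ (G k) x (EuclideanSpace.single k 1) := by
      simp only [hG']
      have h1 : Continuous fun x => fderiv ℝ (J k) (y s x) (0, EuclideanSpace.single k 1) :=
        ((((hJ k).continuous_fderiv (by simp))).comp (hyc.comp (hsec s))).clm_apply continuous_const
      have h2 := hmc.comp (hb.comp (hsec s))
      have h3 := (hJ k).continuous.comp (hyc.comp (hsec s))
      have h4 := hm.continuous.comp (hb.comp (hsec s))
      have h5 : Continuous fun x : Space => (x - x₁) k := by fun_prop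
      exact continuous_const.mul ((h4.mul h1).sub ((continuous_const.mul h2).mul (h5.mul h3)))
    have hGi (k : Fin 3) : Integrable (G k) := by
      refine (hGc k).integrable_of_hasCompactSupport (hcs s fun x hx => ?_)
      simp only [G, m]
      rw [expNegInvGlue.zero_of_nonpos hx.le]; ring
    have hG'i (k : Fin 3) : Integrable fun x => fderiv ℝ (G k) x (EuclideanSpace.single k 1) := by
      refine (hG'c k).integrable_of_hasCompactSupport (hcs s fun x hx => ?_)
      simp only [hG', hmz hx, m]
      rw [expNegInvGlue.zero_of_nonpos hx.le]; ring
    have hdiv (k : Fin 3) := integral_fderiv_apply_eq_zero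
      (fun x => (hG k x).differentiableAt) (hGi k) (hG'i k)
    have hg'i : Integrable (g' s) :=
      (hg'c.comp (hsec s)).integrable_of_hasCompactSupport (hcs s fun x => hg'z)
    have hsum : ∫ x, g' s x = ∫ x, (g' s x +
        ∑ k, fderiv ℝ (G k) x (EuclideanSpace.single k 1)) := by
      rw [integral_add hg'i (integrable_finsetSum _ fun k _ => hG'i k),
        integral_finsetSum _ fun k _ => hG'i k]
      simp only [hdiv, Finset.sum_const_zero, add_zero]
    rw [hsum]
    refine integral_nonpos fun x => ?_
    have he := hc (y s x)
    have e : g' s x + ∑ k, fderiv ℝ (G k) x (EuclideanSpace.single k 1) =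
        -(2 * deriv m (b s x) * ((R - s) * J₀ (y s x) + σ * ∑ k, (x - x₁) k * J k (y s x))) := by
      simp only [hG', g', Fin.sum_univ_three] at he ⊢
      linear_combination σ * m (b s x) * he
    rw [Pi.zero_apply, e, neg_nonpos]
    rcases lt_or_ge (b s x) 0 with hx | hx
    · rw [hmz hx]; simp
    · have hRs : 0 < R - s := by linarith
      refine mul_nonneg (mul_nonneg zero_le_two (hm0 _)) ?_
      have hn := hp (y s x) ((σ * (R - s)⁻¹) • (x - x₁)) (by
        have hx' : ‖x - x₁‖ ≤ R - s := by
          refine abs_le_of_sq_le_sq' ?_ hRs.le |>.2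
          simp only [b] at hx
          linarith
        rw [norm_smul, norm_mul, Real.norm_eq_abs, hσ1, one_mul, norm_inv,
          Real.norm_of_nonneg hRs.le, inv_mul_le_iff₀ hRs, mul_one]
        exact hx')
      have := mul_nonneg hRs.le hn
      refine this.trans_eq ?_
      simp only [PiLp.smul_apply, smul_eq_mul, Fin.sum_univ_three]
      field_simp
  have hnn (y : ℝ × Space) : 0 ≤ J₀ y := by simpa using hp y 0 (by simp)
  have hgnn (s : ℝ) (x : Space) : 0 ≤ g s x := mul_nonneg (expNegInvGlue.nonneg _) (hnn _)
  have hanti : AntitoneOn (fun s => ∫ x, g s x) (Set.Icc 0 |t|) := by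
    refine antitoneOn_of_deriv_nonpos (convex_Icc _ _)
      (fun s _ => (hE s).continuousAt.continuousWithinAt)
      (fun s _ => (hE s).differentiableAt.differentiableWithinAt) fun s hs => ?_
    rw [interior_Icc] at hs
    rw [(hE s).deriv]
    exact hE' (hs.2.trans hR1)
  have hzero : ∫ x, g 0 x = 0 := by
    have : g 0 = fun _ => 0 := by
      funext x
      rcases lt_or_ge (b 0 x) 0 with hx | hx
      · exact hgz hx
      · have hx' : ‖x - x₁‖ ≤ R := by
          refine abs_le_of_sq_le_sq' ?_ ((abs_nonneg t).trans hR1.le) |>.2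
          simp only [b, sub_zero] at hx
          linarith
        have h3 : ‖x₁‖ ≤ ‖x‖ + ‖x - x₁‖ := by
          have := norm_sub_le x (x - x₁)
          simpa using this
        simp only [g, y, mul_zero]
        rw [hz x (by linarith), mul_zero]
    rw [this, integral_zero]
  have hfin : ∫ x, g |t| x = 0 := by
    refine le_antisymm ?_ (integral_nonneg (hgnn _))
    have := hanti (Set.left_mem_Icc.2 (abs_nonneg t)) (Set.right_mem_Icc.2 (abs_nonneg t))
      (abs_nonneg t)
    simpa only [hzero] using this
  have hgt : g |t| = 0 :=
    ((hgc.comp (hsec |t|)).ae_eq_iff_eq volume continuous_zero).1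
      ((integral_eq_zero_iff_of_nonneg (hgnn _) (hgi _)).1 hfin)
  have hx := congrFun hgt x₁
  simp only [g, y, b, hσ, sub_self, norm_zero, Pi.zero_apply] at hx
  refine (mul_eq_zero.1 hx).resolve_left (expNegInvGlue.pos_of_pos ?_).ne'
  have : 0 < R - |t| := by linarith
  have := pow_pos this 2
  linarith

end FinitePropagation

variable {D : DiracMatrices}

theorem re_sesq_one_self (v : Spinor) : (sesq 1 v v).re = ∑ i, ‖v i‖ ^ 2 := by
  simp only [sesq, Matrix.one_mulVec, dotProduct, Complex.re_sum, Pi.star_apply]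
  refine Finset.sum_congr rfl fun i _ => ?_
  rw [← Complex.normSq_eq_norm_sq, Complex.normSq_apply]
  simp

/-- The current of a spinor is causal, since `α · n` squares to `|n|²`. -/
theorem current_causal (v : Spinor) {n : Space} (hn : ‖n‖ ≤ 1) :
    0 ≤ (sesq 1 v v).re + ∑ k, n k * (sesq (alpha D k) v v).re := by
  let A : Matrix (Fin 4) (Fin 4) ℂ := ∑ k, (n k : ℂ) • alpha D k
  let z : Fin 4 → ℝ := Fin.cons 0 fun k => n k
  have hA : D.γ 0 * slash D z = -A := by
    rw [gamma_zero_mul_slash]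
    simp [z, A]
  have hAA : Aᴴ = A := by
    simp [A, Matrix.conjTranspose_sum, alpha_adjoint]
  have hz : mdot z z = -‖n‖ ^ 2 := by
    rw [mdot_self, EuclideanSpace.real_norm_sq_eq, Fin.sum_univ_three]
    change (0 : ℝ) ^ 2 - (n 0 ^ 2 + n 1 ^ 2 + n 2 ^ 2) = _
    ring
  have hsq : A * A = ((‖n‖ ^ 2 : ℝ) : ℂ) • 1 := by
    have h1 : slash D z * D.γ 0 = -(D.γ 0 * slash D z) := by
      have := slash_anticomm D z
      rw [eq_neg_iff_add_eq_zero, add_comm, this]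
      simp [z]
    calc A * A = (D.γ 0 * slash D z) * (D.γ 0 * slash D z) := by rw [hA]; simp
      _ = D.γ 0 * (slash D z * D.γ 0) * slash D z := by noncomm_ring
      _ = -((D.γ 0 * D.γ 0) * (slash D z * slash D z)) := by rw [h1]; noncomm_ring
      _ = _ := by rw [gamma_zero_sq, slash_sq, hz]; simp
  have hnn : 0 ≤ (sesq 1 (v + A *ᵥ v) (v + A *ᵥ v)).re := by
    rw [re_sesq_one_self]; positivity
  have h0 : 0 ≤ (sesq 1 v v).re := by rw [re_sesq_one_self]; positivity
  have hs : sesq A v v = ∑ k, (n k : ℂ) * sesq (alpha D k) v v := by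
    simp only [sesq, A, Fin.sum_univ_three, Matrix.add_mulVec, Matrix.smul_mulVec, dotProduct_add,
      dotProduct_smul, smul_eq_mul]
  have hs2 : sesq (A * A) v v = ((‖n‖ ^ 2 : ℝ) : ℂ) * sesq 1 v v := by
    rw [hsq, sesq, Matrix.smul_mulVec, dotProduct_smul, sesq, smul_eq_mul]
  rw [sesq_add_left, sesq_add_right, sesq_add_right, sesq_mulVec_left, sesq_mulVec_left,
    sesq_mulVec_right, sesq_mulVec_right, hAA, mul_one, one_mul, hs2, Complex.add_re,
    Complex.add_re, Complex.add_re, Complex.re_ofReal_mul] at hnn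
  have hs' : (sesq A v v).re = ∑ k, n k * (sesq (alpha D k) v v).re := by
    rw [hs, Complex.re_sum]
    simp only [Complex.re_ofReal_mul]
  rw [← hs']
  have : ‖n‖ ^ 2 ≤ 1 := pow_le_one₀ (norm_nonneg _) hn
  nlinarith

/-- Solutions of the Dirac equation propagate at most with the speed of light. -/
theorem IsDiracSolution.eq_zero_of_lt_norm {ψ : ℝ × Space → Spinor} (h : IsDiracSolution D ψ)
    {δ : ℝ} (hz : ∀ x, δ < ‖x‖ → ψ (0, x) = 0) {t : ℝ} {x : Space} (ht : |t| + δ < ‖x‖) :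
    ψ (t, x) = 0 := by
  have hcur := h.isConserved h
  have hre {f : ℝ × Space → ℂ} (hf : ContDiff ℝ 1 f) (y v : ℝ × Space) :
      fderiv ℝ (fun y => (f y).re) y v = (fderiv ℝ f y v).re := by
    have := Complex.reCLM.hasFDerivAt.comp y ((hf.differentiable (by simp) y).hasFDerivAt)
    have e : fderiv ℝ (fun y => (f y).re) y = _ := this.fderiv
    rw [e]; rfl
  have key := charge_eq_zero_of_causal (J₀ := fun y => (sesq 1 (ψ y) (ψ y)).re)
    (J := fun k y => (sesq (alpha D k) (ψ y) (ψ y)).re)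
    (Complex.reCLM.contDiff.comp hcur.contDiff_zero)
    (fun k => Complex.reCLM.contDiff.comp (hcur.contDiff k))
    (fun y => by
      have := congrArg Complex.re (hcur.eqn y)
      rw [Complex.add_re, Complex.re_sum] at this
      rw [hre hcur.contDiff_zero]
      simp only [hre (hcur.contDiff _)]
      exact this)
    (fun y n hn => current_causal (D := D) (ψ y) hn) (δ := δ)
    (fun x hx => by simp only [hz x hx]; simp [sesq]) ht
  simp only [re_sesq_one_self] at key
  funext i
  have := (Finset.sum_eq_zero_iff_of_nonneg (fun i _ => by positivity)).1 key i (Finset.mem_univ i)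
  simpa using this

/-! ### The transforms of functions with disjoint supports -/

/-- Even Schwartz functions approximating `1`, whose Fourier transforms have supports shrinking to
the origin. -/
theorem exists_band_limited : ∃ (ρ : ℕ → 𝓢(Space, ℂ)) (C : ℝ), (∀ n p, ‖ρ n p‖ ≤ C) ∧
    (∀ p, Filter.Tendsto (fun n => ρ n p) Filter.atTop (nhds 1)) ∧ (∀ n p, ρ n (-p) = ρ n p) ∧
    ∀ (n : ℕ) (x : Space), 7 * ((n : ℝ) + 1)⁻¹ < ‖x‖ → waveInt (ρ n) 0 x = 0 := by
  let b : ContDiffBump (0 : Space) := ⟨1 / 2, 1, by norm_num, by norm_num⟩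
  let η : Space → ℂ := fun x => (b.normed volume x : ℂ)
  have hη : HasCompactSupport η :=
    b.hasCompactSupport_normed.comp_left (g := fun r : ℝ => (r : ℂ)) Complex.ofReal_zero
  let H : 𝓢(Space, ℂ) := hη.toSchwartzMap
    (Complex.ofRealCLM.contDiff.comp (b.contDiff_normed (n := (⊤ : ℕ∞))))
  have hH (x : Space) : H x = b.normed volume x := rfl
  let ρ₀ : 𝓢(Space, ℂ) := 𝓕⁻ H
  have hρ (p : Space) : ρ₀ p = ∫ v : Space, Complex.exp (↑(2 * Real.pi * inner ℝ v p) * Complex.I) •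
      H v := by
    rw [← Real.fourierInv_eq', ← SchwartzMap.fourierInv_coe]
  have hρ0 : ρ₀ 0 = 1 := by
    rw [hρ]
    simp only [inner_zero_right, mul_zero, Complex.ofReal_zero, zero_mul, Complex.exp_zero, one_smul,
      hH]
    rw [integral_complex_ofReal, b.integral_normed, Complex.ofReal_one]
  have hρn (p : Space) : ρ₀ (-p) = ρ₀ p := by
    rw [hρ, hρ, ← integral_neg_eq_self]
    simp only [inner_neg_left, inner_neg_right, neg_neg, hH, b.normed_neg]
  have hw (x : Space) (hx : 7 < ‖x‖) : waveInt ρ₀ 0 x = 0 := by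
    have h1 := waveInt_zero_eq_fourier ρ₀ 1 x
    rw [one_smul] at h1
    rw [h1, ← SchwartzMap.fourier_coe, FourierTransform.fourier_fourierInv_eq, hH]
    have : (-(1 / (2 * Real.pi))) • x ∉ Function.support (b.normed volume) := by
      rw [b.support_normed_eq, mem_ball_zero_iff, norm_smul, norm_neg, Real.norm_of_nonneg
        (by positivity)]
      change ¬ _ < (1 : ℝ)
      rw [not_lt, div_mul_eq_mul_div, one_mul, le_div_iff₀ (by positivity), one_mul]
      linarith [Real.pi_lt_d2]
    rw [Function.notMem_support.1 this, Complex.ofReal_zero]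
  have hn (n : ℕ) : ((n : ℝ) + 1)⁻¹ ≠ 0 := by positivity
  obtain ⟨C, hC⟩ := ρ₀.decay 0 0
  refine ⟨fun n => SchwartzMap.compCLMOfContinuousLinearEquiv ℂ
    (ContinuousLinearEquiv.smulLeft (Units.mk0 _ (hn n))) ρ₀, C, fun n p => ?_, fun p => ?_,
    fun n p => ?_, fun n x hx => ?_⟩
  · have := hC.2 ((((n : ℝ) + 1)⁻¹) • p)
    simpa using this
  · have h1 : Filter.Tendsto (fun n : ℕ => ((n : ℝ) + 1)⁻¹ • p) Filter.atTop (nhds 0) := by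
      have h := (tendsto_one_div_add_atTop_nhds_zero_nat (𝕜 := ℝ)).smul_const p
      simpa using h
    have h2 := (ρ₀.continuous.tendsto 0).comp h1
    rw [hρ0] at h2
    exact h2
  · change ρ₀ ((((n : ℝ) + 1)⁻¹) • -p) = ρ₀ ((((n : ℝ) + 1)⁻¹) • p)
    rw [smul_neg, hρn]
  · set δ := ((n : ℝ) + 1)⁻¹ with hδ
    have hδ0 : 0 < δ := by positivity
    have h1 := Measure.integral_comp_smul volume (fun p : Space =>
      Complex.exp (-(Complex.I * ((0 * energy p - inner ℝ (δ⁻¹ • x) p : ℝ) : ℂ))) • ρ₀ p) δ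
    have h2 : waveInt ρ₀ 0 (δ⁻¹ • x) = 0 := by
      refine hw _ ?_
      rw [norm_smul, norm_inv, Real.norm_of_nonneg hδ0.le, lt_inv_mul_iff₀ hδ0, mul_comm]
      exact hx
    rw [waveInt] at h2
    rw [h2, smul_zero] at h1
    rw [waveInt, ← h1]
    refine integral_congr_ae (Filter.Eventually.of_forall fun p => ?_)
    have h3 : inner ℝ (δ⁻¹ • x) (δ • p) = inner ℝ x p := by
      rw [inner_smul_left, inner_smul_right, conj_trivial, inv_mul_cancel_left₀ hδ0.ne']
    simp only [h3, zero_mul]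
    rfl

variable {D : DiracMatrices}

theorem proj_lift_sub (p : Space) :
    proj D 1 (lift p) - proj D (-1) (lift (-p)) = (energy p : ℂ) • D.γ 0 := by
  have h0 : (lift p).1 0 = energy p := rfl
  simp only [proj, slash_lift_neg_eq_sub, h0]
  push_cast
  module

/-- The solution of the Dirac equation with momentum space data `ρ w`, where `w` is a constant spinor
and the Fourier transform of `ρ` is supported in the ball of radius `δ`, vanishes at space-like
distance from this ball. Since `ρ` is even, the initial data are `γ⁰ w` times this Fourier
transform. -/
theorem diracField_band_limited_eq_zero {ρ : 𝓢(Space, ℂ)} (he : ∀ p, ρ (-p) = ρ p) {δ : ℝ}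
    (hρ : ∀ x, δ < ‖x‖ → waveInt ρ 0 x = 0) (w : Spinor) {t : ℝ} {x : Space}
    (hx : |t| + δ < ‖x‖) : diracField D (fun z => ρ (spatial z) • w) (t, x) = 0 := by
  have hr : RapidDecay fun p => (fun z => ρ (spatial z) • w) (lift p) := by
    simp only [spatial_lift]
    exact (rapidDecay_schwartz ρ).clm ((ContinuousLinearMap.id ℂ ℂ).smulRight w)
  refine (isDiracSolution_diracField hr).eq_zero_of_lt_norm (fun x hx => ?_) hx
  rw [diracField_zero hr]
  have e : initialAmp D (fun z => ρ (spatial z) • w) = fun p => ρ p • (D.γ 0 *ᵥ w) := by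
    funext p
    have hE : (energy p : ℂ) ≠ 0 := by exact_mod_cast (energy_pos p).ne'
    have h := congrArg (fun M => M *ᵥ w) (proj_lift_sub (D := D) p)
    simp only [Matrix.sub_mulVec, Matrix.smul_mulVec] at h
    simp only [initialAmp, amp, spatial_lift, he, energy_neg, Matrix.mulVec_smul, ← Complex.coe_smul,
      smul_smul]
    push_cast
    rw [one_mul, neg_one_mul, neg_mul, neg_smul, ← sub_eq_add_neg, ← smul_sub, h, smul_smul]
    congr 1
    field_simp
  have e2 : waveInt (fun p => ρ p • (D.γ 0 *ᵥ w)) 0 x = waveInt ρ 0 x • (D.γ 0 *ᵥ w) := by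
    simp only [waveInt]
    rw [← integral_smul_const]
    simp only [smul_assoc]
  rw [e, e2, hρ x hx, zero_smul]

/-- Exchange of the order of integration in a composition of plane wave superpositions. -/
theorem waveInt_mulVec_waveInt {M : Space → Matrix (Fin 4) (Fin 4) ℂ}
    (hM : ∀ i j, RapidDecay fun p => M p i j) {b : Space → Spinor} (hb : RapidDecay b) (κ t : ℝ)
    (x : Space) :
    Integrable (fun r => waveInt (fun p => M p *ᵥ b r) (t - κ * energy r) (x - κ • r)) ∧
    waveInt (fun p => M p *ᵥ waveInt b (-κ * energy p) (-κ • p)) t x =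
      ∫ r, waveInt (fun p => M p *ᵥ b r) (t - κ * energy r) (x - κ • r) := by
  let f (p r : Space) : Spinor := Complex.exp (-(Complex.I *
    (((t - κ * energy r) * energy p - inner ℝ (x - κ • r) p : ℝ) : ℂ))) • (M p *ᵥ b r)
  have hf : Integrable (Function.uncurry f) (volume.prod volume) := by
    have hB : Integrable (fun z : Space × Space => (∑ i, ∑ j, ‖M z.1 i j‖) * ‖b z.2‖)
        (volume.prod volume) :=
      Integrable.mul_prod (integrable_finsetSum _ fun i _ => integrable_finsetSum _ fun j _ =>
        (hM i j).integrable.norm) hb.integrable.norm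
    refine hB.mono' (Continuous.aestronglyMeasurable ?_) (Filter.Eventually.of_forall fun z => ?_)
    · have h1 : Continuous M := continuous_matrix fun i j => (hM i j).continuous
      have h2 := hb.continuous
      have h3 := continuous_energy
      have h4 : Continuous fun z : Space × Space => M z.1 *ᵥ b z.2 :=
        (h1.comp continuous_fst).matrix_mulVec (h2.comp continuous_snd)
      have h5 : Continuous fun z : Space × Space => Complex.exp (-(Complex.I *
          (((t - κ * energy z.2) * energy z.1 - inner ℝ (x - κ • z.2) z.1 : ℝ) : ℂ))) := by
        fun_prop
      exact h5.smul h4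
    · simp only [Function.uncurry, f]
      rw [norm_smul, norm_exp_phase, one_mul]
      refine (pi_norm_le_iff_of_nonneg (by positivity)).2 fun i => ?_
      calc ‖(M z.1 *ᵥ b z.2) i‖ ≤ ∑ j, ‖M z.1 i j * b z.2 j‖ :=
          norm_sum_le Finset.univ fun j => M z.1 i j * b z.2 j
        _ ≤ ∑ j, ‖M z.1 i j‖ * ‖b z.2‖ := by
          refine Finset.sum_le_sum fun j _ => ?_
          rw [norm_mul]
          exact mul_le_mul_of_nonneg_left (norm_le_pi_norm _ j) (norm_nonneg _)
        _ ≤ _ := by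
          rw [← Finset.sum_mul]
          refine mul_le_mul_of_nonneg_right ?_ (norm_nonneg _)
          exact Finset.single_le_sum (f := fun i => ∑ j, ‖M z.1 i j‖)
            (fun i _ => by positivity) (Finset.mem_univ i)
  refine ⟨hf.integral_prod_right, ?_⟩
  rw [show (∫ r, waveInt (fun p => M p *ᵥ b r) (t - κ * energy r) (x - κ • r)) =
    ∫ r, ∫ p, f p r from rfl, ← integral_integral_swap hf, waveInt]
  refine integral_congr_ae (Filter.Eventually.of_forall fun p => ?_)
  simp only
  rw [mulVec_waveInt _ hb.integrable, waveInt, ← integral_smul]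
  refine integral_congr_ae (Filter.Eventually.of_forall fun r => ?_)
  simp only [f]
  rw [smul_smul, ← Complex.exp_add]
  congr 2
  rw [inner_sub_left, inner_smul_left, inner_smul_left, real_inner_comm p r]
  simp only [conj_trivial]
  push_cast
  ring

/-- The matrix in the amplitude of the plane waves of frequency `s = ±1` with weight `ρ`. -/
def bandMat (D : DiracMatrices) (ρ : Space → ℂ) (s : ℝ) (p : Space) : Matrix (Fin 4) (Fin 4) ℂ :=
  (((s * (energy p)⁻¹ : ℝ) : ℂ) * ρ p) • proj D s (lift p)

theorem rapidDecay_bandMat (ρ : 𝓢(Space, ℂ)) (s : ℝ) (i j : Fin 4) :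
    RapidDecay fun p => bandMat D ρ s p i j := by
  have h := ((rapidDecay_schwartz ρ).smul (temperateMat_proj D s i j)).real_smul
    ((Function.HasTemperateGrowth.const s).mul hasTemperateGrowth_energy_inv)
  refine h.of_norm_le ?_ (C := 1) 0 fun p => ?_
  · have := h.continuous
    convert this using 2 with p
    simp [bandMat]
    ring
  · refine le_of_eq ?_
    simp [bandMat]
    ring

theorem amp_const (ρ : Space → ℂ) (s : ℝ) (w : Spinor) :
    amp D s (fun z => ρ (spatial z) • w) = fun p => bandMat D ρ s p *ᵥ w := by
  funext p
  rw [amp, bandMat, spatial_lift, Matrix.mulVec_smul, Matrix.smul_mulVec, ← Complex.coe_smul,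
    smul_smul]

theorem amp_mul_fourierFStar (ρ : Space → ℂ) {s : ℝ} (hs : s = 1 ∨ s = -1) (κ : ℝ)
    {g : Hyp → Spinor} (hg : RapidDecay fun p => g (lift p)) :
    amp D s (fun z => ρ (spatial z) • fourierFStar D κ g z) = fun p => (fourierConst κ : ℂ) •
      (bandMat D ρ s p *ᵥ waveInt (ampStar D g) (-(s * κ) * energy p) (-(s * κ) • p)) := by
  funext p
  have h1 := proj_mul_proj D (s := 1) (by norm_num) (lift p)
  have h2 := proj_mul_proj D (s := -1) (by norm_num) (lift p)
  have h3 := proj_mul_proj_neg D (s := 1) (by norm_num) (lift p)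
  have h4 := proj_mul_proj_neg D (s := -1) (by norm_num) (lift p)
  rw [neg_neg] at h4
  rw [amp, bandMat, spatial_lift, fourierFStar_lift κ hg, Matrix.mulVec_smul, Matrix.mulVec_smul,
    Matrix.mulVec_add, Matrix.mulVec_mulVec, Matrix.mulVec_mulVec, Matrix.smul_mulVec,
    ← Complex.coe_smul]
  rcases hs with rfl | rfl
  · rw [h1, h3, Matrix.zero_mulVec, add_zero, surfInt, one_mul]
    simp only [smul_smul, one_mul]
    congr 1
    ring
  · rw [h2, h4, Matrix.zero_mulVec, zero_add, surfInt]
    simp only [smul_smul, neg_mul, neg_neg, one_mul]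
    congr 1
    push_cast
    ring

/-- With a band limited weight `ρ`, the composition of `fourierFStar` and the passage to solutions of
the Dirac equation superposes the translates by `κ r` of the solutions with data `ρ w`. -/
theorem diracField_mul_fourierFStar (ρ : 𝓢(Space, ℂ)) (κ : ℝ) {g : Hyp → Spinor}
    (hg : RapidDecay fun p => g (lift p)) (t : ℝ) (x : Space) :
    diracField D (fun z => ρ (spatial z) • fourierFStar D κ g z) (t, x) =
      (fourierConst κ : ℂ) • ∫ r, diracField D (fun z => ρ (spatial z) • ampStar D g r)
        (t - κ * energy r, x - κ • r) := by
  have hb := rapidDecay_ampStar (D := D) hg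
  obtain ⟨i1, e1⟩ := waveInt_mulVec_waveInt (rapidDecay_bandMat (D := D) ρ 1) hb κ t x
  obtain ⟨i2, e2⟩ := waveInt_mulVec_waveInt (rapidDecay_bandMat (D := D) ρ (-1)) hb (-κ) (-t) (-x)
  have e3 (r : Space) : -t - -κ * energy r = -(t - κ * energy r) := by ring
  have e4 (r : Space) : -x - -κ • r = -(x - κ • r) := by module
  simp only [e3, e4] at e2 i2
  simp only [diracField, amp_const, amp_mul_fourierFStar ρ (Or.inl rfl) κ hg,
    amp_mul_fourierFStar ρ (Or.inr rfl) κ hg, one_mul, neg_one_mul]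
  rw [waveInt_smul, waveInt_smul, e1, e2, ← smul_add, integral_add i1 i2]

theorem abs_energy_sub_lt {p q : Space} (h : p ≠ q) : |energy p - energy q| < ‖p - q‖ := by
  have hp := energy_pos p
  have hq := energy_pos q
  have hpq : 0 < ‖p - q‖ := norm_pos_iff.2 (sub_ne_zero.2 h)
  have hlt (p : Space) : ‖p‖ < energy p :=
    lt_of_pow_lt_pow_left₀ 2 (energy_pos p).le (by rw [energy_sq]; linarith)
  have h1 : (energy p - energy q) * (energy p + energy q) = inner ℝ (p - q) (p + q) := by
    rw [inner_sub_left, inner_add_right, inner_add_right, real_inner_self_eq_norm_sq,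
      real_inner_self_eq_norm_sq, real_inner_comm]
    linear_combination energy_sq p - energy_sq q
  have h2 : |energy p - energy q| * (energy p + energy q) ≤ ‖p - q‖ * ‖p + q‖ := by
    rw [← abs_of_pos (add_pos hp hq), ← abs_mul, h1]
    exact abs_real_inner_le_norm _ _
  have h3 : ‖p + q‖ < energy p + energy q :=
    (norm_add_le _ _).trans_lt (add_lt_add (hlt p) (hlt q))
  refine lt_of_mul_lt_mul_right (h2.trans_lt ?_) (add_pos hp hq).le
  exact mul_lt_mul_of_pos_left h3 hpq

/-- Different points of the hyperboloid have space-like distance, uniformly for points from disjoint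
compact sets. -/
theorem exists_spacelike_gap {K K' : Set Space} (hK : IsCompact K) (hK' : IsCompact K')
    (hd : Disjoint K K') :
    ∃ c, 0 < c ∧ ∀ p ∈ K, ∀ q ∈ K', |energy p - energy q| + c ≤ ‖p - q‖ := by
  rcases (K ×ˢ K').eq_empty_or_nonempty with he | hne
  · refine ⟨1, one_pos, fun p hp q hq => ?_⟩
    have : (p, q) ∈ K ×ˢ K' := ⟨hp, hq⟩
    simp [he] at this
  · have hc : Continuous fun z : Space × Space => ‖z.1 - z.2‖ - |energy z.1 - energy z.2| := by
      have := continuous_energy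
      fun_prop
    obtain ⟨z, hz, hmin⟩ := (hK.prod hK').exists_isMinOn hne hc.continuousOn
    refine ⟨‖z.1 - z.2‖ - |energy z.1 - energy z.2|, sub_pos.2 (abs_energy_sub_lt fun h => ?_),
      fun p hp q hq => ?_⟩
    · exact Set.disjoint_left.1 hd hz.1 (h ▸ hz.2)
    · have h : ‖z.1 - z.2‖ - |energy z.1 - energy z.2| ≤ ‖p - q‖ - |energy p - energy q| :=
        isMinOn_iff.1 hmin (p, q) ⟨hp, hq⟩
      linarith

/-- Duality between superpositions of plane waves on the hyperboloid. -/
theorem integral_sesq_waveInt (M : Matrix (Fin 4) (Fin 4) ℂ) {a b : Space → Spinor}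
    (ha : RapidDecay a) (hb : RapidDecay b) (κ : ℝ) :
    ∫ q, sesq M (waveInt a (κ * energy q) (κ • q)) (b q) =
      ∫ p, sesq M (a p) (waveInt b (-κ * energy p) (-κ • p)) := by
  let f (q p : Space) : ℂ := Complex.exp (-(Complex.I *
    ((-κ * energy p * energy q - inner ℝ (-κ • p) q : ℝ) : ℂ))) * sesq M (a p) (b q)
  have hf : Integrable (Function.uncurry f) (volume.prod volume) := by
    obtain ⟨C, hC0, hC⟩ := exists_bound_sesq M
    have hB : Integrable (fun z : Space × Space => C * (‖b z.1‖ * ‖a z.2‖))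
        (volume.prod volume) :=
      (Integrable.mul_prod hb.integrable.norm ha.integrable.norm).const_mul C
    refine hB.mono' (Continuous.aestronglyMeasurable ?_) (Filter.Eventually.of_forall fun z => ?_)
    · have h1 := ha.continuous
      have h2 := hb.continuous
      have h3 := continuous_energy
      have h4 : Continuous fun z : Space × Space => sesq M (a z.2) (b z.1) :=
        ((sesqL M).continuous.comp (h1.comp continuous_snd)).clm_apply (h2.comp continuous_fst)
      refine Continuous.mul ?_ h4
      fun_prop
    · simp only [Function.uncurry, f]
      rw [norm_mul, norm_exp_phase, one_mul, mul_comm ‖b z.1‖]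
      exact hC _ _
  have hL (q : Space) : sesq M (waveInt a (κ * energy q) (κ • q)) (b q) = ∫ p, f q p := by
    have h := ((sesqL M).flip (b q)).integral_comp_comm
      (integrable_wave ha.integrable (κ * energy q) (κ • q))
    refine h.symm.trans (integral_congr_ae (Filter.Eventually.of_forall fun p => ?_))
    change sesq M _ _ = _
    rw [sesq_smul_left, ← Complex.exp_conj]
    simp only [f, map_neg, map_mul, Complex.conj_I, Complex.conj_ofReal]
    congr 2
    rw [inner_smul_left, inner_smul_left, real_inner_comm]
    simp only [conj_trivial]
    push_cast
    ring
  have hR (p : Space) : sesq M (a p) (waveInt b (-κ * energy p) (-κ • p)) = ∫ q, f q p := by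
    have h := (sesqL M (a p)).integral_comp_comm
      (integrable_wave hb.integrable (-κ * energy p) (-κ • p))
    refine h.symm.trans (integral_congr_ae (Filter.Eventually.of_forall fun q => ?_))
    change sesq M _ _ = _
    rw [sesq_smul_right]
  simp only [hL, hR]
  exact integral_integral_swap hf

theorem rapidDecay_fourierFStar {κ : ℝ} (hκ : κ ≠ 0) {g : Hyp → Spinor} (hg : IsTest g) :
    RapidDecay fun p => fourierFStar D κ g (lift p) :=
  (isSchwartz_fourierFStar D hκ hg).rapidDecay

theorem rapidDecay_mul_fourierFStar (ρ : 𝓢(Space, ℂ)) {κ : ℝ} (hκ : κ ≠ 0) {g : Hyp → Spinor}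
    (hg : IsTest g) :
    RapidDecay fun p => (fun z => ρ (spatial z) • fourierFStar D κ g z) (lift p) := by
  simp only [spatial_lift]
  exact (rapidDecay_fourierFStar hκ hg).smul ρ.hasTemperateGrowth

/-- The transforms are formally adjoint to each other. -/
theorem scalar_fourierF_left {κ : ℝ} (hκ : κ ≠ 0) {f g : Hyp → Spinor}
    (hf : RapidDecay fun p => f (lift p)) (hg : IsTest g) :
    scalar D (fourierF D κ f) g = scalar D f (fourierFStar D κ g) := by
  have hg' := (isTest_iff.1 hg).rapidDecay
  have hb := rapidDecay_ampStar (D := D) hg'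
  have h1 := rapidDecay_amp (D := D) hf 1
  have h2 := rapidDecay_amp (D := D) hf (-1)
  have e1 := integral_sesq_waveInt (D.γ 0) h1 hb κ
  have e2 := integral_sesq_waveInt (D.γ 0) h2 hb (-κ)
  have hw {a : Space → Spinor} (ha : RapidDecay a) (κ : ℝ) :
      Continuous fun q => waveInt a (κ * energy q) (κ • q) :=
    (continuous_waveInt ha.integrable).comp
      ((continuous_const.mul continuous_energy).prodMk (continuous_const_smul κ))
  have hi {a b : Space → Spinor} (ha : RapidDecay a) (hb : RapidDecay b) (κ : ℝ) :
      Integrable fun q => sesq (D.γ 0) (waveInt a (κ * energy q) (κ • q)) (b q) := by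
    obtain ⟨C, hC0, hC⟩ := exists_bound_sesq (D.γ 0)
    refine (hb.integrable.norm.const_mul (C * ∫ p, ‖a p‖)).mono'
      (((sesqL (D.γ 0)).continuous.comp (hw ha κ)).clm_apply hb.continuous).aestronglyMeasurable
      (Filter.Eventually.of_forall fun q => (hC _ _).trans ?_)
    rw [mul_assoc]
    exact mul_le_mul_of_nonneg_left (mul_le_mul_of_nonneg_right (norm_waveInt_le _ _ _)
      (norm_nonneg _)) hC0
  have hi' {a b : Space → Spinor} (ha : RapidDecay a) (hb : RapidDecay b) (κ : ℝ) :
      Integrable fun p => sesq (D.γ 0) (a p) (waveInt b (κ * energy p) (κ • p)) := by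
    obtain ⟨C, hC0, hC⟩ := exists_bound_sesq (D.γ 0)
    refine (ha.integrable.norm.mul_const (∫ p, ‖b p‖)).const_mul C |>.mono'
      (((sesqL (D.γ 0)).continuous.comp ha.continuous).clm_apply (hw hb κ)).aestronglyMeasurable
      (Filter.Eventually.of_forall fun q => (hC _ _).trans ?_)
    exact mul_le_mul_of_nonneg_left (mul_le_mul_of_nonneg_left (norm_waveInt_le _ _ _)
      (norm_nonneg _)) hC0
  have hl : scalar D (fourierF D κ f) g = (fourierConst κ : ℂ) *
      (∫ q, sesq (D.γ 0) (waveInt (amp D 1 f) (κ * energy q) (κ • q)) (ampStar D g q) +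
        sesq (D.γ 0) (waveInt (amp D (-1) f) (-κ * energy q) (-κ • q)) (ampStar D g q)) := by
    rw [scalar, integral_μH, ← integral_const_mul]
    refine integral_congr_ae (Filter.Eventually.of_forall fun q => ?_)
    simp only
    rw [density_eq, fourierF_lift κ hf, surfInt, surfInt, ← sesq_add_left, ampStar,
      ← Complex.coe_smul, ← Complex.coe_smul, sesq_smul_right, sesq_mulVec_right, smul_eq_mul]
    change _ * sesq _ _ _ = _
    rw [sesq_smul_left, Complex.conj_ofReal]
    ring
  have hr : scalar D f (fourierFStar D κ g) = (fourierConst κ : ℂ) *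
      (∫ p, sesq (D.γ 0) (amp D 1 f p) (waveInt (ampStar D g) (-κ * energy p) (-κ • p)) +
        sesq (D.γ 0) (amp D (-1) f p) (waveInt (ampStar D g) (κ * energy p) (κ • p))) := by
    rw [scalar, integral_μH, ← integral_const_mul]
    refine integral_congr_ae (Filter.Eventually.of_forall fun p => ?_)
    have hm {s : ℝ} (hs : s * s = 1) : (proj D s (lift p))ᴴ * D.γ 0 =
        (s : ℂ) • (D.γ 0 * slash D (lift p).1 * proj D s (lift p)) := by
      have hs' : (s : ℂ) * s = 1 := by exact_mod_cast hs
      rw [proj_adjoint, mul_assoc, gamma_zero_sq, mul_one, mul_assoc, slash_mul_proj D hs,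
        mul_smul_comm, smul_smul, hs', one_smul]
    simp only
    rw [density_eq, fourierFStar_lift κ hg', surfInt, surfInt, amp, amp, ← Complex.coe_smul,
      ← Complex.coe_smul, ← Complex.coe_smul, sesq_smul_left, sesq_smul_left, sesq_mulVec_left,
      sesq_mulVec_left, hm (by norm_num), hm (by norm_num), smul_eq_mul]
    change _ * sesq _ _ _ = _
    rw [sesq_smul_right, sesq_add_right, sesq_mulVec_right, sesq_mulVec_right]
    simp only [sesq, Matrix.smul_mulVec, dotProduct_smul, smul_eq_mul, Complex.conj_ofReal]
    push_cast
    ring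
  simp only [neg_neg] at e2
  rw [hl, hr, integral_add (hi h1 hb κ) (hi h2 hb (-κ)), e1, e2,
    integral_add (hi' h1 hb (-κ)) (hi' h2 hb κ)]

/-- With a band limited weight `ρ`, the transform `fourierF` of `ρ` times `fourierFStar D κ g`
vanishes at the points whose distance from the support of `g` is sufficiently space-like. -/
theorem fourierF_mul_fourierFStar_eq_zero {ρ : 𝓢(Space, ℂ)} (he : ∀ p, ρ (-p) = ρ p) {δ : ℝ}
    (hρ : ∀ x, δ < ‖x‖ → waveInt ρ 0 x = 0) {κ : ℝ} (hκ : κ ≠ 0) {g : Hyp → Spinor}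
    (hg : IsTest g) {q : Space}
    (hq : ∀ r, g (lift r) ≠ 0 → |κ * energy q - κ * energy r| + δ < ‖κ • q - κ • r‖) :
    fourierF D κ (fun z => ρ (spatial z) • fourierFStar D κ g z) (lift q) = 0 := by
  rw [fourierF_lift_eq_diracField κ (rapidDecay_mul_fourierFStar ρ hκ hg),
    diracField_mul_fourierFStar ρ κ (isTest_iff.1 hg).rapidDecay, integral_eq_zero_of_ae,
    smul_zero, smul_zero]
  refine Filter.Eventually.of_forall fun r => ?_
  by_cases h : g (lift r) = 0
  · have : (fun z => ρ (spatial z) • ampStar D g r) = fun z => ρ (spatial z) • (0 : Spinor) := by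
      simp [ampStar, h]
    simp only [this, Pi.zero_apply]
    simp [diracField, amp, waveInt]
  · exact diracField_band_limited_eq_zero he hρ _ (hq r h)

/-- The transform `fourierFStar` maps functions with disjoint supports to orthogonal functions:
when `fourierFStar` of the first function is multiplied by a band limited function, the transform
`fourierF` takes it back to a function supported close to the support of the first function. -/
theorem scalar_fourierFStar_eq_zero {κ : ℝ} (hκ : 0 < κ) {f g : Hyp → Spinor} (hf : IsTest f)
    (hg : IsTest g)
    (hd : Disjoint (tsupport fun p => f (lift p)) (tsupport fun p => g (lift p))) :
    scalar D (fourierFStar D κ f) (fourierFStar D κ g) = 0 := by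
  obtain ⟨ρ, C, hC, hlim, he, hρ⟩ := exists_band_limited
  have hf' := rapidDecay_fourierFStar (D := D) hκ.ne' hf
  have hg' := rapidDecay_fourierFStar (D := D) hκ.ne' hg
  have hden (n : ℕ) (z : Hyp) : density D (fun z => ρ n (spatial z) • fourierFStar D κ f z)
      (fourierFStar D κ g) z =
      conj (ρ n (spatial z)) * density D (fourierFStar D κ f) (fourierFStar D κ g) z := by
    rw [density_eq, density_eq]
    exact sesq_smul_left _ _ _ _
  have hT : Filter.Tendsto (fun n => scalar D (fun z => ρ n (spatial z) • fourierFStar D κ f z)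
      (fourierFStar D κ g)) Filter.atTop
      (nhds (scalar D (fourierFStar D κ f) (fourierFStar D κ g))) := by
    have hint := integrable_density (D := D) hf' hg'
    have hsp : Continuous spatial := continuous_spatial
    refine tendsto_integral_of_dominated_convergence
      (fun z => C * ‖density D (fourierFStar D κ f) (fourierFStar D κ g) z‖) (fun n => ?_)
      (hint.norm.const_mul C) (fun n => Filter.Eventually.of_forall fun z => ?_)
      (Filter.Eventually.of_forall fun z => ?_)
    · rw [show density D (fun z => ρ n (spatial z) • fourierFStar D κ f z) (fourierFStar D κ g) = _
        from funext (hden n)]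
      exact ((Complex.continuous_conj.comp ((ρ n).continuous.comp hsp)).aestronglyMeasurable).mul
        hint.1
    · rw [hden, norm_mul, RCLike.norm_conj]
      exact mul_le_mul_of_nonneg_right (hC n _) (norm_nonneg _)
    · simp only [hden]
      have h := ((Complex.continuous_conj.tendsto 1).comp (hlim (spatial z))).mul_const
        (density D (fourierFStar D κ f) (fourierFStar D κ g) z)
      rw [map_one, one_mul] at h
      exact h
  obtain ⟨c, hc0, hc⟩ := exists_spacelike_gap hg.2 hf.2 hd.symm
  have hev : ∀ᶠ n : ℕ in Filter.atTop, 7 * ((n : ℝ) + 1)⁻¹ < κ * c := by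
    have h := (tendsto_one_div_add_atTop_nhds_zero_nat (𝕜 := ℝ)).const_mul 7
    simp only [one_div, mul_zero] at h
    exact h.eventually_lt_const (by positivity)
  refine tendsto_nhds_unique hT (tendsto_const_nhds.congr' ?_)
  filter_upwards [hev] with n hn
  rw [← scalar_fourierF_left hκ.ne' (rapidDecay_mul_fourierFStar (ρ n) hκ.ne' hf) hg, scalar,
    integral_μH, integral_eq_zero_of_ae]
  refine Filter.Eventually.of_forall fun q => ?_
  by_cases h : g (lift q) = 0
  · simp [density, h]
  · have hz := fourierF_mul_fourierFStar_eq_zero (D := D) (he n) (hρ n) hκ.ne' hf (q := q)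
      fun r hr => by
        have h1 := hc q (subset_tsupport _ h) r (subset_tsupport _ hr)
        rw [← mul_sub, ← smul_sub, abs_mul, abs_of_pos hκ, norm_smul, Real.norm_of_nonneg hκ.le]
        have h2 := mul_le_mul_of_nonneg_left h1 hκ.le
        linarith
    simp [density, diracConj, hz]

/-! ### Test functions in the Hilbert space -/

variable {D : DiracMatrices}

theorem inner_rep_mk (h : HSpace D) {f : Hyp → Spinor} (hf : MemH D f) :
    inner ℂ h (HSpace.mk D f hf) = scalar D h.rep f := by
  rw [inner_def]
  exact integral_congr_ae (density_congr D (Filter.EventuallyEq.refl _ _) (HSpace.rep_mk D f hf))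

theorem inner_mk_mk {g f : Hyp → Spinor} (hg : MemH D g) (hf : MemH D f) :
    inner ℂ (HSpace.mk D g hg) (HSpace.mk D f hf) = scalar D g f := by
  rw [inner_def]
  exact integral_congr_ae (density_congr D (HSpace.rep_mk D g hg) (HSpace.rep_mk D f hf))

theorem mk_add {f g h : Hyp → Spinor} (hf : MemH D f) (hg : MemH D g) (hh : MemH D h)
    (e : h = f + g) : HSpace.mk D h hh = HSpace.mk D f hf + HSpace.mk D g hg := by
  subst e
  refine HSpace.ext_rep ?_
  filter_upwards [HSpace.rep_mk D f hf, HSpace.rep_mk D g hg, HSpace.rep_mk D _ hh,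
    HSpace.rep_add (HSpace.mk D f hf) (HSpace.mk D g hg)] with z h1 h2 h3 h4
  rw [h3, h4, Pi.add_apply, Pi.add_apply, h1, h2]

theorem mk_smul (c : ℂ) {f h : Hyp → Spinor} (hf : MemH D f) (hh : MemH D h)
    (e : h = c • f) : HSpace.mk D h hh = c • HSpace.mk D f hf := by
  subst e
  refine HSpace.ext_rep ?_
  filter_upwards [HSpace.rep_mk D f hf, HSpace.rep_mk D _ hh,
    HSpace.rep_smul c (HSpace.mk D f hf)] with z h1 h3 h4
  rw [h3, h4, Pi.smul_apply, Pi.smul_apply, h1]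

theorem mk_rep (h : HSpace D) : HSpace.mk D h.rep h.memH_rep = h :=
  HSpace.ext_rep (HSpace.rep_mk D _ _)

theorem IsTest.rapidDecay {f : Hyp → Spinor} (hf : IsTest f) : RapidDecay fun p => f (lift p) :=
  (isTest_iff.1 hf).rapidDecay

theorem IsTest.memH (D : DiracMatrices) {f : Hyp → Spinor} (hf : IsTest f) : MemH D f :=
  memH_of_rapidDecay hf.rapidDecay

theorem IsTest.memH_fourierF (D : DiracMatrices) {κ : ℝ} (hκ : κ ≠ 0) {f : Hyp → Spinor}
    (hf : IsTest f) : MemH D (fourierF D κ f) :=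
  memH_of_rapidDecay (isSchwartz_fourierF D hκ hf).rapidDecay

theorem IsTest.memH_fourierFStar (D : DiracMatrices) {κ : ℝ} (hκ : κ ≠ 0) {f : Hyp → Spinor}
    (hf : IsTest f) : MemH D (fourierFStar D κ f) :=
  memH_of_rapidDecay (isSchwartz_fourierFStar D hκ hf).rapidDecay

theorem integrable_density_of_memH {g f : Hyp → Spinor} (hg : MemH D g) (hf : MemH D f) :
    Integrable (density D g f) μH := by
  have h1 := (memH_iff D hg.1).1 hg
  have h2 := (memH_iff D hf.1).1 hf
  refine (L2.integrable_inner (𝕜 := ℂ) h1.toLp h2.toLp).congr ?_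
  filter_upwards [h1.coeFn_toLp, h2.coeFn_toLp] with z e1 e2
  rw [e1, e2, density_eq_inner]

theorem isTest_cutoff {χ : Space → ℝ} (h1 : ContDiff ℝ ∞ χ) (h2 : HasCompactSupport χ)
    (w : Spinor) : IsTest fun z => χ (spatial z) • w := by
  rw [isTest_iff]
  simp only [spatial_lift]
  exact ⟨h1.smul contDiff_const, h2.smul_right⟩

variable (D) in
theorem isUnit_slash (z : Hyp) : IsUnit (slash D z.1) := IsUnit.of_mul_eq_one _ (slash_mul_slash D z)

variable (D) in
theorem isUnit_gamma_zero : IsUnit (D.γ 0) := IsUnit.of_mul_eq_one _ (gamma_zero_sq D)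

theorem eq_zero_of_sesq_single {M : Matrix (Fin 4) (Fin 4) ℂ} (hM : IsUnit M) {v : Spinor}
    (h : ∀ j, sesq M v (Pi.single j 1) = 0) : v = 0 := by
  have h1 : star v ᵥ* M = 0 := by
    funext j
    have := h j
    rw [sesq, Matrix.dotProduct_mulVec, dotProduct_single, mul_one] at this
    exact this
  have h2 : star v = 0 := Matrix.vecMul_injective_iff_isUnit.2 hM (by simpa using h1)
  simpa using congrArg star h2

/-- An element of `H` that is orthogonal to the test functions supported in an open set vanishes
there. -/
theorem ae_eq_zero_of_inner_test_eq_zero {k : HSpace D} {O : Set Space} (hO : IsOpen O)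
    (h : ∀ f (hf : IsTest f), tsupport (fun p => f (lift p)) ⊆ O →
      inner ℂ k (HSpace.mk D f (hf.memH D)) = 0) :
    ∀ᵐ p : Space, p ∈ O → k.rep (lift p) = 0 := by
  let d (j : Fin 4) (p : Space) : ℂ := (energy p)⁻¹ • density D k.rep (fun _ => Pi.single j 1) (lift p)
  have hden (χ : Space → ℝ) (j : Fin 4) (p : Space) :
      (energy p)⁻¹ • density D k.rep (fun z => χ (spatial z) • Pi.single j 1) (lift p) =
        χ p • d j p := by
    simp only [d]
    rw [smul_comm, density_eq, density_eq, spatial_lift, Matrix.mulVec_smul, dotProduct_smul]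
  have hloc (j : Fin 4) : LocallyIntegrable (d j) := by
    intro x
    refine ⟨Metric.closedBall 0 (‖x‖ + 1), ?_, ?_⟩
    · rw [← mem_interior_iff_mem_nhds]
      refine Metric.ball_subset_interior_closedBall ?_
      rw [mem_ball_zero_iff]; linarith
    · let b : ContDiffBump (0 : Space) := ⟨‖x‖ + 1, ‖x‖ + 2, by positivity, by linarith⟩
      have hi := (integrable_μH_iff _).1 (integrable_density_of_memH k.memH_rep
        ((isTest_cutoff b.contDiff b.hasCompactSupport (Pi.single j 1)).memH D))
      refine (hi.integrableOn (s := Metric.closedBall 0 (‖x‖ + 1))).congr_fun (fun p hp => ?_)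
        measurableSet_closedBall
      simp only
      rw [hden, b.one_of_mem_closedBall hp, one_smul]
  have hz (j : Fin 4) : ∀ᵐ p : Space, p ∈ O → d j p = 0 := by
    refine hO.ae_eq_zero_of_integral_contDiff_smul_eq_zero ((hloc j).locallyIntegrableOn _)
      fun g hg hgc hgO => ?_
    have ht := isTest_cutoff hg hgc (Pi.single j 1)
    have h0 := h _ ht (by
      simp only [spatial_lift]
      refine (closure_mono (Function.support_subset_iff'.2 fun p hp => ?_)).trans hgO
      rw [Function.notMem_support.1 hp, zero_smul])
    rw [inner_rep_mk, scalar, integral_μH] at h0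
    simpa only [hden] using h0
  filter_upwards [ae_all_iff.2 hz] with p hp hpO
  refine eq_zero_of_sesq_single ((isUnit_gamma_zero D).mul (isUnit_slash D (lift p))) fun j => ?_
  have := hp j hpO
  simp only [d, density_eq] at this
  exact (smul_eq_zero.1 this).resolve_left (inv_pos.2 (energy_pos p)).ne'

/-- The space of test functions. -/
def testSpace : Submodule ℂ (Hyp → Spinor) where
  carrier := {f | IsTest f}
  zero_mem' := ⟨contDiff_const, HasCompactSupport.zero⟩
  add_mem' hf hg := ⟨hf.1.add hg.1, hf.2.add hg.2⟩
  smul_mem' c _ hf := ⟨contDiff_const.smul hf.1, hf.2.smul_left (f := fun _ => c)⟩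

variable (D) in
/-- The class of a test function in `H`. -/
def ofTest : testSpace →ₗ[ℂ] HSpace D where
  toFun f := HSpace.mk D f.1 (f.2.memH D)
  map_add' _ _ := mk_add _ _ _ rfl
  map_smul' c _ := mk_smul c _ _ rfl

theorem denseRange_ofTest : DenseRange (ofTest D) := by
  rw [DenseRange, ← LinearMap.coe_range, Submodule.dense_iff_topologicalClosure_eq_top,
    Submodule.topologicalClosure_eq_top_iff, Submodule.eq_bot_iff]
  intro k hk
  rw [Submodule.mem_orthogonal'] at hk
  have h := ae_eq_zero_of_inner_test_eq_zero (k := k) isOpen_univ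
    fun f hf _ => hk _ ⟨⟨f, hf⟩, rfl⟩
  rw [← inner_self_eq_zero (𝕜 := ℂ), inner_def, scalar, integral_μH]
  refine integral_eq_zero_of_ae ?_
  filter_upwards [h] with p hp
  simp [density, hp trivial]

theorem amp_add (s : ℝ) (f g : Hyp → Spinor) :
    amp D s (f + g) = fun p => amp D s f p + amp D s g p := by
  funext p; simp [amp, Matrix.mulVec_add]

theorem amp_smul (s : ℝ) (c : ℂ) (f : Hyp → Spinor) :
    amp D s (c • f) = fun p => c • amp D s f p := by
  funext p; simp [amp, Matrix.mulVec_smul, smul_comm c]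

theorem fourierF_add (κ : ℝ) {f g : Hyp → Spinor} (hf : IsTest f) (hg : IsTest g) :
    fourierF D κ (f + g) = fourierF D κ f + fourierF D κ g := by
  funext z
  have hi {f : Hyp → Spinor} (hf : IsTest f) (s : ℝ) :=
    (rapidDecay_amp (D := D) hf.rapidDecay s).integrable
  rw [← lift_spatial z, Pi.add_apply, fourierF_lift_eq_diracField κ hf.rapidDecay,
    fourierF_lift_eq_diracField κ hg.rapidDecay, fourierF_lift_eq_diracField κ
      (IsTest.rapidDecay (testSpace.add_mem hf hg)), diracField, diracField, diracField, amp_add,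
    amp_add, waveInt_add (hi hf 1) (hi hg 1), waveInt_add (hi hf (-1)) (hi hg (-1))]
  module

theorem fourierF_smul (κ : ℝ) (c : ℂ) {f : Hyp → Spinor} (hf : IsTest f) :
    fourierF D κ (c • f) = c • fourierF D κ f := by
  funext z
  rw [← lift_spatial z, Pi.smul_apply, fourierF_lift_eq_diracField κ hf.rapidDecay,
    fourierF_lift_eq_diracField κ (IsTest.rapidDecay (testSpace.smul_mem c hf)), diracField,
    diracField, amp_smul, amp_smul, waveInt_smul, waveInt_smul]
  module

variable (D) in
/-- The transform `fourierF` on test functions, with values in `H`. -/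
def fourierTest {κ : ℝ} (hκ : κ ≠ 0) : testSpace →ₗ[ℂ] HSpace D where
  toFun f := HSpace.mk D (fourierF D κ f.1) (IsTest.memH_fourierF D hκ f.2)
  map_add' f g := mk_add _ _ _ (fourierF_add κ f.2 g.2)
  map_smul' c f := mk_smul c _ _ (fourierF_smul κ c f.2)

theorem norm_fourierTest {κ : ℝ} (hκ : 0 < κ) (f : testSpace) :
    ‖fourierTest D hκ.ne' f‖ = ‖ofTest D f‖ := by
  have h : inner ℂ (fourierTest D hκ.ne' f) (fourierTest D hκ.ne' f) =
      inner ℂ (ofTest D f) (ofTest D f) := by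
    simp only [fourierTest, ofTest, LinearMap.coe_mk, AddHom.coe_mk]
    rw [inner_mk_mk, inner_mk_mk]
    exact scalar_fourierF hκ f.2 f.2
  rw [inner_self_eq_norm_sq_to_K, inner_self_eq_norm_sq_to_K] at h
  have h2 : ‖fourierTest D hκ.ne' f‖ ^ 2 = ‖ofTest D f‖ ^ 2 := by exact_mod_cast h
  exact (pow_left_inj₀ (norm_nonneg _) (norm_nonneg _) two_ne_zero).1 h2

variable (D) in
/-- The isometric extension of `fourierF` to `H`. -/
def fourierOp {κ : ℝ} (hκ : 0 < κ) : HSpace D →L[ℂ] HSpace D :=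
  (fourierTest D hκ.ne').extendOfNorm (ofTest D)

theorem fourierOp_ofTest {κ : ℝ} (hκ : 0 < κ) (f : testSpace) :
    fourierOp D hκ (ofTest D f) = fourierTest D hκ.ne' f :=
  LinearMap.extendOfNorm_eq denseRange_ofTest
    ⟨1, fun f => by rw [one_mul, norm_fourierTest hκ]⟩ f

theorem norm_fourierOp {κ : ℝ} (hκ : 0 < κ) (h : HSpace D) : ‖fourierOp D hκ h‖ = ‖h‖ := by
  refine denseRange_ofTest.induction_on (p := fun h => ‖fourierOp D hκ h‖ = ‖h‖) h
    (isClosed_eq (fourierOp D hκ).continuous.norm continuous_norm) fun f => ?_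
  rw [fourierOp_ofTest, norm_fourierTest hκ]

theorem adjoint_fourierOp_ofTest {κ : ℝ} (hκ : 0 < κ) (f : testSpace) :
    ContinuousLinearMap.adjoint (fourierOp D hκ) (ofTest D f) =
      HSpace.mk D (fourierFStar D κ f.1) (IsTest.memH_fourierFStar D hκ.ne' f.2) := by
  refine denseRange_ofTest.eq_of_inner_right (𝕜 := ℂ) ?_
  intro g
  rw [ContinuousLinearMap.adjoint_inner_right, fourierOp_ofTest]
  simp only [fourierTest, ofTest, LinearMap.coe_mk, AddHom.coe_mk]
  rw [inner_mk_mk, inner_mk_mk]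
  exact scalar_fourierF_left hκ.ne' g.2.rapidDecay f.2

theorem eq_of_extends {U U' : HSpace D →L[ℂ] HSpace D} {T : (Hyp → Spinor) → Hyp → Spinor}
    (h : Extends D U T) (h' : Extends D U' T) : U' = U := by
  refine ContinuousLinearMap.coeFn_injective
    (denseRange_ofTest.equalizer U'.continuous U.continuous (funext fun f => ?_))
  obtain ⟨_, _, e⟩ := h f.1 f.2
  obtain ⟨_, _, e'⟩ := h' f.1 f.2
  exact e'.trans e.symm

/-! ### Unitarity -/

variable {D : DiracMatrices}

/-- A continuous function vanishes at the origin if its integrals against ever narrower bumps around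
the origin vanish. -/
theorem eq_zero_of_peak {V : Type*} [NormedAddCommGroup V] [NormedSpace ℝ V] [CompleteSpace V]
    {G : Space → V}
    (hG : Continuous G) (b : ContDiffBump (0 : Space))
    (h : ∀ n : ℕ, ∫ p, b (((n : ℝ) + 1) • p) • G p = 0) : G 0 = 0 := by
  obtain ⟨C, hC⟩ := (isCompact_closedBall (0 : Space) b.rOut).exists_bound_of_continuousOn
    hG.continuousOn
  have hn (n : ℕ) : (0 : ℝ) < (n : ℝ) + 1 := by positivity
  have hz (n : ℕ) : ∫ p, b p • G (((n : ℝ) + 1)⁻¹ • p) = 0 := by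
    have h1 := Measure.integral_comp_smul volume (fun p => b p • G (((n : ℝ) + 1)⁻¹ • p))
      ((n : ℝ) + 1)
    simp only [inv_smul_smul₀ (hn n).ne'] at h1
    rw [h n] at h1
    refine (smul_eq_zero.1 h1.symm).resolve_left ?_
    rw [abs_eq_zero]
    exact inv_ne_zero (pow_ne_zero _ (hn n).ne')
  have hlim : Filter.Tendsto (fun n : ℕ => ∫ p, b p • G (((n : ℝ) + 1)⁻¹ • p)) Filter.atTop
      (nhds (∫ p, b p • G 0)) := by
    refine tendsto_integral_of_dominated_convergence (fun p => b p * C) (fun n => ?_)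
      ((b.continuous.integrable_of_hasCompactSupport b.hasCompactSupport).mul_const C)
      (fun n => Filter.Eventually.of_forall fun p => ?_) (Filter.Eventually.of_forall fun p => ?_)
    · exact (b.continuous.smul (hG.comp (continuous_const_smul _))).aestronglyMeasurable
    · rw [norm_smul, Real.norm_of_nonneg b.nonneg]
      by_cases hp : p ∈ Metric.closedBall (0 : Space) b.rOut
      · refine mul_le_mul_of_nonneg_left (hC _ ?_) b.nonneg
        rw [mem_closedBall_zero_iff] at hp ⊢
        rw [norm_smul, norm_inv, Real.norm_of_nonneg (hn n).le, inv_mul_le_iff₀ (hn n)]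
        nlinarith [b.rOut_pos, (n.cast_nonneg : (0 : ℝ) ≤ n)]
      · rw [b.zero_of_le_dist (by rw [Metric.mem_closedBall, not_le] at hp; exact hp.le)]
        simp
    · have h1 : Filter.Tendsto (fun n : ℕ => ((n : ℝ) + 1)⁻¹ • p) Filter.atTop (nhds 0) := by
        have h := (tendsto_one_div_add_atTop_nhds_zero_nat (𝕜 := ℝ)).smul_const p
        simpa using h
      exact ((hG.tendsto 0).comp h1).const_smul (b p)
  simp only [hz, integral_smul_const] at hlim
  have h0 := tendsto_nhds_unique hlim tendsto_const_nhds
  exact (smul_eq_zero.1 h0).resolve_left b.integral_pos.ne'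

/-- The transforms of test functions span the spinors at almost every point: for `f` concentrated
near the point `(1, 0)` with constant value `w`, the transform at `u` is close to a multiple of an
invertible matrix applied to `w`. -/
theorem ae_eq_zero_of_density_fourierF {κ : ℝ} (hκ : 0 < κ) {h : Hyp → Spinor}
    (hh : ∀ f, IsTest f → ∀ᵐ z ∂μH, density D h (fourierF D κ f) z = 0) :
    ∀ᵐ z ∂μH, h z = 0 := by
  let b : ContDiffBump (0 : Space) := ⟨1, 2, one_pos, one_lt_two⟩
  have hc0 : 0 < fourierConst κ := by unfold fourierConst; positivity
  have ht (n : ℕ) (j : Fin 4) :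
      IsTest fun z => b (((n : ℝ) + 1) • spatial z) • (Pi.single j 1 : Spinor) :=
    isTest_cutoff (χ := fun p => b (((n : ℝ) + 1) • p))
      (b.contDiff.comp (contDiff_const_smul _)) (b.hasCompactSupport.comp_homeomorph
        (Homeomorph.smulOfNeZero ((n : ℝ) + 1) (by positivity))) _
  filter_upwards [ae_all_iff.2 fun n => ae_all_iff.2 fun j => hh _ (ht n j)] with u hu
  let Φ (p : Space) : Matrix (Fin 4) (Fin 4) ℂ := NormedSpace.exp
    ((-(Complex.I * κ * mdot u.1 (lift p).1)) • slash D (lift p).1) * slash D (lift p).1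
  have hΦ : Continuous Φ := by
    have hP (s : ℝ) : Continuous fun p => proj D s (lift p) :=
      continuous_matrix fun i j => (temperateMat_proj D s i j).1.continuous
    have hw : Continuous fun p => -(Complex.I * κ * mdot u.1 (lift p).1) := by
      have : Continuous fun p => mdot u.1 (lift p).1 := continuous_finsetSum _ fun a _ =>
        continuous_const.mul ((continuous_apply a).comp
          (continuous_subtype_val.comp continuous_lift))
      fun_prop
    simp only [Φ, exp_smul_slash_mul_slash]
    exact ((Complex.continuous_exp.comp hw).smul (hP 1)).sub
      ((Complex.continuous_exp.comp hw.neg).smul (hP (-1)))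
  have hU : IsUnit (D.γ 0 * slash D u.1 * Φ 0) :=
    ((isUnit_gamma_zero D).mul (isUnit_slash D u)).mul
      ((Matrix.isUnit_exp _).mul (isUnit_slash D (lift 0)))
  refine eq_zero_of_sesq_single hU fun j => ?_
  let ℓ : Spinor →L[ℝ] ℂ := sesqL (D.γ 0 * slash D u.1) (h u)
  let G (p : Space) : Spinor := (energy p)⁻¹ • (Φ p *ᵥ Pi.single j 1)
  have hG : Continuous G :=
    (continuous_energy.inv₀ fun p => (energy_pos p).ne').smul (hΦ.matrix_mulVec continuous_const)
  have hpk : ℓ (G 0) = 0 := by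
    refine eq_zero_of_peak (G := fun p => ℓ (G p)) (ℓ.continuous.comp hG) b fun n => ?_
    have h1 := hu n j
    have hF : fourierF D κ (fun z => b (((n : ℝ) + 1) • spatial z) • (Pi.single j 1 : Spinor)) u =
        fourierConst κ • ∫ p, b (((n : ℝ) + 1) • p) • G p := by
      rw [fourierF, ← fourierConst, integral_μH, Complex.coe_smul]
      congr 1
      refine integral_congr_ae (Filter.Eventually.of_forall fun p => ?_)
      simp only [G, Φ]
      rw [spatial_lift, Matrix.mulVec_smul, smul_comm]
    have hi : Integrable fun p => b (((n : ℝ) + 1) • p) • G p := by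
      refine Continuous.integrable_of_hasCompactSupport
        ((b.continuous.comp (continuous_const_smul _)).smul hG) ?_
      exact (b.hasCompactSupport.comp_homeomorph
        (Homeomorph.smulOfNeZero ((n : ℝ) + 1) (by positivity))).smul_right
    rw [density_eq, hF] at h1
    change ℓ _ = 0 at h1
    rw [map_smul, ← ℓ.integral_comp_comm hi] at h1
    simp only [map_smul] at h1
    exact (smul_eq_zero.1 h1).resolve_left hc0.ne'
  have h2 : ℓ (G 0) = (energy 0)⁻¹ • sesq (D.γ 0 * slash D u.1) (h u) (Φ 0 *ᵥ Pi.single j 1) := by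
    simp only [G, map_smul]
    rfl
  rw [h2, sesq_mulVec_right] at hpk
  exact (smul_eq_zero.1 hpk).resolve_left (inv_pos.2 (energy_pos 0)).ne'

theorem memH_indicator (h : HSpace D) {A : Set Space} (hA : MeasurableSet A) :
    MemH D ((spatial ⁻¹' A).indicator h.rep) := by
  have hm : MeasurableSet (spatial ⁻¹' A) := continuous_spatial.measurable hA
  refine ⟨h.memH_rep.1.indicator hm, (h.memH_rep.2.indicator hm).congr ?_⟩
  refine Filter.Eventually.of_forall fun z => ?_
  by_cases hz : z ∈ spatial ⁻¹' A
  · simp [Set.indicator_of_mem hz, density]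
  · simp [Set.indicator_of_notMem hz, density]

theorem scalar_eq_zero_of_ae {g f : Hyp → Spinor}
    (h : ∀ᵐ p : Space, g (lift p) = 0 ∨ f (lift p) = 0) : scalar D g f = 0 := by
  rw [scalar, integral_μH]
  refine integral_eq_zero_of_ae ?_
  filter_upwards [h] with p hp
  rcases hp with hp | hp <;> simp [density, diracConj, hp]

variable {κ : ℝ} (hκ : 0 < κ)

theorem inner_rangeProj (g h : HSpace D) :
    inner ℂ (fourierOp D hκ (ContinuousLinearMap.adjoint (fourierOp D hκ) g)) h =
      inner ℂ (ContinuousLinearMap.adjoint (fourierOp D hκ) g)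
        (ContinuousLinearMap.adjoint (fourierOp D hκ) h) :=
  (ContinuousLinearMap.adjoint_inner_right _ _ _).symm

/-- The orthogonal projection onto the range of `fourierOp` does not enlarge supports. -/
theorem rangeProj_ae_eq_zero {h : HSpace D} {A : Set Space} (hA : IsClosed A)
    (hh : ∀ᵐ p : Space, p ∈ Aᶜ → h.rep (lift p) = 0) :
    ∀ᵐ p : Space, p ∈ Aᶜ →
      (fourierOp D hκ (ContinuousLinearMap.adjoint (fourierOp D hκ) h)).rep (lift p) = 0 := by
  -- a test function is mapped to an element with support in the support of the function
  have htest (f : testSpace) : ∀ᵐ p : Space, p ∈ (tsupport fun p => f.1 (lift p))ᶜ →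
      (fourierOp D hκ (ContinuousLinearMap.adjoint (fourierOp D hκ) (ofTest D f))).rep (lift p) =
        0 := by
    refine ae_eq_zero_of_inner_test_eq_zero (isClosed_tsupport _).isOpen_compl fun g hg hs => ?_
    rw [inner_rangeProj, adjoint_fourierOp_ofTest]
    have e := adjoint_fourierOp_ofTest hκ (D := D) ⟨g, hg⟩
    simp only [ofTest, LinearMap.coe_mk, AddHom.coe_mk] at e
    rw [e, inner_mk_mk]
    exact scalar_fourierFStar_eq_zero hκ f.2 hg (Set.disjoint_left.2 fun p hp hp' => hs hp' hp)
  refine ae_eq_zero_of_inner_test_eq_zero hA.isOpen_compl fun f hf hs => ?_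
  have e : HSpace.mk D f (hf.memH D) = ofTest D ⟨f, hf⟩ := rfl
  rw [e, inner_rangeProj, ← ContinuousLinearMap.adjoint_inner_right,
    ContinuousLinearMap.adjoint_adjoint, inner_def]
  refine scalar_eq_zero_of_ae ?_
  filter_upwards [hh, htest ⟨f, hf⟩] with p h1 h2
  by_cases hp : p ∈ A
  · exact Or.inr (h2 fun hp' => hs hp' hp)
  · exact Or.inl (h1 hp)

/-- The range of `fourierOp` is dense, since its adjoint is injective. -/
theorem adjoint_fourierOp_injective {h : HSpace D}
    (hh : ContinuousLinearMap.adjoint (fourierOp D hκ) h = 0) : h = 0 := by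
  set V := ContinuousLinearMap.adjoint (fourierOp D hκ) with hV
  -- the restrictions of `h` to closed sets are annihilated as well
  have hK {K : Set Space} (hK : IsClosed K) :
      V (HSpace.mk D _ (memH_indicator h hK.measurableSet)) = 0 := by
    set a := HSpace.mk D _ (memH_indicator h hK.measurableSet) with ha
    set b := HSpace.mk D _ (memH_indicator h hK.isOpen_compl.measurableSet) with hb
    have hab : h = a + b := by
      rw [← mk_rep h]
      refine mk_add _ _ _ ?_
      simp only [Set.preimage_compl]
      exact (Set.indicator_self_add_compl _ _).symm
    have hrep {A : Set Space} (hA : MeasurableSet A) : ∀ᵐ p : Space, p ∈ Aᶜ →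
        (HSpace.mk D _ (memH_indicator h hA)).rep (lift p) = 0 := by
      filter_upwards [ae_μH_iff.1 (HSpace.rep_mk D _ (memH_indicator h hA))] with p hp hpA
      rw [hp, Set.indicator_of_notMem]
      rwa [Set.mem_preimage, spatial_lift]
    have hVb : V b = -V a := by
      have : V a + V b = 0 := by rw [← map_add, ← hab, hh]
      exact (neg_eq_of_add_eq_zero_right this).symm
    have h0 : inner ℂ (V a) (V b) = 0 := by
      rw [hV, ← inner_rangeProj, inner_def]
      refine scalar_eq_zero_of_ae ?_
      filter_upwards [rangeProj_ae_eq_zero hκ hK (hrep hK.measurableSet),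
        hrep hK.isOpen_compl.measurableSet] with p h1 h2
      by_cases hp : p ∈ K
      · exact Or.inr (h2 fun h => h hp)
      · exact Or.inl (h1 hp)
    rw [hVb, inner_neg_right, neg_eq_zero, inner_self_eq_zero] at h0
    exact h0
  have hd (f : Hyp → Spinor) (hf : IsTest f) :
      ∀ᵐ z ∂μH, density D h.rep (fourierF D κ f) z = 0 := by
    rw [ae_μH_iff]
    have hi := (integrable_μH_iff _).1 (integrable_density_of_memH h.memH_rep
      (IsTest.memH_fourierF D hκ.ne' hf))
    have hae := ae_eq_zero_of_forall_setIntegral_isCompact_eq_zero hi fun K hKc => by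
      have h1 : inner ℂ (HSpace.mk D _ (memH_indicator h hKc.isClosed.measurableSet))
          (fourierOp D hκ (ofTest D ⟨f, hf⟩)) = 0 := by
        rw [← ContinuousLinearMap.adjoint_inner_left, ← hV, hK hKc.isClosed, inner_zero_left]
      rw [fourierOp_ofTest] at h1
      simp only [fourierTest, LinearMap.coe_mk, AddHom.coe_mk] at h1
      rw [inner_mk_mk, scalar, integral_μH] at h1
      rw [← h1, ← integral_indicator hKc.measurableSet]
      refine integral_congr_ae (Filter.Eventually.of_forall fun p => ?_)
      by_cases hp : p ∈ K
      · have hp' : lift p ∈ spatial ⁻¹' K := by rwa [Set.mem_preimage, spatial_lift]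
        simp [Set.indicator_of_mem hp, Set.indicator_of_mem hp', density]
      · have hp' : lift p ∉ spatial ⁻¹' K := by rwa [Set.mem_preimage, spatial_lift]
        simp [Set.indicator_of_notMem hp, Set.indicator_of_notMem hp', density, diracConj]
    filter_upwards [hae] with p hp
    exact (smul_eq_zero.1 hp).resolve_left (inv_pos.2 (energy_pos p)).ne'
  have h0 := ae_μH_iff.1 (ae_eq_zero_of_density_fourierF hκ hd)
  rw [← inner_self_eq_zero (𝕜 := ℂ), inner_def]
  exact scalar_eq_zero_of_ae (h0.mono fun p hp => Or.inl hp)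

theorem adjoint_fourierOp_fourierOp (h : HSpace D) :
    ContinuousLinearMap.adjoint (fourierOp D hκ) (fourierOp D hκ h) = h :=
  DFunLike.congr_fun ((ContinuousLinearMap.norm_map_iff_adjoint_comp_self _).1
    (norm_fourierOp (D := D) hκ)) h

theorem fourierOp_adjoint_fourierOp (h : HSpace D) :
    fourierOp D hκ (ContinuousLinearMap.adjoint (fourierOp D hκ) h) = h := by
  rw [← sub_eq_zero]
  refine adjoint_fourierOp_injective hκ ?_
  rw [map_sub, adjoint_fourierOp_fourierOp, sub_self]

theorem norm_adjoint_fourierOp (h : HSpace D) :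
    ‖ContinuousLinearMap.adjoint (fourierOp D hκ) h‖ = ‖h‖ := by
  conv_rhs => rw [← fourierOp_adjoint_fourierOp hκ h, norm_fourierOp]

theorem scalar_fourierFStar {κ : ℝ} (hκ : 0 < κ) {g f : Hyp → Spinor} (hg : IsTest g) (hf : IsTest f) :
    scalar D (fourierFStar D κ g) (fourierFStar D κ f) = scalar D g f := by
  have e := inner_rangeProj (D := D) hκ (ofTest D ⟨g, hg⟩) (ofTest D ⟨f, hf⟩)
  rw [fourierOp_adjoint_fourierOp, adjoint_fourierOp_ofTest, adjoint_fourierOp_ofTest,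
    inner_mk_mk] at e
  rw [← e]
  exact inner_mk_mk (hg.memH D) (hf.memH D)

end DiracHyperboloid

end

open DiracHyperboloid in
theorem proposition4p1 (D : DiracMatrices) (κ : ℝ) (hκ : 0 < κ) :
    (∀ f, IsTest f → IsSchwartz (fourierF D κ f) ∧ IsSchwartz (fourierFStar D κ f)) ∧
    (∀ g f, IsTest g → IsTest f →
      scalar D (fourierF D κ g) (fourierF D κ f) = scalar D g f ∧
      scalar D (fourierFStar D κ g) (fourierFStar D κ f) = scalar D g f) ∧
    ∃ U V : HSpace D →L[ℂ] HSpace D,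
      (Extends D U (fourierF D κ) ∧ ∀ U', Extends D U' (fourierF D κ) → U' = U) ∧
      (Extends D V (fourierFStar D κ) ∧ ∀ V', Extends D V' (fourierFStar D κ) → V' = V) ∧
      Isometry U ∧ Isometry V ∧
      ContinuousLinearMap.adjoint U = V ∧ ContinuousLinearMap.adjoint V = U ∧
      U ∈ unitary (HSpace D →L[ℂ] HSpace D) ∧ V ∈ unitary (HSpace D →L[ℂ] HSpace D) := by
  have extU : Extends D (fourierOp D hκ) (fourierF D κ) := fun f hf =>
    ⟨hf.memH D, hf.memH_fourierF D hκ.ne', fourierOp_ofTest hκ ⟨f, hf⟩⟩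
  have extV : Extends D (ContinuousLinearMap.adjoint (fourierOp D hκ)) (fourierFStar D κ) :=
    fun f hf => ⟨hf.memH D, hf.memH_fourierFStar D hκ.ne', adjoint_fourierOp_ofTest hκ ⟨f, hf⟩⟩
  have hVU : ContinuousLinearMap.adjoint (fourierOp D hκ) * fourierOp D hκ = 1 :=
    ContinuousLinearMap.ext (adjoint_fourierOp_fourierOp hκ)
  have hUV : fourierOp D hκ * ContinuousLinearMap.adjoint (fourierOp D hκ) = 1 :=
    ContinuousLinearMap.ext (fourierOp_adjoint_fourierOp hκ)
  refine ⟨fun f hf => ⟨isSchwartz_fourierF D hκ.ne' hf, isSchwartz_fourierFStar D hκ.ne' hf⟩,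
    fun g f hg hf => ⟨scalar_fourierF hκ hg hf, scalar_fourierFStar hκ hg hf⟩,
    fourierOp D hκ, ContinuousLinearMap.adjoint (fourierOp D hκ),
    ⟨extU, fun U' h => eq_of_extends extU h⟩, ⟨extV, fun V' h => eq_of_extends extV h⟩,
    AddMonoidHomClass.isometry_of_norm _ (norm_fourierOp hκ),
    AddMonoidHomClass.isometry_of_norm _ (norm_adjoint_fourierOp hκ), rfl,
    ContinuousLinearMap.adjoint_adjoint _, ?_, ?_⟩
  · rw [Unitary.mem_iff, ContinuousLinearMap.star_eq_adjoint]
    exact ⟨hVU, hUV⟩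
  · rw [Unitary.mem_iff, ContinuousLinearMap.star_eq_adjoint, ContinuousLinearMap.adjoint_adjoint]
    exact ⟨hUV, hVU⟩
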